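/- Let $R$ be a noetherian normal Hensel local domain of Krull dimension two, with fraction field $K$. **Conventions.** An $R$-order is an $R$-algebra $A$ that is finitely generated and torsion-free as an $R$-module and such that $K\otimes_R A$ is a central simple $K$-algebra; its degree is $\deg A=\sqrt{\dim_K (K\otimes_R A)}$. It is maximal if no $R$-order in $K\otimes_R A$ strictly contains it. It is normal if it is a reflexive $R$-module and, for every height one prime $\mathfrak p$ of $R$, the Jacobson radical of $A_{\mathfrak p}$ is principal as a left ideal and as a right ideal. The localised Brauer class of an order $A$ is the pair $(\beta,(g_{\mathfrak p})_{\mathfrak p})$, where $\beta\in\operatorname{Br}K$ is the class of $K\otimes_R A$ and, for each height one prime $\mathfrak p$, $g_{\mathfrak p}$ is the number of field factors of the centre of $A_{\mathfrak p}/\operatorname{rad}A_{\mathfrak p}$. A ring is hereditary if all its left ideals and all its right ideals are projective. **Assumptions.** Let $\Delta$ be a maximal $R$-order such that $K\otimes_R\Delta$ is a division ring, let $z\in\Delta$ be a normal element (that is, $z\Delta=\Delta z$) and let $\mathfrak q$ be a height one prime of $R$ such that 1. the support of the $R$-module $\Delta/z\Delta$ is $V(\mathfrak q)$; 2. $z$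 generates the Jacobson radical of $\Delta_{\mathfrak q}$; 3. the ring $\Delta/z\Delta$ is hereditary. For an integer $d\ge 1$ let $\Delta_d=\Delta_d(z)\subseteq M_d(\Delta)$ be the $R$-order of all matrices whose entries strictly below the diagonal lie in $z\Delta$. **Theorem.** Let $\Lambda$ be a normal $R$-order with the same localised Brauer class as $\Delta_d$. Then $n=\deg\Lambda/\deg\Delta_d$ is an integer, $\Lambda\cong M_n(\Delta_d)$ as $R$-algebras, and $\Lambda$ has (left and right) global dimension two. -/

import Mathlib

open scoped TensorProduct

universe u v

namespace NormalOrders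

section Rings

variable {A : Type v} [Ring A]

/-- An element `z` of a ring is normal if the right ideal `zA` and the left ideal `Az` coincide. -/
def IsNormalElement (z : A) : Prop :=
  Set.range (fun a : A => z * a) = Set.range (fun a : A => a * z)

theorem IsNormalElement.isTwoSided {z : A} (hz : IsNormalElement z) :
    (Ideal.span {z} : Ideal A).IsTwoSided := by
  refine ⟨fun {a} b ha => ?_⟩
  obtain ⟨c, rfl⟩ := Ideal.mem_span_singleton'.1 ha
  have h : z * b ∈ Set.range (fun a : A => a * z) := hz ▸ ⟨b, rfl⟩
  obtain ⟨e, he⟩ := h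
  have he' : e * z = z * b := he
  exact Ideal.mem_span_singleton'.2 ⟨c * e, by rw [mul_assoc, he', mul_assoc]⟩

/-- A ring is hereditary if all its left ideals and all its right ideals are projective. -/
def IsHereditary (A : Type v) [Ring A] : Prop :=
  (∀ I : Ideal A, Module.Projective A I) ∧ ∀ I : Ideal Aᵐᵒᵖ, Module.Projective Aᵐᵒᵖ I

/-- The left global dimension: the supremum of the projective dimensions of all left modules. -/
noncomputable def leftGlobalDimension (A : Type v) [Ring A] : WithBot ℕ∞ :=
  ⨆ M : ModuleCat.{v} A, CategoryTheory.projectiveDimension M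

/-- The right global dimension: the left global dimension of the opposite ring. -/
noncomputable def rightGlobalDimension (A : Type v) [Ring A] : WithBot ℕ∞ :=
  leftGlobalDimension Aᵐᵒᵖ

/-- The ring `A` is normal in the local sense: its Jacobson radical is principal as a left ideal
and principal as a right ideal. -/
def HasPrincipalRadical (A : Type v) [Ring A] : Prop :=
  (∃ t : A, ∀ x : A, x ∈ Ring.jacobson A ↔ ∃ a, x = a * t) ∧
    ∃ t : A, ∀ x : A, x ∈ Ring.jacobson A ↔ ∃ a, x = t * a

end Rings

section Orders

variable (R : Type u) [CommRing R] [IsDomain R]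

/-- A finite, torsion-free `R`-algebra `A` is an `R`-order if `K ⊗[R] A` is a central simple
algebra over the fraction field `K` of `R`. -/
structure IsOrder (A : Type v) [Ring A] [Algebra R A] : Prop where
  finite : Module.Finite R A
  torsionFree : Module.IsTorsionFree R A
  isCentral : Algebra.IsCentral (FractionRing R) (FractionRing R ⊗[R] A)
  isSimple : IsSimpleRing (FractionRing R ⊗[R] A)

/-- The order `A` is maximal if no order in `K ⊗[R] A` strictly contains (the image of) `A`.
An `R`-subalgebra of `K ⊗[R] A` which contains `A` automatically spans `K ⊗[R] A` over `K`, so it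
is an order if and only if it is a finitely generated `R`-module. -/
structure IsMaximalOrder (A : Type v) [Ring A] [Algebra R A] : Prop where
  isOrder : IsOrder R A
  maximal : ∀ S : Subalgebra R (FractionRing R ⊗[R] A), Module.Finite R S →
    (Algebra.TensorProduct.includeRight : A →ₐ[R] FractionRing R ⊗[R] A).range ≤ S →
    S = (Algebra.TensorProduct.includeRight : A →ₐ[R] FractionRing R ⊗[R] A).range

/-- The localisation `A_p` of an `R`-algebra at a prime `p` of `R`. -/
abbrev LocalisedAt (A : Type v) [Ring A] [Algebra R A] (p : PrimeSpectrum R) : Type (max u v) :=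
  Localization.AtPrime p.asIdeal ⊗[R] A

/-- The codimension one primes of `R`. -/
abbrev CodimOnePrime : Type u := {p : PrimeSpectrum R // p.asIdeal.height = 1}

/-- An order is normal if it is a reflexive `R`-module and its localisation at each codimension one
prime has principal radical. -/
structure IsNormalOrder (A : Type v) [Ring A] [Algebra R A] : Prop where
  isOrder : IsOrder R A
  reflexive : Module.IsReflexive R A
  principal : ∀ p : CodimOnePrime R, HasPrincipalRadical (LocalisedAt R A p.1)

variable {R} in
/-- The class of `K ⊗[R] A` in the Brauer group of `K`. -/
noncomputable def brauerClass {A : Type v} [Ring A] [Algebra R A] (h : IsOrder R A) :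
    BrauerGroup.{u, max u v} (FractionRing R) :=
  haveI := h.finite
  haveI := h.isCentral
  haveI := h.isSimple
  Quotient.mk (Brauer.CSA_Setoid (FractionRing R))
    (CSA.mk (AlgCat.of (FractionRing R) (FractionRing R ⊗[R] A)))

/-- The number `g_p` of factors in the decomposition of the centre of `A_p / rad A_p` as a product
of fields, counted as the number of maximal ideals of this centre. -/
noncomputable def localIndex (A : Type v) [Ring A] [Algebra R A] (p : CodimOnePrime R) : ℕ :=
  Nat.card (MaximalSpectrum
    (Subring.center (LocalisedAt R A p.1 ⧸ Ring.jacobson (LocalisedAt R A p.1))))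

variable {R} in
/-- The localised Brauer class of an order: its Brauer class together with the function `g`. -/
noncomputable def localisedBrauerClass {A : Type v} [Ring A] [Algebra R A] (h : IsOrder R A) :
    BrauerGroup.{u, max u v} (FractionRing R) × (CodimOnePrime R → ℕ) :=
  (brauerClass h, localIndex R A)

/-- The degree of an order, i.e. the square root of the dimension of `K ⊗[R] A` over `K`. -/
noncomputable def degree (A : Type v) [Ring A] [Algebra R A] : ℝ :=
  Real.sqrt (Module.finrank (FractionRing R) (FractionRing R ⊗[R] A))

variable {R} in
/-- `Δ` is a maximal order in a division ring and `z` is a normal element of `Δ` such that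
`Δ / zΔ` is supported on the codimension one prime `q`, is hereditary, and `z` generates the
radical of `Δ_q`. As `z` is normal, `zΔ = Δz` is the ideal `Ideal.span {z}`. -/
structure IsNiceNormalElement {D : Type v} [Ring D] [Algebra R D] (q : CodimOnePrime R) (z : D) :
    Prop where
  isMaximalOrder : IsMaximalOrder R D
  isDivision : ∀ x : FractionRing R ⊗[R] D, x ≠ 0 → IsUnit x
  isNormal : IsNormalElement z
  support_eq : Module.support R (D ⧸ (Ideal.span {z} : Ideal D)) =
    PrimeSpectrum.zeroLocus (q.1.asIdeal : Set R)
  radical_eq : Ring.jacobson (LocalisedAt R D q.1) =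
    Ideal.span {(1 : Localization.AtPrime q.1.asIdeal) ⊗ₜ[R] z}
  hereditary : haveI := isNormal.isTwoSided
    IsHereditary (D ⧸ (Ideal.span {z} : Ideal D))

variable {R}

/-- The triangular modulo `z` matrix algebra `Δ_d(z)`: the matrices in `M_d(Δ)` whose entries below
the diagonal lie in `zΔ`. -/
def triangularModulo (d : ℕ) {D : Type v} [Ring D] [Algebra R D] (z : D) (hz : IsNormalElement z) :
    Subalgebra R (Matrix (Fin d) (Fin d) D) where
  carrier := {M | ∀ i j, j < i → M i j ∈ Set.range (fun a : D => z * a)}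
  add_mem' {M N} hM hN i j hij := by
    obtain ⟨a, ha⟩ := hM i j hij
    obtain ⟨b, hb⟩ := hN i j hij
    exact ⟨a + b, by simp only [Matrix.add_apply, ← ha, ← hb, mul_add]⟩
  mul_mem' {M N} hM hN i j hij := by
    have key : ∀ k, ∃ a, z * a = M i k * N k j := by
      intro k
      rcases lt_or_ge k i with hk | hk
      · obtain ⟨a, ha⟩ := hM i k hk
        exact ⟨a * N k j, by rw [← ha, mul_assoc]⟩
      · obtain ⟨b, hb⟩ := hN k j (hij.trans_le hk)
        have h : M i k * z ∈ Set.range (fun a : D => z * a) := hz ▸ ⟨M i k, rfl⟩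
        obtain ⟨c, hc⟩ := h
        exact ⟨c * b, by rw [← hb, ← mul_assoc, ← mul_assoc]; exact congrArg (· * b) hc⟩
    choose a ha using key
    exact ⟨∑ k, a k, by simp only [Finset.mul_sum, ha, Matrix.mul_apply]⟩
  algebraMap_mem' r i j hij := ⟨0, by
    rw [Matrix.algebraMap_matrix_apply, if_neg hij.ne']; simp⟩

/-- Every element of `K ⊗[R] A` becomes an element of `A` after clearing denominators. -/
theorem exists_smul_eq_tmul {A : Type v} [Ring A] [Algebra R A] (x : FractionRing R ⊗[R] A) :
    ∃ r : R, r ≠ 0 ∧ ∃ a : A, r • x = 1 ⊗ₜ a := by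
  obtain ⟨⟨a, r⟩, h⟩ := IsLocalizedModule.surj (nonZeroDivisors R)
    (TensorProduct.mk R (FractionRing R) A 1) x
  exact ⟨r, nonZeroDivisors.coe_ne_zero r, a, h⟩

theorem one_tmul_injective {A : Type v} [Ring A] [Algebra R A] [Module.IsTorsionFree R A] {a : A}
    (h : (1 : FractionRing R) ⊗ₜ[R] a = 0) : a = 0 := by
  have h' : (TensorProduct.mk R (FractionRing R) A 1) a =
      (TensorProduct.mk R (FractionRing R) A 1) 0 := by simpa using h
  obtain ⟨c, hc⟩ := (IsLocalizedModule.eq_iff_exists (nonZeroDivisors R) _).1 h'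
  rw [smul_zero] at hc
  exact (smul_eq_zero.1 hc).resolve_left (nonZeroDivisors.coe_ne_zero c)

theorem isCentral_matrix {K : Type u} [Field K] {A : Type v} [Ring A] [Algebra K A]
    [Algebra.IsCentral K A] (d : ℕ) :
    Algebra.IsCentral K (Matrix (Fin d) (Fin d) A) := by
  refine ⟨fun M hM => ?_⟩
  have hM' : M ∈ Set.center (Matrix (Fin d) (Fin d) A) := hM
  rw [Matrix.center_eq_scalar_image] at hM'
  obtain ⟨a, ha, rfl⟩ := hM'
  have hbot : (a : A) ∈ (⊥ : Subalgebra K A) :=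
    Algebra.IsCentral.out (show a ∈ Subalgebra.center K A from ha)
  obtain ⟨k, rfl⟩ := Algebra.mem_bot.1 hbot
  refine Algebra.mem_bot.2 ⟨k, ?_⟩
  ext i j
  simp [Matrix.algebraMap_matrix_apply, Matrix.scalar_apply, Matrix.diagonal_apply]

/-- The natural map `K ⊗ Δ_d → M_d(K ⊗ Δ)`. -/
noncomputable def triangularToMatrix (d : ℕ) {D : Type v} [Ring D] [Algebra R D] (z : D)
    (hz : IsNormalElement z) :
    FractionRing R ⊗[R] (triangularModulo (R := R) d z hz) →ₐ[FractionRing R]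
      Matrix (Fin d) (Fin d) (FractionRing R ⊗[R] D) :=
  Algebra.TensorProduct.lift (Algebra.ofId _ _)
    (((Algebra.TensorProduct.includeRight : D →ₐ[R] FractionRing R ⊗[R] D).mapMatrix).comp
      (triangularModulo (R := R) d z hz).val)
    (fun x _ => Algebra.commutes x _)

theorem triangularToMatrix_one_tmul {d : ℕ} {D : Type v} [Ring D] [Algebra R D] {z : D}
    {hz : IsNormalElement z} (a : triangularModulo (R := R) d z hz) (i j : Fin d) :
    triangularToMatrix (R := R) d z hz ((1 : FractionRing R) ⊗ₜ[R] a) i j = 1 ⊗ₜ[R] a.1 i j := by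
  have e : triangularToMatrix (R := R) d z hz ((1 : FractionRing R) ⊗ₜ[R] a) =
      Algebra.ofId (FractionRing R) _ 1 *
        ((Algebra.TensorProduct.includeRight : D →ₐ[R] FractionRing R ⊗[R] D).mapMatrix a.1) :=
    Algebra.TensorProduct.lift_tmul _ _ _ _ _
  rw [e, map_one, one_mul]
  rfl

theorem triangularToMatrix_bijective {d : ℕ} {D : Type v} [Ring D] [Algebra R D]
    (h : IsOrder R D) (hdiv : ∀ x : FractionRing R ⊗[R] D, x ≠ 0 → IsUnit x) {z : D}
    (hz : IsNormalElement z) (hz0 : z ≠ 0) :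
    Function.Bijective (triangularToMatrix (R := R) d z hz) := by
  have := h.torsionFree
  constructor
  · rw [injective_iff_map_eq_zero]
    intro x hx
    obtain ⟨r, hr, a, ha⟩ := exists_smul_eq_tmul x
    have h1 : triangularToMatrix (R := R) d z hz (1 ⊗ₜ[R] a) = 0 := by
      rw [← ha, ← algebraMap_smul (FractionRing R) r x, map_smul, hx, smul_zero]
    have h2 : a = 0 := by
      apply Subtype.ext
      ext i j
      apply one_tmul_injective (R := R)
      rw [← triangularToMatrix_one_tmul, h1]
      rfl
    rw [h2, TensorProduct.tmul_zero, ← algebraMap_smul (FractionRing R) r x] at ha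
    have hr' : IsUnit (algebraMap R (FractionRing R) r) := by simpa using hr
    exact hr'.smul_eq_zero.1 ha
  · obtain ⟨y, hy⟩ := (hdiv (1 ⊗ₜ[R] z) (fun h0 => hz0 (one_tmul_injective (R := R) h0))).exists_right_inv
    obtain ⟨c, hc, w, hw⟩ := exists_smul_eq_tmul y
    have hzw : z * w = algebraMap R D c := by
      rw [← sub_eq_zero]
      apply one_tmul_injective (R := R)
      have e1 : (1 : FractionRing R) ⊗ₜ[R] (z * w) = c • (1 : FractionRing R ⊗[R] D) := by
        rw [← hy, ← mul_smul_comm, hw, Algebra.TensorProduct.tmul_mul_tmul, one_mul]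
      rw [TensorProduct.tmul_sub, e1, Algebra.algebraMap_eq_smul_one, TensorProduct.tmul_smul,
        Algebra.TensorProduct.one_def, sub_self]
    have hsingle : ∀ (i j : Fin d) (b : D), Matrix.single i j (algebraMap R D c * b) ∈
        triangularModulo (R := R) d z hz := by
      intro i j b i' j' _
      by_cases hij : i = i' ∧ j = j'
      · obtain ⟨rfl, rfl⟩ := hij
        exact ⟨w * b, by rw [Matrix.single_apply_same, ← hzw, mul_assoc]⟩
      · exact ⟨0, by rw [Matrix.single_apply, if_neg hij]; exact mul_zero z⟩
    have hrange : ∀ (i j : Fin d) (x : FractionRing R ⊗[R] D),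
        Matrix.single i j x ∈ (triangularToMatrix (R := R) d z hz).toLinearMap.range := by
      intro i j x
      obtain ⟨r, hr, b, hb⟩ := exists_smul_eq_tmul x
      have hrc : algebraMap R (FractionRing R) (c * r) ≠ 0 := by simpa using ⟨hc, hr⟩
      have hx : x = (algebraMap R (FractionRing R) (c * r))⁻¹ •
          ((1 : FractionRing R) ⊗ₜ[R] (algebraMap R D c * b)) := by
        rw [eq_inv_smul_iff₀ hrc, algebraMap_smul, mul_smul, hb, ← Algebra.smul_def,
          TensorProduct.tmul_smul]
      refine ⟨(algebraMap R (FractionRing R) (c * r))⁻¹ • (1 ⊗ₜ[R] ⟨_, hsingle i j b⟩), ?_⟩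
      rw [map_smul, hx, ← Matrix.smul_single]
      refine congrArg _ (Matrix.ext fun i' j' => ?_)
      refine (triangularToMatrix_one_tmul (R := R) (hz := hz) ⟨_, hsingle i j b⟩ i' j').trans ?_
      simp only [Matrix.single_apply]
      split_ifs <;> simp
    intro M
    have hM : M ∈ (triangularToMatrix (R := R) d z hz).toLinearMap.range := by
      rw [Matrix.matrix_eq_sum_single M]
      exact Submodule.sum_mem _ fun i _ => Submodule.sum_mem _ fun j _ => hrange i j _
    exact hM

theorem isOrder_triangularModulo [IsNoetherianRing R] {d : ℕ} (hd : 0 < d) {D : Type v} [Ring D]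
    [Algebra R D] (h : IsOrder R D) (hdiv : ∀ x : FractionRing R ⊗[R] D, x ≠ 0 → IsUnit x)
    {z : D} (hz : IsNormalElement z) (hz0 : z ≠ 0) :
    IsOrder R (triangularModulo (R := R) d z hz) := by
  have := h.finite
  have := h.torsionFree
  have := h.isCentral
  have := h.isSimple
  have : Nonempty (Fin d) := ⟨⟨0, hd⟩⟩
  let e := AlgEquiv.ofBijective _ (triangularToMatrix_bijective (d := d) h hdiv hz hz0)
  have := isCentral_matrix (K := FractionRing R) (A := FractionRing R ⊗[R] D) d
  refine ⟨?_, ?_, Algebra.IsCentral.of_algEquiv _ _ _ e.symm, IsSimpleRing.of_ringEquiv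
    e.symm.toRingEquiv inferInstance⟩
  · have : Module.Finite R (Matrix (Fin d) (Fin d) D) :=
      inferInstanceAs (Module.Finite R (Fin d → Fin d → D))
    exact Module.Finite.of_injective (triangularModulo (R := R) d z hz).val.toLinearMap
      Subtype.val_injective
  · have : Module.IsTorsionFree R (Matrix (Fin d) (Fin d) D) :=
      inferInstanceAs (Module.IsTorsionFree R (Fin d → Fin d → D))
    exact Function.Injective.moduleIsTorsionFree
      (N := Matrix (Fin d) (Fin d) D) Subtype.val Subtype.val_injective (fun _ _ => rfl)

theorem IsNiceNormalElement.ne_zero {D : Type v} [Ring D] [Algebra R D]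
    {q : CodimOnePrime R} {z : D} (h : IsNiceNormalElement q z) : z ≠ 0 := by
  rintro rfl
  have := h.isMaximalOrder.isOrder.torsionFree
  have := h.isMaximalOrder.isOrder.isSimple
  have : Nontrivial D := by
    by_contra hD
    rw [not_nontrivial_iff_subsingleton] at hD
    have h1 : (1 : FractionRing R ⊗[R] D) = 0 := by
      rw [Algebra.TensorProduct.one_def, Subsingleton.elim (1 : D) 0, TensorProduct.tmul_zero]
    exact one_ne_zero h1
  have hsup := Module.support_subset_of_injective (R := R)
    (((Ideal.span {(0 : D)} : Ideal D).mkQ).restrictScalars R) (by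
      intro a b hab
      have h2 : a - b ∈ (Ideal.span {(0 : D)} : Ideal D) := (Submodule.Quotient.eq _).1 hab
      rw [Ideal.span_singleton_eq_bot.2 rfl] at h2
      exact sub_eq_zero.1 h2)
  rw [Module.support_of_noZeroSMulDivisors, h.support_eq] at hsup
  have hmem := hsup (Set.mem_univ (⟨⊥, Ideal.isPrime_bot⟩ : PrimeSpectrum R))
  have hle : q.1.asIdeal ≤ ⊥ := fun x hx => (PrimeSpectrum.mem_zeroLocus _ _).1 hmem hx
  have hq := q.2
  rw [le_bot_iff.1 hle] at hq
  simp at hq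

/-- Under the assumptions on `Δ` and `z`, the algebra `Δ_d(z)` is an order. -/
theorem IsNiceNormalElement.isOrder_triangularModulo [IsNoetherianRing R] {D : Type v} [Ring D]
    [Algebra R D] {q : CodimOnePrime R} {z : D} (h : IsNiceNormalElement q z) {d : ℕ}
    (hd : 0 < d) : IsOrder R (triangularModulo (R := R) d z h.isNormal) :=
  NormalOrders.isOrder_triangularModulo hd h.isMaximalOrder.isOrder h.isDivision h.isNormal
    h.ne_zero

end Orders

end NormalOrders

set_option linter.unusedSectionVars false

/-! Write `D` for Δ, `m` for the maximal ideal of `R` and `F` for `D_q / rad D_q`. Depth at least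
two appears throughout as `IsSaturated`; reflexive modules and maximal orders have it.

Local structure of `D`. An order in a division ring over a henselian normal domain is a local ring
(`isLocalRing_of_isIntegral`). Its quotient `D ⧸ zD` is local and hereditary, hence a domain, and
any two of its principal left ideals, or right ideals, are comparable, since finiteness over `R`
supplies linear relations between any two elements. These properties are collected in
`IsUniformizing`. As `z` lies in the radical of `D`, Nakayama's lemma gives the tool used three
times below: a chain `X = N 0 ≥ ... ≥ N e = zX` of `D`-modules with quotients torsion-free over `D ⧸
zD` has a basis of `X` adapted to it (`exists_adapted_basis`). In particular finite torsion-free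
`D`-modules of depth two are free.

Position of `L`. Equality of Brauer classes embeds `L` with full rank into some `M_N(D)`, through
its action on a saturated, hence free, `D`-lattice. Since `L` has depth two, it is the intersection
of its localisations at height one primes. At `p ≠ q` the order `Δ_d` is a full matrix algebra. An
order with principal radical strictly inside `M_N(D_p)` has more central idempotents modulo its
radical than `M_N(D_p)` (`card_lt_card_maximalSpectrum_center`), so equality of the indices gives
`L_p = M_N(D_p)`. At `q` let `t` generate the radical of `L_q` and let `T` be its residue class in
`M_N(F)`, a nilpotent matrix. Then `L_q` consists of exactly those matrices whose residues preserve
the row spaces of all powers of `T` (`mem_range_iff_forall_exists`). These row spaces pull back to a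
chain of lattices between `D^N` and `zD^N`, and a basis adapted to it conjugates `L` onto an algebra
of block triangular matrices modulo `z`.

Sizes. The number of blocks is the index at `q`, which is `d`. Factoring matrix units through the
generator `t` shows that the block sizes decrease weakly in cyclic order, so they all have the same
value `n` (`card_block_eq`). Hence `L ≅ M_n(Δ_d)`, and the ratio of degrees is `n`.

Global dimension. Over a block triangular order finite torsion-free modules of depth two are
projective: an adapted basis of one corner, for the chain formed by the images of the other corners,
splits the module off a free one. Second syzygies have depth two, so finite modules have projective
dimension at most two, and Auslander's theorem extends the bound to all modules. The bound is
attained by `L ⧸ mL`, because `mL` does not have depth two. The hypotheses are symmetric under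
passage to the opposite ring, which gives the right-hand statement. -/

namespace NormalOrders

/-! ### Depth two over a two-dimensional normal local domain -/

section Commutative

open IsLocalRing

/-- A torsion-free module `X` over a local domain is saturated if `X ⧸ c X` has no nonzero elements
killed by the maximal ideal, for all `c ≠ 0`; this says that `X` has depth at least two. -/
def IsSaturated (R : Type*) [CommRing R] [IsLocalRing R] (X : Type*) [AddCommGroup X]
    [Module R X] : Prop :=
  ∀ c : R, c ≠ 0 → ∀ x : X, (∀ a ∈ maximalIdeal R, ∃ y : X, a • x = c • y) → ∃ y : X, x = c • y

section

variable {R : Type*} [CommRing R] [IsLocalRing R]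

theorem IsSaturated.of_pow {X : Type*} [AddCommGroup X] [Module R X] (hX : IsSaturated R X) {c : R}
    (hc : c ≠ 0) (k : ℕ) : ∀ x : X, (∀ a ∈ maximalIdeal R ^ k, ∃ y : X, a • x = c • y) →
      ∃ y : X, x = c • y := by
  induction k with
  | zero => intro x h; simpa using h 1 (by simp)
  | succ k ih =>
    intro x h
    refine hX c hc x fun b hb => ih _ fun a ha => ?_
    rw [smul_smul]
    exact h _ (by rw [pow_succ]; exact Ideal.mul_mem_mul ha hb)

theorem IsSaturated.of_linearEquiv {X Y : Type*} [AddCommGroup X] [Module R X] [AddCommGroup Y]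
    [Module R Y] (hX : IsSaturated R X) (e : X ≃ₗ[R] Y) : IsSaturated R Y := by
  intro c hc y h
  obtain ⟨x, hx⟩ := hX c hc (e.symm y) fun a ha => by
    obtain ⟨y', hy'⟩ := h a ha
    exact ⟨e.symm y', by rw [← map_smul, hy', map_smul]⟩
  exact ⟨e x, by rw [← map_smul, ← hx, e.apply_symm_apply]⟩

theorem IsSaturated.pi {ι : Type*} {X : ι → Type*} [∀ i, AddCommGroup (X i)] [∀ i, Module R (X i)]
    (hX : ∀ i, IsSaturated R (X i)) : IsSaturated R (∀ i, X i) := by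
  intro c hc x h
  have key : ∀ i, ∃ y : X i, x i = c • y := fun i => hX i c hc (x i) fun a ha => by
    obtain ⟨y, hy⟩ := h a ha
    exact ⟨y i, congrFun hy i⟩
  choose y hy using key
  exact ⟨y, funext hy⟩

/-- A submodule of a saturated module with torsion-free quotient is saturated. -/
theorem IsSaturated.of_injective {X Y : Type*} [AddCommGroup X] [Module R X] [AddCommGroup Y]
    [Module R Y] (hX : IsSaturated R X) (f : Y →ₗ[R] X) (hf : Function.Injective f)
    (h : ∀ c : R, c ≠ 0 → ∀ x, c • x ∈ f.range → x ∈ f.range) : IsSaturated R Y := by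
  intro c hc y hy
  obtain ⟨x, hx⟩ := hX c hc (f y) fun a ha => by
    obtain ⟨y', hy'⟩ := hy a ha
    exact ⟨f y', by rw [← map_smul, hy', map_smul]⟩
  obtain ⟨y', rfl⟩ := h c hc x ⟨y, hx⟩
  exact ⟨y', hf (by rw [hx, map_smul])⟩

/-- A direct summand of a saturated module is saturated. -/
theorem IsSaturated.of_retract {X Y : Type*} [AddCommGroup X] [Module R X] [AddCommGroup Y]
    [Module R Y] (hX : IsSaturated R X) (f : Y →ₗ[R] X) (g : X →ₗ[R] Y)
    (h : ∀ y, g (f y) = y) : IsSaturated R Y := by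
  intro c hc y hy
  obtain ⟨x, hx⟩ := hX c hc (f y) fun a ha => by
    obtain ⟨y', hy'⟩ := hy a ha
    exact ⟨f y', by rw [← map_smul, hy', map_smul]⟩
  exact ⟨g x, by rw [← h y, hx, map_smul]⟩

end

section

variable (R : Type*) [CommRing R] [IsDomain R] [IsNoetherianRing R] [IsLocalRing R]

variable {R} in
theorem height_maximalIdeal (hdim : ringKrullDim R = 2) : (maximalIdeal R).height = 2 := by
  have h := IsLocalRing.maximalIdeal_height_eq_ringKrullDim (R := R)
  rw [hdim] at h
  exact WithBot.coe_injective h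

variable {R} in
theorem height_eq_one_of_ne (hdim : ringKrullDim R = 2) (p : Ideal R) [p.IsPrime] (h0 : p ≠ ⊥)
    (hm : p ≠ maximalIdeal R) : p.height = 1 := by
  have h1 : p < maximalIdeal R := lt_of_le_of_ne (le_maximalIdeal Ideal.IsPrime.ne_top') hm
  have h2 := Ideal.height_add_one_le_of_lt_of_isPrime h1
  rw [height_maximalIdeal hdim] at h2
  have h3 : p.height ≠ 0 := fun h => h0 (Ideal.height_eq_zero_iff_eq_bot.1 h)
  have h4 : p.height ≠ ⊤ := by
    intro h; rw [h] at h2; simp at h2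
  lift p.height to ℕ using h4 with n
  norm_cast at *
  omega

variable {R} in
-- In dimension two a nonzero prime is maximal or of height one, so no prime other than the maximal
-- ideal can contain `I`.
theorem exists_maximalIdeal_pow_le (hdim : ringKrullDim R = 2) (I : Ideal R) (h0 : I ≠ ⊥)
    (h1 : ∀ p : Ideal R, p.IsPrime → p.height = 1 → ¬ I ≤ p) : ∃ k, maximalIdeal R ^ k ≤ I := by
  refine Ideal.exists_pow_le_of_le_radical_of_fg ?_ (IsNoetherian.noetherian _)
  rw [Ideal.radical_eq_sInf]
  refine le_sInf ?_
  rintro p ⟨hp, hp'⟩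
  by_cases hm : p = maximalIdeal R
  · exact hm.ge
  · exact absurd hp (h1 p hp' (height_eq_one_of_ne hdim p (fun h => h0 (by
      rw [h] at hp; exact le_bot_iff.1 hp)) hm))

variable {R} in
theorem exists_maximalIdeal_pow_le_of_lt (hdim : ringKrullDim R = 2) (q I : Ideal R) [q.IsPrime]
    (hq : q.height = 1) (h : q < I) : ∃ k, maximalIdeal R ^ k ≤ I := by
  refine exists_maximalIdeal_pow_le hdim I (fun h0 => ?_) fun p hp hp1 hle => ?_
  · rw [h0] at h; exact not_lt_bot h
  · have := Ideal.height_add_one_le_of_lt_of_isPrime (h.trans_le hle)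
    rw [hq, hp1] at this
    norm_cast at this

/-- Put `x = b / c`, so that `x m ⊆ R`. If `x m ⊆ m`, then `x` is integral by the determinant trick
and lies in `R`. Otherwise some `x a` is a unit, so `m` is generated by `a`, against Krull's
principal ideal theorem. -/
theorem isSaturated_self [IsIntegrallyClosed R] (hdim : ringKrullDim R = 2) : IsSaturated R R := by
  intro c hc b h
  have hcK : algebraMap R (FractionRing R) c ≠ 0 := IsFractionRing.to_map_eq_zero_iff.not.mpr hc
  let x : FractionRing R := algebraMap R (FractionRing R) b / algebraMap R (FractionRing R) c
  have hx : ∀ a ∈ maximalIdeal R, ∃ y : R, algebraMap R (FractionRing R) y = x * algebraMap R (FractionRing R) a := by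
    intro a ha
    obtain ⟨y, hy⟩ := h a ha
    refine ⟨y, ?_⟩
    have : algebraMap R (FractionRing R) a * algebraMap R (FractionRing R) b = algebraMap R (FractionRing R) c * algebraMap R (FractionRing R) y := by
      rw [← map_mul, ← map_mul]; exact congrArg _ hy
    simp only [x]
    field_simp
    linear_combination -this
  suffices ∃ y, algebraMap R (FractionRing R) y = x by
    obtain ⟨y, hy⟩ := this
    refine ⟨y, IsFractionRing.injective R (FractionRing R) ?_⟩
    rw [smul_eq_mul, map_mul, hy, mul_div_cancel₀ _ hcK]
  have hm0 : maximalIdeal R ≠ ⊥ := fun h0 => by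
    have := height_maximalIdeal hdim
    rw [h0, Ideal.height_bot] at this
    exact absurd this (by norm_num)
  by_cases hstab : ∀ a ∈ maximalIdeal R, ∃ y ∈ maximalIdeal R,
      algebraMap R (FractionRing R) y = x * algebraMap R (FractionRing R) a
  · have hint : IsIntegral R x := by
      refine isIntegral_of_smul_mem_submodule
        (Submodule.map (Algebra.linearMap R (FractionRing R)) (maximalIdeal R)) ?_
        ((IsNoetherian.noetherian _).map _) x ?_
      · obtain ⟨a, ha, ha0⟩ := Submodule.exists_mem_ne_zero_of_ne_bot hm0
        rw [Submodule.ne_bot_iff]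
        exact ⟨_, ⟨a, ha, rfl⟩, IsFractionRing.to_map_eq_zero_iff.not.mpr ha0⟩
      · rintro _ ⟨a, ha, rfl⟩
        obtain ⟨y, hy, hy'⟩ := hstab a ha
        exact ⟨y, hy, hy'⟩
    exact IsIntegrallyClosed.isIntegral_iff.1 hint
  · exfalso
    push Not at hstab
    obtain ⟨a, ha, hay⟩ := hstab
    obtain ⟨y, hy⟩ := hx a ha
    have hyu : IsUnit y := by
      by_contra hyu
      exact hay y ((mem_maximalIdeal _).2 hyu) hy
    obtain ⟨w, hw⟩ := hyu.exists_left_inv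
    have hle : maximalIdeal R ≤ Ideal.span {a} := by
      intro b' hb'
      obtain ⟨y', hy'⟩ := hx b' hb'
      refine Ideal.mem_span_singleton'.2 ⟨w * y', IsFractionRing.injective R (FractionRing R) ?_⟩
      have hwK : algebraMap R (FractionRing R) w * algebraMap R (FractionRing R) y = 1 := by rw [← map_mul, hw, map_one]
      rw [map_mul, map_mul, hy']
      rw [hy] at hwK
      linear_combination algebraMap R (FractionRing R) b' * hwK
    have heq : maximalIdeal R = Ideal.span {a} :=
      le_antisymm hle ((Ideal.span_singleton_le_iff_mem _).2 ha)
    have hle1 := Ideal.height_le_one_of_isPrincipal_of_mem_minimalPrimes (Ideal.span {a})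
      (maximalIdeal R) (by
        rw [← heq, Ideal.minimalPrimes_eq_subsingleton_self]; rfl)
    rw [height_maximalIdeal hdim] at hle1
    norm_cast at hle1

variable {R}

/-- Every functional takes `x` into `cR`, so `f ↦ f x / c` is an element of the bidual; reflexivity
realises it by a vector. -/
theorem IsSaturated.of_isReflexive (hR : IsSaturated R R) (X : Type*) [AddCommGroup X] [Module R X]
    [Module.IsReflexive R X] : IsSaturated R X := by
  intro c hc x h
  have key : ∀ f : Module.Dual R X, ∃ r : R, f x = c * r := fun f => hR c hc (f x) fun a ha => by
    obtain ⟨y, hy⟩ := h a ha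
    exact ⟨f y, by rw [← map_smul, hy, map_smul]⟩
  choose g hg using key
  let G : Module.Dual R (Module.Dual R X) :=
    { toFun := g
      map_add' := fun f f' => mul_left_cancel₀ hc (by
        rw [← hg, mul_add, ← hg, ← hg]; rfl)
      map_smul' := fun r f => mul_left_cancel₀ hc (by
        rw [← hg, RingHom.id_apply, smul_eq_mul, mul_left_comm, ← hg]; rfl) }
  obtain ⟨y, hy⟩ := (Module.bijective_dual_eval R X).2 G
  refine ⟨y, (Module.bijective_dual_eval R X).1 (LinearMap.ext fun f => ?_)⟩
  have : f y = g f := congrArg (fun F : Module.Dual R (Module.Dual R X) => F f) hy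
  simp [Module.Dual.eval_apply, hg f, this]

end

end Commutative

end NormalOrders

namespace NormalOrders

/-! ### Henselian descent: integral domains over `R` are local -/

section Hensel

open IsLocalRing Polynomial
open scoped Pointwise

/-- Finitely many maximal ideals different from `n` have a common element congruent to one
modulo `n`. -/
theorem exists_mem_sub_one_mem {C : Type*} [CommRing C] (n : Ideal C) [n.IsMaximal]
    (s : Set (Ideal C)) (hs : s.Finite) (h : ∀ P ∈ s, P.IsMaximal ∧ P ≠ n) :
    ∃ v : C, v - 1 ∈ n ∧ ∀ P ∈ s, v ∈ P := by
  induction s, hs using Set.Finite.induction_on with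
  | empty => exact ⟨1, by simp, by simp⟩
  | @insert P s hP hs ih =>
    obtain ⟨v, hv, hv'⟩ := ih fun Q hQ => h Q (Set.mem_insert_of_mem _ hQ)
    have hP' := h P (Set.mem_insert _ _)
    have hsup : P ⊔ n = ⊤ := Ideal.IsMaximal.coprime_of_ne hP'.1 inferInstance hP'.2
    obtain ⟨a, ha, b, hb, hab⟩ := Submodule.mem_sup.1 ((Ideal.eq_top_iff_one _).1 hsup)
    refine ⟨a * v, ?_, ?_⟩
    · have : a * v - 1 = (v - 1) - v * b := by linear_combination v * hab
      rw [this]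
      exact n.sub_mem hv (n.mul_mem_left _ hb)
    · rintro Q (rfl | hQ)
      · exact Q.mul_mem_right _ ha
      · exact Q.mul_mem_left _ (hv' Q hQ)

/-- If a finite group acts on a domain `S` with invariants a henselian local ring, then `S` has
only one maximal ideal. -/
theorem eq_of_isMaximal_of_isInvariant {R S G : Type*} [CommRing R] [HenselianLocalRing R]
    [CommRing S] [IsDomain S] [Algebra R S] [FaithfulSMul R S] [Algebra.IsIntegral R S]
    [Group G] [Finite G] [MulSemiringAction G S] [SMulCommClass G R S] [Algebra.IsInvariant R S G]
    (n n' : Ideal S) [hn : n.IsMaximal] [hn' : n'.IsMaximal] : n = n' := by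
  classical
  cases nonempty_fintype G
  by_contra hne
  obtain ⟨v, hv, hv'⟩ := exists_mem_sub_one_mem n
    (insert n' ((fun g : G => g • n) '' {g | g • n ≠ n})) ((Set.toFinite _).insert _) (by
      rintro P (rfl | ⟨g, hg, rfl⟩)
      · exact ⟨hn', Ne.symm hne⟩
      · exact ⟨Ideal.map_isMaximal_of_equiv (MulSemiringAction.toRingEquiv G S g) , hg⟩)
  have hvn : ∀ g : G, g • n = n → g • v - 1 ∈ n := fun g hg => by
    rw [← hg, show g • v - 1 = g • (v - 1) by rw [smul_sub, smul_one]]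
    exact Ideal.smul_mem_pointwise_smul _ _ _ hv
  -- The norm `u` of `v` over the stabiliser of `n` is `1` modulo `n` and lies in `n'`. It is fixed
  -- by `H`, and every conjugate different from `u` lies in `n`.
  let H := MulAction.stabilizer G n
  let u : S := ∏ g : H, g.1 • v
  have hun : u - 1 ∈ n := by
    rw [← Ideal.Quotient.eq, map_one, map_prod]
    refine Finset.prod_eq_one fun g _ => ?_
    rw [← map_one (Ideal.Quotient.mk n), Ideal.Quotient.eq]
    exact hvn _ g.2
  have hu' : u ∈ n' := by
    refine n'.mem_of_dvd (Finset.dvd_prod_of_mem _ (Finset.mem_univ (1 : H))) ?_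
    simpa using hv' n' (Set.mem_insert _ _)
  have hHu : ∀ h ∈ H, h • u = u := fun h hh => by
    simp only [u]
    rw [Finset.smul_prod']
    refine Fintype.prod_equiv (Equiv.mulLeft (⟨h, hh⟩ : H)) _ _ fun g => ?_
    simp [mul_smul]
  have hgu : ∀ g : G, g • u ≠ u → g • u ∈ n := fun g hg => by
    have hg' : g⁻¹ • n ≠ n := fun h => hg (hHu g (by
      rw [MulAction.mem_stabilizer_iff]; exact (inv_smul_eq_iff.1 h).symm))
    have h1 : v ∈ g⁻¹ • n := hv' _ (Set.mem_insert_of_mem _ ⟨g⁻¹, hg', rfl⟩)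
    have h2 : u ∈ g⁻¹ • n := by
      refine (g⁻¹ • n).mem_of_dvd (Finset.dvd_prod_of_mem _ (Finset.mem_univ (1 : H))) ?_
      simpa using h1
    rwa [Ideal.mem_inv_pointwise_smul_iff] at h2
  -- Only the distinct conjugates are used: then `f` is congruent to `(X - 1) X ^ k` modulo `n`, and
  -- `1` is a simple root.
  let s : Finset S := Finset.univ.image fun g : G => g • u
  have hus : u ∈ s := Finset.mem_image.2 ⟨1, Finset.mem_univ _, one_smul _ _⟩
  let f : S[X] := ∏ x ∈ s, (X - C x)
  have hf : f.Monic := monic_prod_of_monic _ _ fun x _ => monic_X_sub_C x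
  have hfinv : ∀ g : G, f.map (MulSemiringAction.toRingHom G S g) = f := fun g => by
    rw [Polynomial.map_prod]
    refine Finset.prod_bij (fun x _ => g • x) ?_ ?_ ?_ ?_
    · rintro x hx
      obtain ⟨g', -, rfl⟩ := Finset.mem_image.1 hx
      exact Finset.mem_image.2 ⟨g * g', Finset.mem_univ _, mul_smul _ _ _⟩
    · intro x _ y _ hxy
      exact MulAction.injective g hxy
    · intro x hx
      obtain ⟨g', -, rfl⟩ := Finset.mem_image.1 hx
      exact ⟨(g⁻¹ * g') • u, Finset.mem_image.2 ⟨_, Finset.mem_univ _, rfl⟩, by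
        rw [← mul_smul, mul_inv_cancel_left]⟩
    · intro x _
      simp
  have hlift : f ∈ Polynomial.lifts (algebraMap R S) := by
    rw [Polynomial.lifts_iff_coeff_lifts]
    intro k
    obtain ⟨a, ha⟩ := Algebra.IsInvariant.isInvariant (A := R) (G := G) (f.coeff k) fun g => by
      conv_rhs => rw [← hfinv g]
      rw [Polynomial.coeff_map]; rfl
    exact ⟨a, ha⟩
  obtain ⟨F, hF, -, hFm⟩ := Polynomial.lifts_and_natDegree_eq_and_monic hlift hf
  have hmn : ∀ r : R, algebraMap R S r ∈ n ↔ r ∈ maximalIdeal R := fun r => by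
    have : (n.comap (algebraMap R S)).IsMaximal := Ideal.isMaximal_comap_of_isIntegral_of_isMaximal n
    rw [← eq_maximalIdeal this]; rfl
  have hev : ∀ (P : R[X]), algebraMap R S (P.eval 1) = (P.map (algebraMap R S)).eval 1 := by
    intro P; rw [Polynomial.eval_map, ← Polynomial.eval₂_at_apply, map_one]
  have hsplit : f = (X - C u) * ∏ x ∈ s.erase u, (X - C x) :=
    (Finset.mul_prod_erase s (fun x => X - Polynomial.C x) hus).symm
  -- The lifted root `a` lies in `R` and is a conjugate of `u`. Being invariant, it equals `u`; it
  -- is a unit because `a ≡ 1`, while `u ∈ n'`.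
  obtain ⟨a, ha, ha1⟩ := HenselianLocalRing.is_henselian F hFm 1 (by
      rw [← hmn, hev, hF, hsplit, eval_mul]
      refine n.mul_mem_right _ ?_
      rw [eval_sub, eval_X, eval_C, ← neg_sub]
      exact n.neg_mem hun) (by
      by_contra hnu
      rw [← mem_nonunits_iff, ← mem_maximalIdeal, ← hmn, hev, ← derivative_map, hF, hsplit,
        derivative_mul, eval_add, eval_mul, eval_mul] at hnu
      have h1 : eval 1 (X - C u) * eval 1 (derivative (∏ x ∈ s.erase u, (X - C x))) ∈ n := by
        refine n.mul_mem_right _ ?_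
        rw [eval_sub, eval_X, eval_C, ← neg_sub]
        exact n.neg_mem hun
      have h2 := (n.add_mem_iff_left h1).1 hnu
      have h3 : eval 1 (derivative (X - C u)) * eval 1 (∏ x ∈ s.erase u, (X - C x)) - 1 ∈ n := by
        rw [← Ideal.Quotient.eq, map_one, derivative_X_sub_C, eval_one, one_mul, eval_prod, map_prod]
        refine Finset.prod_eq_one fun x hx => ?_
        rw [Finset.mem_erase] at hx
        obtain ⟨g, -, rfl⟩ := Finset.mem_image.1 hx.2
        rw [← map_one (Ideal.Quotient.mk n), Ideal.Quotient.eq, eval_sub, eval_X, eval_C]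
        simpa using hgu g hx.1
      have h4 := n.sub_mem h2 h3
      rw [sub_sub_cancel] at h4
      exact hn.ne_top ((Ideal.eq_top_iff_one _).2 h4))
  have hroot : f.eval (algebraMap R S a) = 0 := by
    rw [← hF, Polynomial.eval_map_algebraMap, aeval_algebraMap_apply, coe_aeval_eq_eval, ha.eq_zero,
      map_zero]
  rw [eval_prod, Finset.prod_eq_zero_iff] at hroot
  obtain ⟨x, hx, hxa⟩ := hroot
  obtain ⟨g, -, rfl⟩ := Finset.mem_image.1 hx
  rw [eval_sub, eval_X, eval_C, sub_eq_zero] at hxa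
  have hua : u = algebraMap R S a := by
    have : u = g⁻¹ • algebraMap R S a := by rw [hxa, inv_smul_smul]
    rw [this, smul_algebraMap]
  have hau : IsUnit a := by
    by_contra h
    have h1 : a ∈ maximalIdeal R := h
    have h2 := (maximalIdeal R).sub_mem h1 ha1
    rw [sub_sub_cancel] at h2
    exact (maximalIdeal.isMaximal R).ne_top ((Ideal.eq_top_iff_one _).2 h2)
  exact hn'.ne_top (Ideal.eq_top_of_isUnit_mem _ hu' (hua ▸ hau.map (algebraMap R S)))

open Polynomial in
/-- The inverse of `a` is a polynomial in `a` if it is integral. -/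
theorem exists_aeval_mul_eq_one {R S : Type*} [CommRing R] [CommRing S] [Algebra R S] {a b : S}
    (hab : a * b = 1) (hb : IsIntegral R b) : ∃ h : R[X], a * aeval a h = 1 := by
  obtain ⟨p, hp, hpb⟩ := hb
  let _ : Invertible b := ⟨a, hab, by rw [mul_comm, hab]⟩
  -- Reversing a monic equation of `b` gives an equation of `a` with constant term `1`, which
  -- exhibits the inverse of `a` as a polynomial in `a`.
  have h1 := Polynomial.eval₂_reverse_mul_pow (algebraMap R S) b p
  rw [hpb] at h1
  have h2 : aeval a p.reverse = 0 := by
    have h3 : aeval a p.reverse * b ^ p.natDegree = 0 := h1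
    calc aeval a p.reverse = aeval a p.reverse * b ^ p.natDegree * a ^ p.natDegree := by
          rw [mul_assoc, ← mul_pow, mul_comm b a, hab, one_pow, mul_one]
      _ = 0 := by rw [h3, zero_mul]
  rw [← Polynomial.divX_mul_X_add p.reverse, coeff_zero_reverse, hp.leadingCoeff] at h2
  refine ⟨-p.reverse.divX, ?_⟩
  simp only [map_add, map_mul, aeval_X, map_one, map_neg] at h2 ⊢
  linear_combination -h2

open Polynomial in
/-- Over a henselian normal local domain, a monic polynomial which is irreducible and separable
over the fraction field cannot vanish at both `0` and `1` modulo the maximal ideal. -/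
theorem isUnit_eval_zero_or_one {R : Type*} [CommRing R] [IsDomain R] [IsIntegrallyClosed R]
    [HenselianLocalRing R] (K : Type*) [Field K] [Algebra R K] [IsFractionRing R K] (g : R[X])
    (hg : g.Monic) (hirr : Irreducible (g.map (algebraMap R K)))
    (hsep : (g.map (algebraMap R K)).Separable) : IsUnit (g.eval 0) ∨ IsUnit (g.eval 1) := by
  let E := (g.map (algebraMap R K)).SplittingField
  have : IsGalois K E := IsGalois.of_separable_splitting_field hsep
  have hinj : Function.Injective (algebraMap R E) := by
    rw [IsScalarTower.algebraMap_eq R K E]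
    exact (algebraMap K E).injective.comp (IsFractionRing.injective R K)
  have : FaithfulSMul R (integralClosure R E) := by
    rw [faithfulSMul_iff_algebraMap_injective]
    intro x y hxy
    exact hinj (congrArg Subtype.val hxy)
  -- Galois invariants lie in `K`, and integral elements of `K` lie in `R`; hence the integral
  -- closure of `R` in `E` has a unique maximal ideal.
  have : Algebra.IsInvariant R (integralClosure R E) Gal(E/K) := by
    refine ⟨fun b hb => ?_⟩
    obtain ⟨k, hk⟩ := IntermediateField.mem_bot.1 ((IsGalois.mem_bot_iff_fixed (F := K) b.1).2
      fun σ => congrArg Subtype.val (hb σ))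
    have hint : IsIntegral R k := by
      rw [← isIntegral_algHom_iff (IsScalarTower.toAlgHom R K E) (algebraMap K E).injective]
      exact hk ▸ b.2
    obtain ⟨r, rfl⟩ := IsIntegrallyClosed.isIntegral_iff.1 hint
    exact ⟨r, Subtype.ext ((IsScalarTower.algebraMap_apply R K E r).trans hk)⟩
  have hmax : ∀ n n' : Ideal (integralClosure R E), n.IsMaximal → n'.IsMaximal → n = n' :=
    fun n n' _ _ => eq_of_isMaximal_of_isInvariant (R := R) (G := Gal(E/K)) n n'
  obtain ⟨α, hα⟩ : ∃ α : E, aeval α (g.map (algebraMap R K)) = 0 := by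
    obtain ⟨α, hα⟩ := (SplittingField.splits (g.map (algebraMap R K))).exists_eval_eq_zero (by
      rw [degree_map]; exact (degree_pos_of_irreducible hirr).ne')
    exact ⟨α, by rwa [eval_map_algebraMap] at hα⟩
  have hαR : aeval α g = 0 := by rwa [aeval_map_algebraMap] at hα
  let x : integralClosure R E := ⟨α, g, hg, hαR⟩
  have hdvd : ∀ P : R[X], aeval α P = 0 → g ∣ P := fun P hP => by
    rw [← Polynomial.map_dvd_map (algebraMap R K) (IsFractionRing.injective R K) hg]
    have h1 := minpoly.eq_of_irreducible_of_monic hirr hα (hg.map _)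
    rw [h1]
    exact minpoly.dvd K α (by rwa [aeval_map_algebraMap])
  -- If `ε(x)` is invertible, its inverse is `h(ε(x))` for a polynomial `h`, so `g` divides `ε ·
  -- h(ε) - 1`. Evaluation at a zero `t` of `ε` shows that `g(t)` divides `-1`. This is applied to
  -- `X` at `0` and to `1 - X` at `1`.
  have key : ∀ (t : R) (ε : R[X]), ε.eval t = 0 → IsUnit (aeval x ε) → IsUnit (g.eval t) := by
    intro t ε hε hu
    obtain ⟨b, hb⟩ := hu.exists_right_inv
    obtain ⟨h, hh⟩ := exists_aeval_mul_eq_one hb (Algebra.IsIntegral.isIntegral (R := R) (A := integralClosure R E) b)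
    obtain ⟨k, hk⟩ := hdvd (ε * h.comp ε - 1) (by
      have h1 := congrArg (algebraMap (integralClosure R E) E) hh
      rw [map_mul, ← aeval_algebraMap_apply, map_one, ← aeval_algebraMap_apply,
        ← aeval_algebraMap_apply] at h1
      rw [map_sub, map_mul, aeval_comp, map_one]
      exact sub_eq_zero.2 h1)
    have h2 := congrArg (Polynomial.eval t) hk
    simp only [eval_sub, eval_mul, hε, zero_mul, eval_one, zero_sub] at h2
    exact IsUnit.of_mul_eq_one (-k.eval t) (by rw [mul_neg, ← h2, neg_neg])
  have hu : IsUnit x ∨ IsUnit (1 - x) := by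
    by_contra h
    push Not at h
    obtain ⟨n, hn, hxn⟩ := exists_max_ideal_of_mem_nonunits h.1
    obtain ⟨n', hn', hxn'⟩ := exists_max_ideal_of_mem_nonunits h.2
    rw [← hmax n n' hn hn'] at hxn'
    refine hn.ne_top ((Ideal.eq_top_iff_one _).2 ?_)
    simpa using n.add_mem hxn hxn'
  rcases hu with hu | hu
  · exact Or.inl (key 0 X (by simp) (by simpa using hu))
  · exact Or.inr (key 1 (1 - X) (by simp) (by simpa using hu))

/-- A noncommutative domain which is integral over a henselian normal local domain `R` and which
is torsion-free over `R` is a local ring. -/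
theorem isLocalRing_of_isIntegral {R : Type*} [CommRing R] [IsDomain R] [IsIntegrallyClosed R]
    [HenselianLocalRing R] (K : Type*) [Field K] [Algebra R K] [IsFractionRing R K] (A : Type*)
    [Ring A] [Algebra R A] [Algebra.IsIntegral R A] (AK : Type*) [Ring AK] [IsDomain AK]
    [Algebra K AK] [Algebra R AK] [IsScalarTower R K AK] (φ : A →ₐ[R] AK)
    (hφ : Function.Injective φ) : IsLocalRing A := by
  have : Nontrivial A := ⟨0, 1, fun h => zero_ne_one (α := AK) (by
    rw [← map_zero φ, ← map_one φ, h])⟩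
  -- As `g(y) = 0`, the element `y - t` divides `-g(t)`, with a cofactor commuting with it.
  have hunit : ∀ (g : R[X]) (y : A), aeval y g = 0 → ∀ t : R, IsUnit (g.eval t) →
      IsUnit (y - algebraMap R A t) := by
    intro g y hy t ht
    obtain ⟨k, hk⟩ := Polynomial.X_sub_C_dvd_sub_C_eval (p := g) (a := t)
    have h1 := congrArg (aeval y) hk
    rw [map_sub, hy, map_mul, map_sub, aeval_X, aeval_C, aeval_C, zero_sub] at h1
    have hcomm : Commute (y - algebraMap R A t) (aeval y k) := by
      have := (Commute.all (X - C t) k).map (aeval y)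
      rwa [map_sub, aeval_X, aeval_C] at this
    refine (hcomm.isUnit_mul_iff.1 ?_).1
    rw [← h1]
    exact (ht.map _).neg
  refine IsLocalRing.of_isUnit_or_isUnit_one_sub_self fun x => ?_
  have hint : IsIntegral K (φ x) := ((Algebra.IsIntegral.isIntegral (R := R) x).map φ).tower_top
  obtain ⟨p, hp⟩ := ExpChar.exists K
  -- The minimal polynomial of `x` may be inseparable. Its separable contraction `g` is the minimal
  -- polynomial of the power `x ^ p ^ k`, and a unit power, or a unit `1 - x ^ p ^ k`, is enough.
  obtain ⟨g, hgsep, k, hgk⟩ := (minpoly.irreducible hint).hasSeparableContraction p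
  have hp0 : 0 < p ^ k := pow_pos (expChar_pos K p) k
  have hgm : g.Monic := by
    rw [← Polynomial.monic_expand_iff hp0, hgk]
    exact minpoly.monic hint
  have hgirr : Irreducible g := by
    refine Polynomial.of_irreducible_expand hp0.ne' ?_
    rw [hgk]; exact minpoly.irreducible hint
  have hgy : aeval (φ (x ^ p ^ k)) g = 0 := by
    rw [map_pow, ← Polynomial.expand_aeval, hgk, minpoly.aeval]
  obtain ⟨P, hP, hPy⟩ := Algebra.IsIntegral.isIntegral (R := R) (x ^ p ^ k)
  have hdvd : g ∣ P.map (algebraMap R K) := by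
    rw [minpoly.eq_of_irreducible_of_monic hgirr hgy hgm]
    refine minpoly.dvd _ _ ?_
    rw [aeval_map_algebraMap, aeval_algHom_apply, show aeval (x ^ p ^ k) P = 0 from hPy, map_zero]
  obtain ⟨G, hG⟩ := IsIntegrallyClosed.eq_map_mul_C_of_dvd K hP hdvd
  rw [hgm.leadingCoeff, map_one, mul_one] at hG
  have hGm : G.Monic :=
    Polynomial.monic_of_injective (IsFractionRing.injective R K) (by rwa [hG])
  have hGy : aeval (x ^ p ^ k) G = 0 := by
    apply hφ
    rw [← Polynomial.aeval_algHom_apply, map_zero, ← aeval_map_algebraMap K, hG, hgy]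
  rcases isUnit_eval_zero_or_one K G hGm (by rwa [hG]) (by rwa [hG]) with h | h
  · left
    have := hunit _ _ hGy 0 h
    rw [map_zero, sub_zero] at this
    exact (isUnit_pow_iff hp0.ne').1 this
  · right
    have h1 := (hunit _ _ hGy 1 h).neg
    rw [map_one, neg_sub, ← mul_neg_geom_sum] at h1
    refine ((Commute.isUnit_mul_iff ?_).1 h1).1
    exact Commute.sum_right _ _ _ fun i _ =>
      ((Commute.one_left _).sub_left (Commute.refl x)).pow_right i

end Hensel

end NormalOrders

namespace NormalOrders

/-! ### Local hereditary rings -/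

section LocalHereditary

open MulOpposite

/-- The idempotent `b * a` of a local ring is `0` or `1`, and `a * b = 1` excludes `0`. -/
theorem isUnit_of_left_inv_of_local {B : Type*} [Ring B] [IsLocalRing B] {a b : B}
    (h : a * b = 1) : IsUnit b := by
  have he : (b * a) * (b * a) = b * a := by rw [mul_assoc, ← mul_assoc a, h, one_mul]
  rcases IsLocalRing.isUnit_or_isUnit_of_isUnit_add (a := b * a) (b := 1 - b * a)
    (by rw [add_sub_cancel]; exact isUnit_one) with hu | hu
  · have : b * a = 1 := hu.mul_left_cancel (by rw [he, mul_one])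
    exact ⟨⟨b, a, this, h⟩, rfl⟩
  · have h1 : (1 - b * a) * (b * a) = 0 := by rw [sub_mul, one_mul, he, sub_self]
    have h2 : b * a = 0 := hu.mul_left_cancel (by rw [h1, mul_zero])
    have h3 : (1 : B) = 0 := by
      calc (1 : B) = (a * b) * (a * b) := by rw [h, one_mul]
        _ = a * (b * a) * b := by simp only [mul_assoc]
        _ = 0 := by rw [h2, mul_zero, zero_mul]
    exact absurd h3 one_ne_zero

theorem isUnit_of_isUnit_mul_right {B : Type*} [Ring B] [IsLocalRing B] {a b : B}
    (h : IsUnit (a * b)) : IsUnit b := by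
  obtain ⟨u, hu⟩ := h.exists_left_inv
  exact isUnit_of_left_inv_of_local (a := u * a) (by rw [mul_assoc, hu])

theorem isLocalRing_op (B : Type*) [Ring B] [IsLocalRing B] : IsLocalRing Bᵐᵒᵖ := by
  refine IsLocalRing.of_isUnit_or_isUnit_one_sub_self fun x => ?_
  have h := IsLocalRing.isUnit_or_isUnit_of_isUnit_add (a := x.unop) (b := 1 - x.unop)
    (by rw [add_sub_cancel]; exact isUnit_one)
  rcases h with h | h
  · exact Or.inl h.op
  · exact Or.inr h.op

theorem isLocalRing_of_surjective {A B : Type*} [Ring A] [Ring B] [IsLocalRing A] [Nontrivial B]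
    (f : A →+* B) (hf : Function.Surjective f) : IsLocalRing B := by
  refine IsLocalRing.of_isUnit_or_isUnit_one_sub_self fun x => ?_
  obtain ⟨a, rfl⟩ := hf x
  rcases IsLocalRing.isUnit_or_isUnit_of_isUnit_add (a := a) (b := 1 - a)
    (by rw [add_sub_cancel]; exact isUnit_one) with h | h
  · exact Or.inl (h.map f)
  · exact Or.inr (by simpa using h.map f)

/-- Splitting `B → Ba` yields an element `e` with `e a = a`, and with `b e = 0` whenever `b a = 0`.
Since `B` is local, either `e` is a unit and `b = 0`, or `1 - e` is a unit and `a = 0`. -/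
theorem noZeroDivisors_of_projective {B : Type*} [Ring B] [IsLocalRing B]
    (hB : ∀ I : Ideal B, Module.Projective B I) : NoZeroDivisors B := by
  refine ⟨fun {b a} hba => ?_⟩
  have := hB (Ideal.span {a})
  let a' : (Ideal.span {a} : Ideal B) := ⟨a, Ideal.subset_span rfl⟩
  let f : B →ₗ[B] (Ideal.span {a} : Ideal B) := LinearMap.toSpanSingleton B _ a'
  have hf : Function.Surjective f := by
    rintro ⟨y, hy⟩
    obtain ⟨c, rfl⟩ := Ideal.mem_span_singleton'.1 hy
    exact ⟨c, Subtype.ext rfl⟩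
  obtain ⟨s, hs⟩ := Module.projective_lifting_property f LinearMap.id hf
  have h1 : s a' * a = a := congrArg Subtype.val (LinearMap.congr_fun hs a')
  have h2 : b * s a' = 0 := by
    rw [← smul_eq_mul, ← map_smul, show b • a' = 0 from Subtype.ext hba, map_zero]
  rcases IsLocalRing.isUnit_or_isUnit_of_isUnit_add (a := s a') (b := 1 - s a')
    (by rw [add_sub_cancel]; exact isUnit_one) with h | h
  · left
    exact h.mul_right_cancel (by rw [h2, zero_mul])
  · right
    exact h.mul_left_cancel (by rw [sub_mul, one_mul, h1, sub_self, mul_zero])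

/-- If two elements of a hereditary local ring satisfy a nontrivial linear relation, then one of
them is a multiple of the other. -/
theorem exists_eq_mul_or_of_projective {B : Type*} [Ring B] [IsLocalRing B]
    (hB : ∀ I : Ideal B, Module.Projective B I) {a b x y : B} (hxy : x * a + y * b = 0)
    (hx : x ≠ 0) : (∃ t, a = t * b) ∨ ∃ t, b = t * a := by
  have := noZeroDivisors_of_projective hB
  have := hB (Ideal.span {a, b})
  let a' : (Ideal.span {a, b} : Ideal B) := ⟨a, Ideal.subset_span (by simp)⟩
  let b' : (Ideal.span {a, b} : Ideal B) := ⟨b, Ideal.subset_span (by simp)⟩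
  let f : B × B →ₗ[B] (Ideal.span {a, b} : Ideal B) :=
    (LinearMap.toSpanSingleton B _ a').coprod (LinearMap.toSpanSingleton B _ b')
  have hf : Function.Surjective f := by
    rintro ⟨w, hw⟩
    obtain ⟨c, e, rfl⟩ := Ideal.mem_span_pair.1 hw
    exact ⟨(c, e), Subtype.ext rfl⟩
  -- The relation `(x, y)` is annihilated by the `2 × 2` matrix with rows `s a'` and `s b'`. A unit
  -- among suitable entries of this matrix, or of one minus it, makes one generator a multiple of
  -- the other.
  obtain ⟨s, hs⟩ := Module.projective_lifting_property f LinearMap.id hf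
  have ha : (s a').1 * a + (s a').2 * b = a := congrArg Subtype.val (LinearMap.congr_fun hs a')
  have hb : (s b').1 * a + (s b').2 * b = b := congrArg Subtype.val (LinearMap.congr_fun hs b')
  have hrel : x • s a' + y • s b' = 0 := by
    rw [← map_smul, ← map_smul, ← map_add, show x • a' + y • b' = 0 from Subtype.ext hxy, map_zero]
  have h1 : x * (s a').1 + y * (s b').1 = 0 := congrArg Prod.fst hrel
  have h2 : x * (s a').2 + y * (s b').2 = 0 := congrArg Prod.snd hrel
  have ha' : (1 - (s a').1) * a = (s a').2 * b := by
    rw [sub_mul, one_mul, sub_eq_iff_eq_add, add_comm, ha]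
  have hb' : (1 - (s b').2) * b = (s b').1 * a := by
    rw [sub_mul, one_mul, sub_eq_iff_eq_add, hb]
  by_cases hu1 : IsUnit (1 - (s a').1)
  · obtain ⟨u, hu⟩ := hu1.exists_left_inv
    exact Or.inl ⟨u * (s a').2, by rw [mul_assoc, ← ha', ← mul_assoc, hu, one_mul]⟩
  by_cases hu2 : IsUnit (1 - (s b').2)
  · obtain ⟨u, hu⟩ := hu2.exists_left_inv
    exact Or.inr ⟨u * (s b').1, by rw [mul_assoc, ← hb', ← mul_assoc, hu, one_mul]⟩
  by_cases hu3 : IsUnit (s a').2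
  · obtain ⟨u, hu⟩ := hu3.exists_left_inv
    exact Or.inr ⟨u * (1 - (s a').1), by rw [mul_assoc, ha', ← mul_assoc, hu, one_mul]⟩
  -- In the remaining case the matrix is lower triangular modulo the radical with units on the
  -- diagonal, hence invertible, which would force `x = y = 0`.
  exfalso
  have hu1' : IsUnit (s a').1 := (IsLocalRing.isUnit_or_isUnit_of_isUnit_add
    (a := (s a').1) (b := 1 - (s a').1) (by rw [add_sub_cancel]; exact isUnit_one)).resolve_right hu1
  have hu2' : IsUnit (s b').2 := (IsLocalRing.isUnit_or_isUnit_of_isUnit_add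
    (a := (s b').2) (b := 1 - (s b').2) (by rw [add_sub_cancel]; exact isUnit_one)).resolve_right hu2
  obtain ⟨u, hu⟩ := hu1'.exists_right_inv
  have hx' : x = -(y * (s b').1 * u) := by
    rw [← neg_eq_iff_add_eq_zero] at h1
    rw [← h1, neg_mul, neg_neg, mul_assoc, hu, mul_one]
  have hy : y * ((s b').2 - (s b').1 * u * (s a').2) = 0 := by
    rw [mul_sub, sub_eq_add_neg, add_comm, ← h2, hx']
    simp only [neg_mul, mul_assoc]
  have hunit : IsUnit ((s b').2 - (s b').1 * u * (s a').2) := by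
    refine (IsLocalRing.isUnit_or_isUnit_of_isUnit_add
      (a := (s b').2 - (s b').1 * u * (s a').2) (b := (s b').1 * u * (s a').2)
      (by rwa [sub_add_cancel])).resolve_right fun h => hu3 (isUnit_of_isUnit_mul_right h)
  have hy0 : y = 0 := hunit.mul_right_cancel (by rw [hy, zero_mul])
  exact hx (by rw [hx', hy0, zero_mul, zero_mul, neg_zero])

open Polynomial in
/-- A regular integral element divides a nonzero constant. -/
theorem exists_mul_eq_algebraMap {R A : Type*} [CommRing R] [Ring A] [Algebra R A]
    [Nontrivial A] {b : A} (hb : ∀ x, b * x = 0 → x = 0) (hint : IsIntegral R b) :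
    ∃ (u : A) (r : R), algebraMap R A r ≠ 0 ∧ b * u = algebraMap R A r ∧
      u * b = algebraMap R A r := by
  obtain ⟨p, hp, hpb⟩ := hint
  replace hpb : aeval b p = 0 := hpb
  induction h : p.natDegree using Nat.strong_induction_on generalizing p with
  | _ n ih =>
    have hX := Polynomial.divX_mul_X_add p
    have hcomm : aeval b p.divX * b = b * aeval b p.divX := by
      have := ((Commute.all p.divX X).map (aeval b)).eq
      rwa [aeval_X] at this
    -- A vanishing constant term lets the regular element `b` be cancelled from the equation,
    -- lowering its degree; a nonvanishing one is the constant sought.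
    by_cases h0 : algebraMap R A (p.coeff 0) = 0
    · have h1 : aeval b p.divX * b = 0 := by
        rw [← hX, map_add, map_mul, aeval_X, aeval_C, h0, add_zero] at hpb
        exact hpb
      have h2 := hb _ (hcomm ▸ h1)
      by_cases hd : p.natDegree = 0
      · rw [hp.natDegree_eq_zero.1 hd, map_one] at hpb
        exact absurd hpb one_ne_zero
      · have hdeg : p.divX.natDegree = p.natDegree - 1 := Polynomial.natDegree_divX_eq_natDegree_tsub_one
        refine ih p.divX.natDegree (by omega) p.divX ?_ h2 rfl
        rw [Monic, leadingCoeff, hdeg, coeff_divX, Nat.sub_add_cancel (Nat.pos_of_ne_zero hd)]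
        exact hp
    · refine ⟨-aeval b p.divX, p.coeff 0, h0, ?_, ?_⟩
      · rw [mul_neg, ← hcomm, neg_eq_iff_add_eq_zero, ← aeval_C b, ← aeval_X (R := R) b]
        rw [← hX, map_add, map_mul] at hpb
        simpa using hpb
      · rw [neg_mul, neg_eq_iff_add_eq_zero]
        rw [← hX, map_add, map_mul] at hpb
        simpa using hpb

end LocalHereditary

end NormalOrders

namespace NormalOrders

/-! ### Saturation of lattices -/

section Saturation

open IsLocalRing

variable {R : Type*} [CommRing R] [IsDomain R] [IsNoetherianRing R] [IsLocalRing R]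

/-- The saturation of a submodule: the vectors moved into it by a power of the maximal ideal. -/
def saturation {V : Type*} [AddCommGroup V] [Module R V] (M : Submodule R V) : Submodule R V where
  carrier := {w | ∃ k : ℕ, ∀ a ∈ maximalIdeal R ^ k, a • w ∈ M}
  add_mem' := by
    rintro v w ⟨k, hk⟩ ⟨l, hl⟩
    refine ⟨k + l, fun a ha => ?_⟩
    rw [smul_add]
    exact M.add_mem (hk a (Ideal.pow_le_pow_right (Nat.le_add_right k l) ha))
      (hl a (Ideal.pow_le_pow_right (Nat.le_add_left l k) ha))
  zero_mem' := ⟨0, fun a _ => by rw [smul_zero]; exact M.zero_mem⟩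
  smul_mem' := by
    rintro r w ⟨k, hk⟩
    exact ⟨k, fun a ha => by rw [smul_comm]; exact M.smul_mem _ (hk a ha)⟩

theorem le_saturation {V : Type*} [AddCommGroup V] [Module R V] (M : Submodule R V) :
    M ≤ saturation M := fun _ hv => ⟨0, fun _ _ => M.smul_mem _ hv⟩

theorem map_saturation_le {V W : Type*} [AddCommGroup V] [Module R V] [AddCommGroup W] [Module R W]
    (f : V →ₗ[R] W) {M : Submodule R V} {N : Submodule R W} (h : ∀ v ∈ M, f v ∈ N) {v : V}
    (hv : v ∈ saturation M) : f v ∈ saturation N := by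
  obtain ⟨k, hk⟩ := hv
  exact ⟨k, fun a ha => by rw [← map_smul]; exact h _ (hk a ha)⟩

/-- The maximal ideal is finitely generated, so the exponents needed for its elements have a common
bound. -/
theorem mem_saturation_of_forall_smul_mem {V : Type*} [AddCommGroup V] [Module R V]
    (M : Submodule R V) {v : V} (h : ∀ a ∈ maximalIdeal R, a • v ∈ saturation M) :
    v ∈ saturation M := by
  have key : ∀ I : Ideal R, I.FG → I ≤ maximalIdeal R →
      ∃ k : ℕ, ∀ a ∈ I, ∀ b ∈ maximalIdeal R ^ k, (b * a) • v ∈ M := by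
    intro I hI
    induction I, hI using Submodule.fg_induction with
    | singleton x =>
      intro hx
      obtain ⟨k, hk⟩ := h x (hx (Submodule.mem_span_singleton_self x))
      refine ⟨k, fun a ha b hb => ?_⟩
      obtain ⟨r, rfl⟩ := Submodule.mem_span_singleton.1 ha
      rw [smul_eq_mul, mul_left_comm, mul_smul, mul_smul]
      exact M.smul_mem _ (hk b hb)
    | sup N₁ N₂ _ _ ih₁ ih₂ =>
      intro hN
      obtain ⟨k, hk⟩ := ih₁ (le_sup_left.trans hN)
      obtain ⟨l, hl⟩ := ih₂ (le_sup_right.trans hN)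
      refine ⟨k + l, fun a ha b hb => ?_⟩
      obtain ⟨a₁, h₁, a₂, h₂, rfl⟩ := Submodule.mem_sup.1 ha
      rw [mul_add, add_smul]
      exact M.add_mem (hk _ h₁ _ (Ideal.pow_le_pow_right (Nat.le_add_right k l) hb))
        (hl _ h₂ _ (Ideal.pow_le_pow_right (Nat.le_add_left l k) hb))
  obtain ⟨k, hk⟩ := key _ (IsNoetherian.noetherian _) le_rfl
  refine ⟨k + 1, fun a ha => ?_⟩
  rw [pow_succ] at ha
  refine Submodule.mul_induction_on ha (fun b hb c hc => hk c hc b hb) fun x y hx hy => ?_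
  rw [add_smul]
  exact M.add_mem hx hy

variable (K : Type*) [Field K] [Algebra R K] [IsFractionRing R K]

theorem isSaturated_saturation {V : Type*} [AddCommGroup V] [Module R V] [Module K V]
    [IsScalarTower R K V] (M : Submodule R V) : IsSaturated R (saturation M) := by
  intro c hc w h
  have hcK : algebraMap R K c ≠ 0 := IsFractionRing.to_map_eq_zero_iff.not.mpr hc
  have hv : (algebraMap R K c)⁻¹ • (w : V) ∈ saturation M := by
    refine mem_saturation_of_forall_smul_mem M fun a ha => ?_
    obtain ⟨y, hy⟩ := h a ha
    have hy' : a • (w : V) = c • (y : V) := congrArg Subtype.val hy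
    rw [smul_comm, hy', ← algebraMap_smul K c, smul_smul, inv_mul_cancel₀ hcK, one_smul]
    exact y.2
  refine ⟨⟨_, hv⟩, Subtype.ext ?_⟩
  change (w : V) = c • ((algebraMap R K c)⁻¹ • (w : V))
  rw [← algebraMap_smul K c, smul_smul, mul_inv_cancel₀ hcK, one_smul]

theorem mem_range_of_pow_smul (hR : IsSaturated R R) {x : K} {k : ℕ}
    (h : ∀ a ∈ maximalIdeal R ^ k, a • x ∈ (algebraMap R K).range) :
    x ∈ (algebraMap R K).range := by
  obtain ⟨n, d, hd, rfl⟩ := IsFractionRing.div_surjective (A := R) x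
  have hd0 : d ≠ 0 := nonZeroDivisors.ne_zero hd
  have hdK : algebraMap R K d ≠ 0 := IsFractionRing.to_map_eq_zero_iff.not.mpr hd0
  obtain ⟨y, hy⟩ := hR.of_pow hd0 k n fun a ha => by
    obtain ⟨y, hy⟩ := h a ha
    refine ⟨y, IsFractionRing.injective R K ?_⟩
    rw [smul_eq_mul, smul_eq_mul, map_mul, map_mul, hy, Algebra.smul_def]
    field_simp
  exact ⟨y, by rw [hy, smul_eq_mul, map_mul, mul_div_cancel_left₀ _ hdK]⟩

/-- The coordinates of `M` in a `K`-basis have a common denominator `b`. Because `R` is saturated,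
the same `b` serves for the saturation, which therefore embeds into a finitely generated module over
a noetherian ring. -/
theorem saturation_fg (hR : IsSaturated R R) {V : Type*} [AddCommGroup V] [Module R V] [Module K V]
    [IsScalarTower R K V] [FiniteDimensional K V] {M : Submodule R V} (hM : M.FG) :
    (saturation M).FG := by
  let β := Module.finBasis K V
  obtain ⟨s, hs⟩ := hM
  obtain ⟨b, hb⟩ := IsLocalization.exist_integer_multiples_of_finite (nonZeroDivisors R)
    (fun p : s × Fin (Module.finrank K V) => β.repr p.1 p.2)
  have hb0 : (b : R) ≠ 0 := nonZeroDivisors.coe_ne_zero b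
  have hbK : algebraMap R K b ≠ 0 := IsFractionRing.to_map_eq_zero_iff.not.mpr hb0
  have hint : ∀ v ∈ M, ∀ j, (b : R) • β.repr v j ∈ (algebraMap R K).range := by
    intro v hv
    rw [← hs] at hv
    induction hv using Submodule.span_induction with
    | mem x hx => exact fun j => hb (⟨x, hx⟩, j)
    | zero => intro j; simp
    | add x y _ _ hx hy =>
      intro j
      rw [map_add, Finsupp.add_apply, smul_add]
      exact Subring.add_mem _ (hx j) (hy j)
    | smul r x _ hx =>
      intro j
      obtain ⟨y, hy⟩ := hx j
      refine ⟨r * y, ?_⟩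
      rw [map_mul, hy, ← algebraMap_smul K r x, map_smul, Finsupp.smul_apply, smul_eq_mul,
        Algebra.smul_def, Algebra.smul_def]
      ring
  have hsat : ∀ v ∈ saturation M, ∀ j, (b : R) • β.repr v j ∈ (algebraMap R K).range := by
    rintro v ⟨k, hk⟩ j
    refine mem_range_of_pow_smul K hR (k := k) fun a ha => ?_
    obtain ⟨y, hy⟩ := hint _ (hk a ha) j
    refine ⟨y, ?_⟩
    rw [hy, ← algebraMap_smul K a v, map_smul, Finsupp.smul_apply, smul_eq_mul, Algebra.smul_def,
      Algebra.smul_def, Algebra.smul_def]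
    ring
  have hle : ∀ v ∈ saturation M, (b : R) • v ∈ Submodule.span R (Set.range β) := by
    intro v hv
    rw [← β.sum_repr v, Finset.smul_sum]
    refine Submodule.sum_mem _ fun j _ => ?_
    obtain ⟨y, hy⟩ := hsat v hv j
    rw [← smul_assoc, ← hy, algebraMap_smul]
    exact Submodule.smul_mem _ _ (Submodule.subset_span ⟨j, rfl⟩)
  have hfin : Module.Finite R (Submodule.span R (Set.range β)) :=
    Module.Finite.span_of_finite R (Set.finite_range β)
  let f : saturation M →ₗ[R] Submodule.span R (Set.range β) :=
    ((LinearMap.lsmul R V (b : R)).comp (saturation M).subtype).codRestrict _ fun v => hle v.1 v.2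
  have hf : Function.Injective f := by
    intro v w hvw
    have h1 : (b : R) • (v : V) = (b : R) • (w : V) := congrArg Subtype.val hvw
    rw [← algebraMap_smul K (b : R) (v : V), ← algebraMap_smul K (b : R) (w : V)] at h1
    exact Subtype.ext (smul_right_injective V hbK h1)
  have := Module.Finite.of_injective f hf
  exact Module.Finite.iff_fg.1 this

end Saturation

section Maximal

open IsLocalRing

variable {R : Type u} [CommRing R] [IsDomain R] [IsNoetherianRing R] [IsLocalRing R]

/-- A maximal order is saturated. -/
theorem IsMaximalOrder.isSaturated (hR : IsSaturated R R) {D : Type v} [Ring D] [Algebra R D]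
    (h : IsMaximalOrder R D) : IsSaturated R D := by
  have := h.isOrder.finite
  have := h.isOrder.torsionFree
  let i : D →ₐ[R] FractionRing R ⊗[R] D := Algebra.TensorProduct.includeRight
  let M : Submodule R (FractionRing R ⊗[R] D) := Subalgebra.toSubmodule i.range
  -- The saturation of an order is again a ring and is finitely generated, so a maximal order equals
  -- its saturation.
  let S : Subalgebra R (FractionRing R ⊗[R] D) := Submodule.toSubalgebra (saturation M)
    (le_saturation M i.range.one_mem) (by
      rintro x y ⟨k, hk⟩ ⟨l, hl⟩
      refine ⟨k + l, fun a ha => ?_⟩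
      rw [pow_add] at ha
      refine Submodule.mul_induction_on ha (fun a ha b hb => ?_) fun a b ha hb => ?_
      · rw [← smul_mul_smul_comm]
        exact i.range.mul_mem (hk a ha) (hl b hb)
      · rw [add_smul]
        exact M.add_mem ha hb)
  have hS : S = i.range := by
    refine h.maximal S ?_ (le_saturation M)
    refine Module.Finite.iff_fg.2 (saturation_fg (FractionRing R) hR (M := M) ?_)
    rw [← Module.Finite.iff_fg]
    exact Module.Finite.of_surjective i.rangeRestrict.toLinearMap i.rangeRestrict_surjective
  intro c hc x hx
  have hcK : algebraMap R (FractionRing R) c ≠ 0 := IsFractionRing.to_map_eq_zero_iff.not.mpr hc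
  have hv : (algebraMap R (FractionRing R) c)⁻¹ • i x ∈ S := by
    refine ⟨1, fun a ha => ?_⟩
    rw [pow_one] at ha
    obtain ⟨y, hy⟩ := hx a ha
    refine ⟨y, ?_⟩
    change i y = _
    rw [smul_comm, ← map_smul, hy, map_smul, ← algebraMap_smul (FractionRing R) c, smul_smul,
      inv_mul_cancel₀ hcK, one_smul]
  rw [hS] at hv
  obtain ⟨y, hy⟩ := hv
  refine ⟨y, ?_⟩
  have hy' : i y = (algebraMap R (FractionRing R) c)⁻¹ • i x := hy
  rw [← sub_eq_zero]
  apply one_tmul_injective (R := R)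
  change i (x - c • y) = 0
  rw [map_sub, map_smul, hy', ← algebraMap_smul (FractionRing R) c, smul_smul,
    mul_inv_cancel₀ hcK, one_smul, sub_self]

end Maximal

end NormalOrders

namespace NormalOrders

/-! ### Normal elements whose quotient is a noncommutative discrete valuation ring -/

open IsLocalRing MulOpposite

theorem IsNormalElement.dvd_iff {D : Type*} [Ring D] {z : D} (hz : IsNormalElement z) (a : D) :
    z ∣ a ↔ ∃ b, a = b * z := by
  constructor
  · rintro ⟨c, rfl⟩
    obtain ⟨b, hb⟩ : z * c ∈ Set.range fun a : D => a * z := hz ▸ ⟨c, rfl⟩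
    exact ⟨b, hb.symm⟩
  · rintro ⟨b, rfl⟩
    obtain ⟨c, hc⟩ : b * z ∈ Set.range fun a : D => z * a := hz ▸ ⟨b, rfl⟩
    exact ⟨c, hc.symm⟩

theorem IsNormalElement.dvd_mul_left {D : Type*} [Ring D] {z : D} (hz : IsNormalElement z)
    {b : D} (a : D) (h : z ∣ b) : z ∣ a * b := by
  obtain ⟨c, rfl⟩ := (hz.dvd_iff b).1 h
  exact (hz.dvd_iff _).2 ⟨a * c, (mul_assoc _ _ _).symm⟩

theorem IsNormalElement.mem_span_iff {D : Type*} [Ring D] {z : D} (hz : IsNormalElement z) (a : D) :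
    a ∈ (Ideal.span {z} : Ideal D) ↔ z ∣ a := by
  rw [hz.dvd_iff, Ideal.mem_span_singleton']
  exact exists_congr fun b => eq_comm

theorem IsNormalElement.op {D : Type*} [Ring D] {z : D} (hz : IsNormalElement z) :
    IsNormalElement (op z) := by
  ext x
  constructor
  · rintro ⟨a, rfl⟩
    obtain ⟨c, hc⟩ := (hz.dvd_iff _).2 ⟨a.unop, rfl⟩
    exact ⟨MulOpposite.op c, unop_injective hc.symm⟩
  · rintro ⟨a, rfl⟩
    obtain ⟨c, hc⟩ := (hz.dvd_iff _).1 ⟨a.unop, rfl⟩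
    exact ⟨MulOpposite.op c, unop_injective hc.symm⟩

theorem IsNormalElement.op_dvd_iff {D : Type*} [Ring D] {z : D} (hz : IsNormalElement z) (x : Dᵐᵒᵖ) :
    MulOpposite.op z ∣ x ↔ z ∣ x.unop := by
  rw [hz.dvd_iff]
  constructor
  · rintro ⟨c, rfl⟩
    exact ⟨c.unop, rfl⟩
  · rintro ⟨c, hc⟩
    exact ⟨MulOpposite.op c, unop_injective hc⟩

/-- The properties of a local order `D` of depth two and of a normal element `z` such that
`D ⧸ z D` is a noncommutative discrete valuation ring; this list is stable under passing to the
opposite ring. -/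
structure IsUniformizing (R : Type*) [CommRing R] [IsLocalRing R] {D : Type*} [Ring D] [Algebra R D]
    (q : Ideal R) (z : D) : Prop where
  finite : Module.Finite R D
  torsionFree : Module.IsTorsionFree R D
  isSaturated : IsSaturated R D
  isDomain : IsDomain D
  isLocalRing : IsLocalRing D
  isNormal : IsNormalElement z
  not_isUnit : ¬ IsUnit z
  exists_mul_eq : ∃ (w : D) (c : R), c ≠ 0 ∧ z * w = algebraMap R D c ∧ w * z = algebraMap R D c
  dvd_algebraMap_iff : ∀ a : R, z ∣ algebraMap R D a ↔ a ∈ q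
  dvd_or_dvd : ∀ a b : D, z ∣ a * b → z ∣ a ∨ z ∣ b
  left_chain : ∀ a b : D, (∃ x, z ∣ a - x * b) ∨ ∃ x, z ∣ b - x * a
  right_chain : ∀ a b : D, (∃ x, z ∣ a - b * x) ∨ ∃ x, z ∣ b - a * x
  exists_inv : ∀ b : D, ¬ z ∣ b → ∃ (u : D) (r : R), r ∉ q ∧ z ∣ u * b - algebraMap R D r ∧
    z ∣ b * u - algebraMap R D r

theorem IsUniformizing.op {R : Type*} [CommRing R] [IsLocalRing R] {D : Type*} [Ring D]
    [Algebra R D] {q : Ideal R} {z : D} (h : IsUniformizing R q z) :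
    IsUniformizing R q (MulOpposite.op z) where
  finite := by
    have := h.finite
    exact Module.Finite.equiv (opLinearEquiv R)
  torsionFree := by
    have := h.torsionFree
    exact Function.Injective.moduleIsTorsionFree (N := D) MulOpposite.unop unop_injective
      (fun _ _ => rfl)
  isSaturated := h.isSaturated.of_linearEquiv (opLinearEquiv R)
  isDomain := by
    have := h.isDomain
    infer_instance
  isLocalRing := by
    have := h.isLocalRing
    exact isLocalRing_op D
  isNormal := h.isNormal.op
  not_isUnit hu := h.not_isUnit hu.unop
  exists_mul_eq := by
    obtain ⟨w, c, hc, h1, h2⟩ := h.exists_mul_eq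
    exact ⟨MulOpposite.op w, c, hc, unop_injective h2, unop_injective h1⟩
  dvd_algebraMap_iff a := (h.isNormal.op_dvd_iff _).trans (h.dvd_algebraMap_iff a)
  dvd_or_dvd a b hab := by
    rw [h.isNormal.op_dvd_iff] at hab
    rw [h.isNormal.op_dvd_iff, h.isNormal.op_dvd_iff]
    exact (h.dvd_or_dvd _ _ hab).symm
  left_chain a b := by
    rcases h.right_chain a.unop b.unop with ⟨x, hx⟩ | ⟨x, hx⟩
    · exact Or.inl ⟨MulOpposite.op x, (h.isNormal.op_dvd_iff _).2 hx⟩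
    · exact Or.inr ⟨MulOpposite.op x, (h.isNormal.op_dvd_iff _).2 hx⟩
  right_chain a b := by
    rcases h.left_chain a.unop b.unop with ⟨x, hx⟩ | ⟨x, hx⟩
    · exact Or.inl ⟨MulOpposite.op x, (h.isNormal.op_dvd_iff _).2 hx⟩
    · exact Or.inr ⟨MulOpposite.op x, (h.isNormal.op_dvd_iff _).2 hx⟩
  exists_inv b hb := by
    rw [h.isNormal.op_dvd_iff] at hb
    obtain ⟨u, r, hr, h1, h2⟩ := h.exists_inv _ hb
    exact ⟨MulOpposite.op u, r, hr, (h.isNormal.op_dvd_iff _).2 h2, (h.isNormal.op_dvd_iff _).2 h1⟩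

theorem isDomain_of_forall_isUnit {A : Type*} [Ring A] [Nontrivial A] (h : ∀ x : A, x ≠ 0 → IsUnit x) :
    IsDomain A :=
  have : NoZeroDivisors A := ⟨fun {a b} hab => by
    by_contra hne
    push Not at hne
    exact hne.2 ((h a hne.1).mul_left_cancel (by rw [hab, mul_zero]))⟩
  NoZeroDivisors.to_isDomain A

/-- The assumptions on `Δ` and `z` imply that `Δ ⧸ z Δ` is a noncommutative discrete valuation
ring. -/
theorem IsNiceNormalElement.isUniformizing {R : Type u} [CommRing R] [IsDomain R]
    [IsNoetherianRing R] [IsIntegrallyClosed R] [HenselianLocalRing R] (hdim : ringKrullDim R = 2)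
    {D : Type v} [Ring D] [Algebra R D] {q : CodimOnePrime R} {z : D}
    (h : IsNiceNormalElement q z) : IsUniformizing R q.1.asIdeal z := by
  have := h.isMaximalOrder.isOrder.finite
  have := h.isMaximalOrder.isOrder.torsionFree
  have := h.isMaximalOrder.isOrder.isSimple
  let i : D →ₐ[R] FractionRing R ⊗[R] D := Algebra.TensorProduct.includeRight
  have hi : Function.Injective i := (injective_iff_map_eq_zero i).2 fun a ha =>
    one_tmul_injective (R := R) ha
  have hDK : IsDomain (FractionRing R ⊗[R] D) := isDomain_of_forall_isUnit h.isDivision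
  have hD : IsDomain D := hi.isDomain i.toRingHom
  have hloc : IsLocalRing D := isLocalRing_of_isIntegral (FractionRing R) D _ i hi
  have htwo := h.isNormal.isTwoSided
  let B := D ⧸ (Ideal.span {z} : Ideal D)
  let mk : D →+* B := Ideal.Quotient.mk (Ideal.span {z})
  have hmk : ∀ a, mk a = 0 ↔ z ∣ a := fun a => by
    rw [Ideal.Quotient.eq_zero_iff_mem, h.isNormal.mem_span_iff]
  have hmks : ∀ a b, mk a = mk b ↔ z ∣ a - b := fun a b => by
    rw [← sub_eq_zero, ← map_sub, hmk]
  have hmksurj : Function.Surjective mk := Ideal.Quotient.mk_surjective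
  have hBnt : Nontrivial B := by
    rw [← not_subsingleton_iff_nontrivial]
    intro hs
    have h1 : q.1 ∈ Module.support R (D ⧸ (Ideal.span {z} : Ideal D)) := by
      rw [h.support_eq]
      exact (PrimeSpectrum.mem_zeroLocus _ _).2 le_rfl
    rw [Module.mem_support_iff_exists_annihilator] at h1
    obtain ⟨m, hm⟩ := h1
    have h2 : (1 : R) ∈ (R ∙ m).annihilator := by
      rw [Submodule.mem_annihilator_span_singleton]
      exact Subsingleton.elim (α := B) _ _
    exact q.1.isPrime.ne_top ((Ideal.eq_top_iff_one _).2 (hm h2))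
  have hBloc : IsLocalRing B := isLocalRing_of_surjective mk hmksurj
  have hBdom : NoZeroDivisors B := noZeroDivisors_of_projective h.hereditary.1
  have hBoploc : IsLocalRing Bᵐᵒᵖ := isLocalRing_op B
  -- The support determines the annihilator of `B` only up to radical, but `B` has no zero divisors,
  -- so its annihilator is already radical.
  have hann : ∀ a : R, algebraMap R B a = 0 ↔ a ∈ q.1.asIdeal := by
    have hsup := Module.support_eq_zeroLocus (R := R) (M := B)
    rw [h.support_eq] at hsup
    have hvan := congrArg PrimeSpectrum.vanishingIdeal hsup
    rw [PrimeSpectrum.vanishingIdeal_zeroLocus_eq_radical,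
      PrimeSpectrum.vanishingIdeal_zeroLocus_eq_radical, q.1.isPrime.radical] at hvan
    have hmem : ∀ a : R, a ∈ Module.annihilator R B ↔ algebraMap R B a = 0 := fun a => by
      rw [Module.mem_annihilator]
      constructor
      · intro ha
        rw [Algebra.algebraMap_eq_smul_one]; exact ha 1
      · intro ha b
        rw [Algebra.smul_def, ha, zero_mul]
    intro a
    rw [hvan]
    constructor
    · intro ha
      exact Ideal.le_radical ((hmem a).2 ha)
    · rintro ⟨n, hn⟩
      rw [hmem, map_pow] at hn
      exact IsReduced.eq_zero _ ⟨n, hn⟩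
  have hint : Algebra.IsIntegral R B := inferInstance
  have hinv : ∀ b : B, b ≠ 0 → ∃ (u : B) (r : R), r ∉ q.1.asIdeal ∧ b * u = algebraMap R B r ∧
      u * b = algebraMap R B r := fun b hb => by
    obtain ⟨u, r, hr, h1, h2⟩ := exists_mul_eq_algebraMap (R := R)
      (fun x hx => (mul_eq_zero.1 hx).resolve_left hb) (Algebra.IsIntegral.isIntegral b)
    exact ⟨u, r, fun hq => hr ((hann r).2 hq), h1, h2⟩
  -- With `u a = r` a nonzero central constant, `(b u) a - r b = 0` is the nontrivial linear
  -- relation required by `exists_eq_mul_or_of_projective`.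
  have hleft : ∀ a b : B, (∃ x, a = x * b) ∨ ∃ x, b = x * a := by
    intro a b
    by_cases ha : a = 0
    · exact Or.inl ⟨0, by rw [ha, zero_mul]⟩
    obtain ⟨u, r, hr, -, h2⟩ := hinv a ha
    by_cases hb : b = 0
    · exact Or.inr ⟨0, by rw [hb, zero_mul]⟩
    have hne : b * u ≠ 0 := by
      intro h0
      have : b * (u * a) = 0 := by rw [← mul_assoc, h0, zero_mul]
      rw [h2] at this
      exact (mul_ne_zero hb fun h => hr ((hann r).1 h)) this
    refine exists_eq_mul_or_of_projective h.hereditary.1 (x := b * u) (y := -algebraMap R B r) ?_ hne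
    rw [mul_assoc, h2, neg_mul, Algebra.commutes, add_neg_cancel]
  have hright : ∀ a b : B, (∃ x, a = b * x) ∨ ∃ x, b = a * x := by
    intro a b
    by_cases ha : a = 0
    · exact Or.inl ⟨0, by rw [ha, mul_zero]⟩
    obtain ⟨u, r, hr, h2, -⟩ := hinv a ha
    by_cases hb : b = 0
    · exact Or.inr ⟨0, by rw [hb, mul_zero]⟩
    have hne : u * b ≠ 0 := by
      intro h0
      have : (a * u) * b = 0 := by rw [mul_assoc, h0, mul_zero]
      rw [h2] at this
      exact (mul_ne_zero (fun h => hr ((hann r).1 h)) hb) this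
    have := exists_eq_mul_or_of_projective h.hereditary.2 (a := MulOpposite.op a)
      (b := MulOpposite.op b) (x := MulOpposite.op (u * b))
      (y := -MulOpposite.op (algebraMap R B r)) (unop_injective (by
        change a * (u * b) + b * -algebraMap R B r = 0
        rw [← mul_assoc, h2, mul_neg, Algebra.commutes, add_neg_cancel]))
      (fun h0 => hne (op_injective h0))
    rcases this with ⟨t, ht⟩ | ⟨t, ht⟩
    · exact Or.inl ⟨t.unop, op_injective ht⟩
    · exact Or.inr ⟨t.unop, op_injective ht⟩
  refine ⟨inferInstance, inferInstance,
    h.isMaximalOrder.isSaturated (isSaturated_self R hdim), hD, hloc, h.isNormal, ?_, ?_, ?_, ?_, ?_, ?_,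
    ?_⟩
  · intro hu
    have : mk z = 0 := (hmk z).2 dvd_rfl
    exact (this ▸ hu.map mk).ne_zero rfl
  · obtain ⟨u, r, hr, h1, h2⟩ := exists_mul_eq_algebraMap (R := R)
      (fun x hx => (mul_eq_zero.1 hx).resolve_left h.ne_zero)
      (Algebra.IsIntegral.isIntegral z)
    exact ⟨u, r, fun h0 => hr (by rw [h0, map_zero]), h1, h2⟩
  · intro a
    rw [← hmk, ← hann]
    rfl
  · intro a b hab
    rw [← hmk, map_mul] at hab
    rw [← hmk, ← hmk]
    exact mul_eq_zero.1 hab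
  · intro a b
    rcases hleft (mk a) (mk b) with ⟨x, hx⟩ | ⟨x, hx⟩ <;> obtain ⟨x, rfl⟩ := hmksurj x
    · exact Or.inl ⟨x, (hmks _ _).1 (by rw [hx, map_mul])⟩
    · exact Or.inr ⟨x, (hmks _ _).1 (by rw [hx, map_mul])⟩
  · intro a b
    rcases hright (mk a) (mk b) with ⟨x, hx⟩ | ⟨x, hx⟩ <;> obtain ⟨x, rfl⟩ := hmksurj x
    · exact Or.inl ⟨x, (hmks _ _).1 (by rw [hx, map_mul])⟩
    · exact Or.inr ⟨x, (hmks _ _).1 (by rw [hx, map_mul])⟩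
  · intro b hb
    obtain ⟨u, r, hr, h1, h2⟩ := hinv (mk b) (fun h0 => hb ((hmk b).1 h0))
    obtain ⟨u, rfl⟩ := hmksurj u
    exact ⟨u, r, hr, (hmks _ _).1 (by rw [map_mul, h2]; rfl), (hmks _ _).1 (by rw [map_mul, h1]; rfl)⟩

end NormalOrders

namespace NormalOrders

open IsLocalRing

/-! ### Bases adapted to chains of lattices -/

section Chains

variable {R : Type*} [CommRing R] [IsDomain R] [IsNoetherianRing R] [IsLocalRing R]
  {D : Type*} [Ring D] [Algebra R D] {q : Ideal R} {z : D}

theorem IsUniformizing.mem_jacobson (h : IsUniformizing R q z) : z ∈ Ring.jacobson D := by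
  have := h.isDomain
  have := h.isLocalRing
  rw [Ring.jacobson_eq_sInf_isMaximal, Submodule.mem_sInf]
  intro I hI
  by_contra hz
  obtain ⟨y, i, hi, hy⟩ := hI.exists_inv hz
  have h1 : ¬ IsUnit (y * z) := fun hu => h.not_isUnit (isUnit_of_isUnit_mul_right hu)
  have h2 := (IsLocalRing.isUnit_or_isUnit_of_isUnit_add (a := y * z) (b := i)
    (by rw [hy]; exact isUnit_one)).resolve_left h1
  exact hI.ne_top (Ideal.eq_top_of_isUnit_mem _ hi h2)

variable {X : Type*} [AddCommGroup X] [Module R X] [Module D X] [IsScalarTower R D X]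

theorem IsUniformizing.smul_injective (h : IsUniformizing R q z) [Module.IsTorsionFree R X] {x : X}
    (hx : z • x = 0) : x = 0 := by
  obtain ⟨w, c, hc, -, h2⟩ := h.exists_mul_eq
  have h3 : c • x = 0 := by
    rw [← algebraMap_smul D c x, ← h2, mul_smul, hx, smul_zero]
  exact (smul_eq_zero.1 h3).resolve_left hc

variable (X) in
/-- The submodule `z X`. -/
def normalMultiples (hz : IsNormalElement z) : Submodule D X where
  carrier := {x | ∃ y : X, x = z • y}
  add_mem' := by
    rintro _ _ ⟨x, rfl⟩ ⟨y, rfl⟩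
    exact ⟨x + y, (smul_add _ _ _).symm⟩
  zero_mem' := ⟨0, (smul_zero _).symm⟩
  smul_mem' := by
    rintro b _ ⟨x, rfl⟩
    obtain ⟨c, hc⟩ := hz.dvd_mul_left b (dvd_refl z)
    exact ⟨c • x, by rw [smul_smul, hc, mul_smul]⟩

theorem smul_mem_normalMultiples (hz : IsNormalElement z) {b : D} (hb : z ∣ b) (x : X) :
    b • x ∈ normalMultiples X hz := by
  obtain ⟨c, rfl⟩ := hb
  exact ⟨c • x, mul_smul _ _ _⟩

/-- Nakayama's lemma: `z` lies in the radical of `D`. -/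
theorem IsUniformizing.eq_top_of_sup (h : IsUniformizing R q z) [Module.Finite R X]
    {N : Submodule D X} (hN : ⊤ ≤ N ⊔ normalMultiples X h.isNormal) : N = ⊤ := by
  have : Module.Finite D X := Module.Finite.of_restrictScalars_finite R D X
  have hfg : (⊤ : Submodule D (X ⧸ N)).FG := Module.Finite.fg_top
  have := Submodule.FG.eq_bot_of_le_jacobson_smul hfg (by
    rintro x -
    obtain ⟨x, rfl⟩ := N.mkQ_surjective x
    obtain ⟨n, hn, _, ⟨y, rfl⟩, rfl⟩ := Submodule.mem_sup.1 (hN (Submodule.mem_top (x := x)))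
    rw [map_add, (Submodule.Quotient.mk_eq_zero N).2 hn |> fun e => (show N.mkQ n = 0 from e),
      zero_add, map_smul]
    exact Submodule.smul_mem_smul h.mem_jacobson Submodule.mem_top)
  rw [← N.ker_mkQ, LinearMap.ker_eq_top]
  ext x
  exact (Submodule.mem_bot D).1 (this ▸ Submodule.mem_top)

/-- Principal right ideals of `D ⧸ zD` form a chain, so among finitely many coefficients one divides
all the others modulo `z`; it serves as a pivot. -/
theorem IsUniformizing.exists_dvd_sub_mul (h : IsUniformizing R q z) {ι : Type*} (δ : ι → D)
    (s : Finset ι) (hs : s.Nonempty) : ∃ k ∈ s, ∀ i ∈ s, ∃ x, z ∣ δ i - δ k * x := by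
  induction hs using Finset.Nonempty.cons_induction with
  | singleton a => exact ⟨a, by simp, fun i hi => ⟨1, by simp_all⟩⟩
  | cons a s ha _ ih =>
    obtain ⟨k, hk, hk'⟩ := ih
    rcases h.right_chain (δ a) (δ k) with ⟨x, hx⟩ | ⟨x, hx⟩
    · refine ⟨k, Finset.mem_cons_of_mem hk, fun i hi => ?_⟩
      rcases Finset.mem_cons.1 hi with rfl | hi
      · exact ⟨x, hx⟩
      · exact hk' i hi
    · refine ⟨a, Finset.mem_cons_self a s, fun i hi => ?_⟩
      rcases Finset.mem_cons.1 hi with rfl | hi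
      · exact ⟨1, by simp⟩
      · obtain ⟨y, hy⟩ := hk' i hi
        refine ⟨x * y, ?_⟩
        have : δ i - δ a * (x * y) = (δ i - δ k * y) + (δ k - δ a * x) * y := by noncomm_ring
        rw [this]
        exact dvd_add hy (Dvd.dvd.mul_right hx y)

/-- A finitely generated module over `D` modulo a submodule with torsion-free quotient over
`D ⧸ z D` has generators which are independent modulo `z`. -/
theorem IsUniformizing.exists_generators (h : IsUniformizing R q z) {P P' : Submodule D X}
    (hP : P.FG) (hz : ∀ x ∈ P, z • x ∈ P') (hpure : ∀ (b : D) (x : X), ¬ z ∣ b → b • x ∈ P' → x ∈ P') :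
    ∃ (n : ℕ) (x : Fin n → X), (∀ k, x k ∈ P) ∧ P ≤ Submodule.span D (Set.range x) ⊔ P' ∧
      ∀ δ : Fin n → D, ∑ k, δ k • x k ∈ P' → ∀ k, z ∣ δ k := by
  classical
  -- A generating family of minimal length is taken: a relation not divisible by `z` would make one
  -- generator redundant.
  have hex : ∃ (n : ℕ) (x : Fin n → X), (∀ k, x k ∈ P) ∧ P ≤ Submodule.span D (Set.range x) ⊔ P' := by
    obtain ⟨n, x, hx⟩ := Submodule.fg_iff_exists_fin_generating_family.1 hP
    exact ⟨n, x, fun k => hx ▸ Submodule.subset_span ⟨k, rfl⟩, hx ▸ le_sup_left⟩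
  obtain ⟨x, hxP, hx⟩ := Nat.find_spec hex
  have hmin := fun m hm => Nat.find_min hex (m := m) hm
  generalize Nat.find hex = n at *
  refine ⟨n, x, hxP, hx, fun δ hδ => ?_⟩
  by_contra! hne
  obtain ⟨k₁, hk₁⟩ := hne
  obtain ⟨k, -, hk⟩ := h.exists_dvd_sub_mul δ Finset.univ ⟨k₁, Finset.mem_univ _⟩
  replace hk : ∀ i, ∃ y, z ∣ δ i - δ k * y := fun i => hk i (Finset.mem_univ i)
  have hkz : ¬ z ∣ δ k := fun hdvd => hk₁ (by
    obtain ⟨y, hy⟩ := hk k₁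
    have := dvd_add hy (Dvd.dvd.mul_right hdvd y)
    rwa [sub_add_cancel] at this)
  have hzP : ∀ b : D, z ∣ b → ∀ i, b • x i ∈ P' := by
    rintro _ ⟨c, rfl⟩ i
    rw [mul_smul]
    exact hz _ (P.smul_mem c (hxP i))
  choose y hy using hk
  -- The quotient of the pivot `δ k` by itself is normalised to `1`. Purity divides the relation by
  -- `δ k`, and the resulting one expresses `x k` through the other generators.
  let y' := Function.update y k 1
  have hy' : ∀ i, z ∣ δ i - δ k * y' i := fun i => by
    by_cases hik : i = k
    · subst hik
      simp [y']
    · simp only [y', Function.update_of_ne hik]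
      exact hy i
  have hsum : ∑ i, y' i • x i ∈ P' := by
    refine hpure (δ k) _ hkz ?_
    have : δ k • ∑ i, y' i • x i = ∑ i, δ i • x i - ∑ i, (δ i - δ k * y' i) • x i := by
      rw [← Finset.sum_sub_distrib, Finset.smul_sum]
      refine Finset.sum_congr rfl fun i _ => ?_
      rw [← sub_smul, sub_sub_cancel, mul_smul]
    rw [this]
    exact P'.sub_mem hδ (P'.sum_mem fun i _ => hzP _ (hy' i) i)
  obtain _ | n := n
  · exact k.elim0
  refine hmin n n.lt_succ_self ⟨fun i => x (k.succAbove i), fun i => hxP _, hx.trans ?_⟩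
  refine sup_le (Submodule.span_le.2 ?_) le_sup_right
  rintro _ ⟨i, rfl⟩
  have hother : ∀ i, x (k.succAbove i) ∈
      Submodule.span D (Set.range fun i => x (k.succAbove i)) ⊔ P' := fun i =>
    Submodule.mem_sup_left (Submodule.subset_span ⟨i, rfl⟩)
  rcases Fin.eq_self_or_eq_succAbove k i with rfl | ⟨j, rfl⟩
  · rw [Fin.sum_univ_succAbove _ i] at hsum
    have h1 : y' i • x i = x i := by simp [y']
    rw [h1] at hsum
    have h2 := Submodule.sub_mem _ (Submodule.mem_sup_right (S := Submodule.span D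
      (Set.range fun j => x (i.succAbove j))) hsum) (Submodule.sum_mem _ fun j (_ : j ∈ Finset.univ) =>
        Submodule.smul_mem _ (y' (i.succAbove j)) (hother j))
    rwa [add_sub_cancel_right] at h2
  · exact hother j

/-- A chain of submodules between `X` and `z X` whose quotients are torsion-free over `D ⧸ z D` has
an adapted basis. -/
theorem IsUniformizing.exists_adapted_basis (h : IsUniformizing R q z) [Module.Finite R X]
    [Module.IsTorsionFree R X] (e : ℕ) (N : ℕ → Submodule D X) (hN0 : N 0 = ⊤)
    (hNe : N e = normalMultiples X h.isNormal) (hN : Antitone N)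
    (hpure : ∀ j ≤ e, ∀ (b : D) (x : X), ¬ z ∣ b → b • x ∈ N j → x ∈ N j) :
    ∃ (n : Fin e → ℕ) (b : Module.Basis (Σ j : Fin e, Fin (n j)) D X),
      ∀ j ≤ e, ∀ x, x ∈ N j ↔ ∀ k, k.1.1 < j → z ∣ b.repr x k := by
  classical
  have := h.finite
  have hfinD : Module.Finite D X := Module.Finite.of_restrictScalars_finite R D X
  have hnoeth : IsNoetherian R X := inferInstance
  have hnoethD : IsNoetherian D X := isNoetherian_of_tower R hnoeth
  have hzN : ∀ j ≤ e, normalMultiples X h.isNormal ≤ N j := fun j hj => hNe ▸ hN hj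
  have hgen : ∀ j : Fin e, ∃ (n : ℕ) (x : Fin n → X), (∀ k, x k ∈ N j) ∧
      N j ≤ Submodule.span D (Set.range x) ⊔ N (j + 1) ∧
      ∀ δ : Fin n → D, ∑ k, δ k • x k ∈ N (j + 1) → ∀ k, z ∣ δ k := fun j =>
    h.exists_generators (IsNoetherian.noetherian _)
      (fun x _ => hzN _ j.2 (smul_mem_normalMultiples _ dvd_rfl x)) (hpure _ j.2)
  choose n x hxN hxgen hxind using hgen
  let y : (Σ j : Fin e, Fin (n j)) → X := fun p => x p.1 p.2
  have hspan : ∀ j ≤ e, ⊤ ≤ Submodule.span D (Set.range y) ⊔ N j := by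
    intro j
    induction j with
    | zero => intro _; rw [hN0]; exact le_sup_right
    | succ j ih =>
      intro hj
      refine (ih (by omega)).trans (sup_le le_sup_left ((hxgen ⟨j, hj⟩).trans ?_))
      refine sup_le_sup_right (Submodule.span_mono ?_) _
      rintro _ ⟨k, rfl⟩
      exact ⟨⟨⟨j, hj⟩, k⟩, rfl⟩
  have hspan' : Submodule.span D (Set.range y) = ⊤ :=
    h.eq_top_of_sup (hNe ▸ hspan e le_rfl)
  have hind : ∀ j ≤ e, ∀ δ : (Σ j : Fin e, Fin (n j)) → D, ∑ p, δ p • y p ∈ N j →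
      ∀ p, p.1.1 < j → z ∣ δ p := by
    intro j
    induction j with
    | zero => intro _ δ _ p hp; omega
    | succ j ih =>
      intro hj δ hδ p hp
      have hih := ih (by omega) δ (hN j.le_succ hδ)
      rcases Nat.lt_succ_iff_lt_or_eq.1 hp with hp | hp
      · exact hih p hp
      · obtain ⟨i, k⟩ := p
        simp only at hp
        subst hp
        refine hxind i (fun k => δ ⟨i, k⟩) ?_ k
        rw [Fintype.sum_sigma, ← Finset.add_sum_erase _ _ (Finset.mem_univ i)] at hδ
        refine (Submodule.add_mem_iff_left _ (Submodule.sum_mem _ fun i' hi' => ?_)).1 hδ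
        refine Submodule.sum_mem _ fun k' _ => ?_
        have hne : i'.1 ≠ i.1 := fun h => Finset.ne_of_mem_erase hi' (Fin.ext h)
        rcases lt_or_gt_of_ne hne with hlt | hlt
        · exact hzN _ hj (smul_mem_normalMultiples _ (hih ⟨i', k'⟩ hlt) _)
        · exact Submodule.smul_mem _ _ (hN hlt (hxN i' k'))
  have hli : LinearIndependent D y := by
    rw [Fintype.linearIndependent_iff]
    -- All coefficients of a relation are divisible by `z`, and the quotient is again a relation
    -- because `z` acts injectively on `X`. So `C ⊆ zC`, and Nakayama applies.
    let C : Submodule D ((Σ j : Fin e, Fin (n j)) → D) := LinearMap.ker (Fintype.linearCombination D y)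
    have hC : C = ⊥ := by
      have : IsNoetherian D D := isNoetherian_of_tower R (inferInstance : IsNoetherian R D)
      refine Submodule.FG.eq_bot_of_le_jacobson_smul (IsNoetherian.noetherian C) fun δ hδ => ?_
      have hδ0 : ∑ p, δ p • y p = 0 := hδ
      have hdvd : ∀ p, z ∣ δ p := fun p => hind e le_rfl δ (by rw [hδ0]; exact zero_mem _) p p.1.2
      choose ε hε using hdvd
      have hδε : δ = z • ε := funext hε
      rw [hδε]
      refine Submodule.smul_mem_smul h.mem_jacobson ?_
      refine h.smul_injective (X := X) (x := ∑ p, ε p • y p) ?_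
      rw [Finset.smul_sum, ← hδ0]
      exact Finset.sum_congr rfl fun p _ => by rw [hε, mul_smul]
    intro δ hδ p
    have : δ ∈ C := hδ
    rw [hC] at this
    exact congrFun ((Submodule.mem_bot D).1 this) p
  let b := Module.Basis.mk hli hspan'.ge
  refine ⟨n, b, fun j hj x => ⟨fun hx k hk => ?_, fun hx => ?_⟩⟩
  · refine hind j hj (b.repr x) ?_ k hk
    have := b.sum_repr x
    simp only [b, Module.Basis.mk_apply] at this
    rwa [this]
  · rw [← b.sum_repr x]
    refine Submodule.sum_mem _ fun k _ => ?_
    rw [Module.Basis.mk_apply]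
    rcases lt_or_ge k.1.1 j with hk | hk
    · exact hzN _ hj (smul_mem_normalMultiples _ (hx k hk) _)
    · exact Submodule.smul_mem _ _ (hN hk (hxN k.1 k.2))

end Chains

end NormalOrders

namespace NormalOrders

open IsLocalRing

/-! ### Depth two makes the quotients torsion-free -/

section Purity

variable {R : Type*} [CommRing R] [IsDomain R] [IsNoetherianRing R] [IsLocalRing R]
  {D : Type*} [Ring D] [Algebra R D] {q : Ideal R} {z : D}
  {X : Type*} [AddCommGroup X] [Module R X] [Module D X] [IsScalarTower R D X]

theorem mem_of_pow_smul_mem {N : Submodule D X}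
    (hN : ∀ x : X, (∀ a ∈ maximalIdeal R, a • x ∈ N) → x ∈ N) (k : ℕ) :
    ∀ x : X, (∀ a ∈ maximalIdeal R ^ k, a • x ∈ N) → x ∈ N := by
  induction k with
  | zero => intro x h; simpa using h 1 (by simp)
  | succ k ih =>
    intro x h
    refine hN x fun b hb => ih _ fun a ha => ?_
    rw [smul_smul]
    exact h _ (by rw [pow_succ]; exact Ideal.mul_mem_mul ha hb)

/-- Choose `u b ≡ r` modulo `z` with `r ∉ q`. The scalars carrying `x` into `N` form an ideal that
contains `r` and also `q`, since `q` kills `X ⧸ zX`. An ideal strictly above `q` contains a power of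
`m`, and `N` is closed under division by such a power. -/
theorem IsUniformizing.pure_of_closed (h : IsUniformizing R q z) (hdim : ringKrullDim R = 2)
    [q.IsPrime] (hq : q.height = 1) {N : Submodule D X} (hzN : normalMultiples X h.isNormal ≤ N)
    (hN : ∀ x : X, (∀ a ∈ maximalIdeal R, a • x ∈ N) → x ∈ N) (b : D) (x : X) (hb : ¬ z ∣ b)
    (hx : b • x ∈ N) : x ∈ N := by
  obtain ⟨u, r, hr, hu, -⟩ := h.exists_inv b hb
  have hrx : r • x ∈ N := by
    have h1 := hzN (smul_mem_normalMultiples h.isNormal hu x)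
    rw [sub_smul, algebraMap_smul, mul_smul] at h1
    exact (Submodule.sub_mem_iff_right _ (N.smul_mem u hx)).1 h1
  let I : Ideal R := (N.restrictScalars R).comap (LinearMap.toSpanSingleton R X x)
  have hqI : q < I := by
    refine lt_of_le_of_ne (fun a ha => ?_) fun heq => hr (heq ▸ hrx)
    change a • x ∈ N
    rw [← algebraMap_smul D a x]
    exact hzN (smul_mem_normalMultiples h.isNormal ((h.dvd_algebraMap_iff a).2 ha) x)
  obtain ⟨k, hk⟩ := exists_maximalIdeal_pow_le_of_lt hdim q I hq hqI
  exact mem_of_pow_smul_mem hN k x fun a ha => hk ha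

/-- Multiplication by `w`, where `w z = c` is a central constant, turns divisibility by `z` into
divisibility by `c`, to which saturation applies. -/
theorem IsUniformizing.normalMultiples_closed (h : IsUniformizing R q z) [Module.IsTorsionFree R X]
    (hX : IsSaturated R X) (x : X)
    (hx : ∀ a ∈ maximalIdeal R, a • x ∈ normalMultiples X h.isNormal) :
    x ∈ normalMultiples X h.isNormal := by
  obtain ⟨w, c, hc, h1, h2⟩ := h.exists_mul_eq
  have hcs : ∀ y : X, w • z • y = c • y := fun y => by rw [smul_smul, h2, algebraMap_smul]
  obtain ⟨y, hy⟩ := hX c hc (w • x) fun a ha => by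
    obtain ⟨y, hy⟩ := hx a ha
    exact ⟨y, by rw [← algebraMap_smul D a, smul_smul, Algebra.commutes, mul_smul, algebraMap_smul,
      hy, hcs]⟩
  refine ⟨y, ?_⟩
  have h3 : z • w • x = z • w • z • y := by rw [hy, hcs]
  rw [smul_smul, smul_smul z w, h1, algebraMap_smul, algebraMap_smul] at h3
  rw [← sub_eq_zero]
  refine (smul_eq_zero.1 (?_ : c • (x - z • y) = 0)).resolve_left hc
  rw [smul_sub, h3, sub_self]

/-- Finite torsion-free saturated modules are free. -/
theorem IsUniformizing.exists_basis (h : IsUniformizing R q z) (hdim : ringKrullDim R = 2)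
    [q.IsPrime] (hq : q.height = 1) [Module.Finite R X] [Module.IsTorsionFree R X]
    (hX : IsSaturated R X) : ∃ n : ℕ, Nonempty (Module.Basis (Fin n) D X) := by
  -- This is the one-step chain from `X` to `zX`.
  obtain ⟨n, b, -⟩ := h.exists_adapted_basis (X := X) 1
    (fun j => if j = 0 then ⊤ else normalMultiples X h.isNormal) (by simp) (by simp)
    (by
      intro i j hij
      by_cases hj : j = 0
      · subst hj; simp [Nat.le_zero.1 hij]
      · by_cases hi : i = 0 <;> simp [hi, hj])
    (by
      intro j _ c x hc hx
      by_cases hj : j = 0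
      · simp [hj]
      · simp only [hj, if_false] at hx ⊢
        exact h.pure_of_closed hdim hq le_rfl (h.normalMultiples_closed hX) c x hc hx)
  exact ⟨_, ⟨b.reindex (Fintype.equivFin _)⟩⟩

end Purity

/-! ### Block triangular orders and their corners -/

section BlockTriangular

variable (R : Type*) [CommRing R] {D : Type*} [Ring D] [Algebra R D] {ι : Type*} [Fintype ι]
  [DecidableEq ι]

/-- The block triangular matrices modulo `z`, where `h i` is the number of the block of `i`. -/
def blockTriangular (h : ι → ℕ) (z : D) (hz : IsNormalElement z) :
    Subalgebra R (Matrix ι ι D) where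
  carrier := {M | ∀ i j, h j < h i → z ∣ M i j}
  add_mem' hM hN i j hij := dvd_add (hM i j hij) (hN i j hij)
  mul_mem' {M N} hM hN i j hij := by
    rw [Matrix.mul_apply]
    refine Finset.dvd_sum fun k _ => ?_
    rcases lt_or_ge (h k) (h i) with hk | hk
    · exact Dvd.dvd.mul_right (hM i k hk) _
    · exact hz.dvd_mul_left _ (hN k j (hij.trans_le hk))
  algebraMap_mem' r i j hij := by
    rw [Matrix.algebraMap_matrix_apply, if_neg (by rintro rfl; exact hij.false)]
    exact dvd_zero z

variable {R} {h : ι → ℕ} {z : D} {hz : IsNormalElement z}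

theorem single_mem_blockTriangular (i j : ι) {d : D} (hd : h j < h i → z ∣ d) :
    Matrix.single i j d ∈ blockTriangular R h z hz := by
  intro i' j' hij
  by_cases hc : i = i' ∧ j = j'
  · obtain ⟨rfl, rfl⟩ := hc
    rw [Matrix.single_apply_same]
    exact hd hij
  · rw [Matrix.single_apply, if_neg hc]
    exact dvd_zero z

/-- A matrix with at most one nonzero entry as an element of the block triangular order. -/
def blockSingle (R : Type*) [CommRing R] [Algebra R D] (hz : IsNormalElement z) (i j : ι) (d : D)
    (hd : h j < h i → z ∣ d) : blockTriangular R h z hz :=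
  ⟨Matrix.single i j d, single_mem_blockTriangular i j hd⟩

theorem blockSingle_mul (i j k : ι) (d e : D) (hd : h j < h i → z ∣ d) (he : h k < h j → z ∣ e)
    (hde : h k < h i → z ∣ d * e) :
    blockSingle R hz i j d hd * blockSingle R hz j k e he = blockSingle R hz i k (d * e) hde :=
  Subtype.ext (Matrix.single_mul_single_same _ _ _ _ _)

theorem blockSingle_add (i j : ι) (d e : D) (hd : h j < h i → z ∣ d) (he : h j < h i → z ∣ e)
    (hde : h j < h i → z ∣ d + e) :
    blockSingle R hz i j (d + e) hde = blockSingle R hz i j d hd + blockSingle R hz i j e he :=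
  Subtype.ext (Matrix.single_add _ _ _ _)

end BlockTriangular

end NormalOrders

namespace NormalOrders

open IsLocalRing

section Corner

variable {R : Type*} [CommRing R] {D : Type*} [Ring D] [Algebra R D] {ι : Type*} [Fintype ι]
  [DecidableEq ι] {h : ι → ℕ} {z : D} {hz : IsNormalElement z}
  (X : Type*) [AddCommGroup X] [Module R X] [Module (blockTriangular R h z hz) X]
  [IsScalarTower R (blockTriangular R h z hz) X]

theorem blockSingle_smul_smul {X : Type*} [AddCommGroup X] [Module (blockTriangular R h z hz) X]
    (i j k : ι) (d e : D) (hd : h j < h i → z ∣ d) (he : h k < h j → z ∣ e)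
    (hde : h k < h i → z ∣ d * e) (x : X) :
    blockSingle R hz i j d hd • blockSingle R hz j k e he • x = blockSingle R hz i k (d * e) hde • x := by
  rw [smul_smul, blockSingle_mul i j k d e hd he hde]

variable (R h hz) in
/-- The corner `e X` of a module over a block triangular order, `e` a diagonal matrix unit. -/
def corner (i : ι) : Submodule R X where
  carrier := {x | blockSingle R hz i i 1 (fun hi => absurd hi (lt_irrefl (h i))) • x = x}
  add_mem' {x y} hx hy := by
    change _ • (x + y) = _
    rw [smul_add, hx, hy]
  zero_mem' := smul_zero _
  smul_mem' r x hx := by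
    change _ • (r • x) = _
    rw [smul_comm, hx]

variable {X}

theorem blockSingle_smul_mem_corner (i j : ι) (d : D) (hd : h j < h i → z ∣ d) (x : X) :
    blockSingle R hz i j d hd • x ∈ corner R h hz X i := by
  change _ • _ = _
  rw [blockSingle_smul_smul i i j 1 d _ hd (by rwa [one_mul])]
  simp only [one_mul]

/-- The action of `D` on a corner. -/
abbrev cornerModule (i : ι) : Module D (corner R h hz X i) where
  smul d x := ⟨blockSingle R hz i i d (fun hi => absurd hi (lt_irrefl (h i))) • (x : X),
    blockSingle_smul_mem_corner i i d _ _⟩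
  one_smul x := Subtype.ext x.2
  mul_smul d e x := Subtype.ext (blockSingle_smul_smul i i i d e _ _ _ _).symm
  smul_zero d := Subtype.ext (smul_zero _)
  smul_add d x y := Subtype.ext (smul_add _ _ _)
  add_smul d e x := Subtype.ext (by
    refine (congrArg (· • (x : X)) (blockSingle_add i i d e (fun hi => absurd hi (lt_irrefl (h i)))
      (fun hi => absurd hi (lt_irrefl (h i))) _)).trans ?_
    exact add_smul _ _ _)
  zero_smul x := Subtype.ext (by
    refine (congrArg (· • (x : X)) (?_ : _ = (0 : blockTriangular R h z hz))).trans (zero_smul _ _)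
    exact Subtype.ext (Matrix.single_zero _ _))

end Corner

/-! ### Saturated modules over block triangular orders are projective -/

section Projective

variable {R : Type*} [CommRing R] [IsDomain R] [IsNoetherianRing R] [IsLocalRing R]
  {D : Type*} [Ring D] [Algebra R D] {q : Ideal R} {z : D} {ι : Type*} [Fintype ι]
  [DecidableEq ι] {h : ι → ℕ}

/-- The unit from `j` to `i` can be undone up to the constant `c = w z`: the product of `w e_jj`, `z
e_ji` and `e_ij` is `c e_jj`. -/
theorem IsUniformizing.blockSingle_injective (hD : IsUniformizing R q z) {X : Type*}
    [AddCommGroup X] [Module R X] [Module (blockTriangular R h z hD.isNormal) X]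
    [IsScalarTower R (blockTriangular R h z hD.isNormal) X] [Module.IsTorsionFree R X] {i j : ι}
    (hij : h i ≤ h j) {x : X}
    (hx : blockSingle (h := h) R hD.isNormal i j 1 (fun hi => absurd hi hij.not_gt) • x = 0) :
    blockSingle (h := h) R hD.isNormal j j 1 (fun hi => absurd hi (lt_irrefl (h j))) • x = 0 := by
  obtain ⟨w, c, hc, h1, h2⟩ := hD.exists_mul_eq
  have h3 : blockSingle (h := h) R hD.isNormal j j w (fun hi => absurd hi (lt_irrefl (h j))) •
      blockSingle (h := h) R hD.isNormal j i z (fun _ => dvd_rfl) •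
      blockSingle (h := h) R hD.isNormal i j 1 (fun hi => absurd hi hij.not_gt) • x = 0 := by
    rw [hx, smul_zero, smul_zero]
  rw [blockSingle_smul_smul j i j z 1 _ _ (fun hi => absurd hi (lt_irrefl (h j))),
    blockSingle_smul_smul j j j w (z * 1) _ _ (fun hi => absurd hi (lt_irrefl (h j)))] at h3
  have h4 : blockSingle (h := h) R hD.isNormal j j (w * (z * 1)) (fun hi => absurd hi (lt_irrefl (h j))) =
      c • blockSingle (h := h) R hD.isNormal j j 1 (fun hi => absurd hi (lt_irrefl (h j))) := by
    apply Subtype.ext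
    change Matrix.single j j (w * (z * 1)) = c • Matrix.single j j 1
    rw [mul_one, h2, Matrix.smul_single, Algebra.algebraMap_eq_smul_one]
  rw [h4, smul_assoc] at h3
  exact (smul_eq_zero.1 h3).resolve_left hc

/-- Finite torsion-free saturated modules over a block triangular order are projective. -/
theorem IsUniformizing.projective_of_isSaturated (hD : IsUniformizing R q z)
    (hdim : ringKrullDim R = 2) [q.IsPrime] (hq : q.height = 1) {e : ℕ} (he : 0 < e)
    (hlt : ∀ i, h i < e) (hsurj : ∀ j < e, ∃ i, h i = j) {X : Type*}
    [AddCommGroup X] [Module R X] [Module (blockTriangular R h z hD.isNormal) X]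
    [IsScalarTower R (blockTriangular R h z hD.isNormal) X] [Module.Finite R X]
    [Module.IsTorsionFree R X] (hX : IsSaturated R X) :
    Module.Projective (blockTriangular R h z hD.isNormal) X := by
  classical
  obtain ⟨i₀, hi₀⟩ := hsurj 0 he
  have hmin : ∀ i, h i₀ ≤ h i := fun i => hi₀ ▸ Nat.zero_le _
  let _ := cornerModule (R := R) (h := h) (hz := hD.isNormal) (X := X) i₀
  let E : ∀ (i j : ι) (d : D), (h j < h i → z ∣ d) → blockTriangular R h z hD.isNormal :=
    blockSingle R hD.isNormal
  have E_smul : ∀ (i j k : ι) (d e : D) (hd : h j < h i → z ∣ d) (he : h k < h j → z ∣ e)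
      (hde : h k < h i → z ∣ d * e) (x : X), E i j d hd • E j k e he • x = E i k (d * e) hde • x :=
    blockSingle_smul_smul
  have hnl : ∀ {i j : ι} {d : D}, h i ≤ h j → h j < h i → z ∣ d := fun h1 h2 => absurd h2 h1.not_gt
  have hsmul : ∀ (d : D) (x : corner R h hD.isNormal X i₀), ((d • x : corner R h hD.isNormal X i₀) : X) =
      E i₀ i₀ d (hnl le_rfl) • (x : X) := fun _ _ => rfl
  have htower : IsScalarTower R D (corner R h hD.isNormal X i₀) := ⟨fun r d x => Subtype.ext (by
    change E i₀ i₀ (r • d) _ • (x : X) = r • (E i₀ i₀ d _ • (x : X))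
    rw [← smul_assoc]
    exact congrArg (· • (x : X)) (Subtype.ext (Matrix.smul_single _ _ _ _).symm))⟩
  have hfin : Module.Finite R (corner R h hD.isNormal X i₀) := inferInstance
  obtain ⟨w, c, hc, hzw, hwz⟩ := hD.exists_mul_eq
  choose σ hσ using hsurj
  -- `N j` is the image of the corner of block `j`, represented by the index `σ j`, inside the
  -- corner of block `0`. From `e` on the value is the multiples of `z`, so that the chain ends as
  -- an adapted basis requires.
  let N : ℕ → Submodule D (corner R h hD.isNormal X i₀) := fun j =>
    if hj : j < e then
      { carrier := {x | ∃ y : X, (x : X) = E i₀ (σ j hj) 1 (hnl (hmin _)) • y}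
        add_mem' := by
          rintro x x' ⟨y, hy⟩ ⟨y', hy'⟩
          exact ⟨y + y', by rw [Submodule.coe_add, hy, hy', smul_add]⟩
        zero_mem' := ⟨0, (smul_zero _).symm⟩
        smul_mem' := by
          rintro d x ⟨y, hy⟩
          refine ⟨E (σ j hj) (σ j hj) d (hnl le_rfl) • y, ?_⟩
          rw [hsmul, hy, E_smul _ _ _ _ _ _ _ (hnl (hmin _)), E_smul _ _ _ _ _ _ _ (hnl (hmin _))]
          simp only [one_mul, mul_one] }
    else normalMultiples _ hD.isNormal
  have hNlt : ∀ j (hj : j < e) x, x ∈ N j ↔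
      ∃ y : X, (x : X) = E i₀ (σ j hj) 1 (hnl (hmin _)) • y := fun j hj x => by
    simp only [N, dif_pos hj]; rfl
  have hzN : ∀ j, normalMultiples _ hD.isNormal ≤ N j := by
    intro j
    by_cases hj : j < e
    · rintro _ ⟨x, rfl⟩
      rw [hNlt j hj]
      refine ⟨E (σ j hj) i₀ z (fun _ => dvd_rfl) • (x : X), ?_⟩
      rw [hsmul, E_smul _ _ _ _ _ _ _ (hnl le_rfl)]
      simp only [one_mul]
    · simp only [N, dif_neg hj]; exact le_rfl
  have hblock : ∀ (i : ι) (x : X) (hx : E i₀ i 1 (hnl (hmin _)) • x ∈ corner R h hD.isNormal X i₀),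
      (⟨_, hx⟩ : corner R h hD.isNormal X i₀) ∈ N (h i) := by
    intro i x hx
    rw [hNlt _ (hlt i)]
    refine ⟨E (σ (h i) (hlt i)) i 1 (hnl (hσ _ _).le) • x, ?_⟩
    rw [E_smul _ _ _ _ _ _ _ (by rw [one_mul]; exact hnl (hmin _))]
    simp only [one_mul]
  let C : ∀ i, X →ₗ[R] corner R h hD.isNormal X i₀ := fun i =>
    { toFun := fun x => ⟨E i₀ i 1 (hnl (hmin _)) • x, blockSingle_smul_mem_corner _ _ _ _ _⟩
      map_add' := fun x x' => Subtype.ext (smul_add _ _ _)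
      map_smul' := fun r x => Subtype.ext (smul_comm _ _ _) }
  obtain ⟨n, b, hb⟩ := hD.exists_adapted_basis (X := corner R h hD.isNormal X i₀) e N
    (by
      rw [eq_top_iff]
      rintro x -
      rw [hNlt 0 he]
      refine ⟨E (σ 0 he) i₀ 1 (hnl (by rw [hσ, hi₀])) • (x : X), ?_⟩
      rw [E_smul _ _ _ _ _ _ _ (hnl le_rfl)]
      simp only [one_mul]
      exact x.2.symm)
    (by simp only [N, dif_neg (lt_irrefl e)])
    (by
      intro j j' hjj
      by_cases hj' : j' < e
      · intro x hx
        obtain ⟨y, hy⟩ := (hNlt j' hj' x).1 hx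
        have hj : j < e := hjj.trans_lt hj'
        rw [hNlt j hj]
        refine ⟨E (σ j hj) (σ j' hj') 1 (hnl (by rw [hσ, hσ]; exact hjj)) • y, ?_⟩
        rw [hy, E_smul _ _ _ _ _ _ _ (by rw [one_mul]; exact hnl (hmin _))]
        simp only [one_mul]
      · refine le_trans (le_of_eq ?_) (hzN j)
        simp only [N, dif_neg hj'])
    (by
      intro j hj
      refine fun b x => hD.pure_of_closed hdim hq (hzN j) (fun x hx => ?_) b x
      by_cases hj : j < e
      · rw [hNlt j hj]
        -- Since `c = z w`, the vector `c x` lies in the multiples of `z`, hence in the image of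
        -- block `j`. Saturation of `X` divides the chosen preimage by `c`.
        have hcx : c • x ∈ N j := by
          rw [← algebraMap_smul D c x, ← hzw, mul_smul]
          exact hzN j ⟨_, rfl⟩
        obtain ⟨y, hy⟩ := (hNlt j hj _).1 hcx
        obtain ⟨y', hy'⟩ := hX c hc (E (σ j hj) (σ j hj) 1 (hnl le_rfl) • y) fun a ha => by
          obtain ⟨t, ht⟩ := (hNlt j hj _).1 (hx a ha)
          refine ⟨E (σ j hj) (σ j hj) 1 (hnl le_rfl) • t, ?_⟩
          rw [← sub_eq_zero, smul_comm a, smul_comm c, ← smul_sub]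
          refine hD.blockSingle_injective (hmin _) ?_
          rw [smul_sub, smul_comm _ a y, smul_comm _ c t]
          change a • E i₀ (σ j hj) 1 (hnl (hmin _)) • y - c • E i₀ (σ j hj) 1 (hnl (hmin _)) • t = 0
          rw [← hy, ← ht]
          change a • c • (x : X) - c • a • (x : X) = 0
          rw [smul_comm, sub_self]
        refine ⟨y', ?_⟩
        have h5 : c • (x : X) = c • E i₀ (σ j hj) 1 (hnl (hmin _)) • y' := by
          rw [← smul_comm _ c y', ← hy', E_smul _ _ _ _ _ _ _ (by rw [one_mul]; exact hnl (hmin _))]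
          simp only [one_mul]
          exact hy
        rw [← sub_eq_zero, ← smul_sub] at h5
        exact sub_eq_zero.1 ((smul_eq_zero.1 h5).resolve_left hc)
      · simp only [N, dif_neg hj] at hx ⊢
        refine hD.normalMultiples_closed ?_ x hx
        exact hX.of_retract (corner R h hD.isNormal X i₀).subtype (C i₀) fun y => Subtype.ext y.2)
  have hC : ∀ i (x : X), C i x ∈ N (h i) := fun i x => hblock i x _
  have hCsmul : ∀ i (M : blockTriangular R h z hD.isNormal) (x : X),
      C i (M • x) = ∑ l, M.1 i l • C l x := by
    intro i M x
    apply Subtype.ext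
    rw [AddSubmonoidClass.coe_finsetSum]
    simp only [hsmul]
    change E i₀ i 1 _ • M • x = ∑ l, E i₀ i₀ (M.1 i l) _ • E i₀ l 1 _ • x
    have h6 : ∀ l, E i₀ i₀ (M.1 i l) (hnl le_rfl) • E i₀ l 1 (hnl (hmin _)) • x =
        E i₀ l (M.1 i l) (hnl (hmin _)) • x := fun l => by
      rw [E_smul _ _ _ _ _ _ _ (by rw [mul_one]; exact hnl (hmin _))]
      simp only [mul_one]
    simp only [h6]
    rw [smul_smul, ← Finset.sum_smul]
    congr 1
    apply Subtype.ext
    rw [AddSubmonoidClass.coe_finsetSum]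
    change Matrix.single i₀ i 1 * M.1 = ∑ l, Matrix.single i₀ l (M.1 i l)
    ext a a'
    rw [Matrix.sum_apply]
    by_cases ha : a = i₀
    · subst ha
      simp [Matrix.single_apply]
    · rw [Matrix.single_mul_apply_of_ne _ _ _ _ _ ha]
      simp [Ne.symm ha]
  have hCinj : ∀ x : X, (∀ i, C i x = 0) → x = 0 := by
    intro x hx
    have h7 : ∀ i, E i i 1 (hnl le_rfl) • x = 0 := fun i =>
      hD.blockSingle_injective (hmin i) (congrArg Subtype.val (hx i))
    rw [← one_smul (blockTriangular R h z hD.isNormal) x,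
      show (1 : blockTriangular R h z hD.isNormal) = ∑ i, E i i 1 (hnl le_rfl) from ?_,
      Finset.sum_smul]
    · exact Finset.sum_eq_zero fun i _ => h7 i
    · apply Subtype.ext
      rw [AddSubmonoidClass.coe_finsetSum]
      change 1 = ∑ i, Matrix.single i i (1 : D)
      exact (Matrix.sum_single_one).symm
  have hby : ∀ k, ∃ y : X, b k = C (σ k.1 k.1.2) y := by
    intro k
    obtain ⟨y, hy⟩ := (hNlt k.1 k.1.2 _).1 ((hb k.1 k.1.2.le (b k)).2 fun k' hk' => by
      rw [b.repr_self, Finsupp.single_apply, if_neg (by rintro rfl; exact hk'.false)]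
      exact dvd_zero z)
    exact ⟨y, Subtype.ext hy⟩
  choose y hy using hby
  -- The matrix for the basis vector `k` carries the `k`-th coordinates of all corners of `x` in the
  -- single column `σ k`; the criterion for membership in `N (h i)` makes it block triangular.
  -- Sending the `k`-th generator to a lift `y k` of `b k` gives the retraction.
  let f : X →ₗ[blockTriangular R h z hD.isNormal]
      ((Σ j : Fin e, Fin (n j)) → blockTriangular R h z hD.isNormal) :=
    { toFun := fun x k => ⟨fun i j => if j = σ k.1 k.1.2 then b.repr (C i x) k else 0, fun i j hij => by
        dsimp only
        split_ifs with hj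
        · subst hj
          rw [hσ] at hij
          exact (hb (h i) (hlt i).le _).1 (hC i x) k hij
        · exact dvd_zero z⟩
      map_add' := fun x x' => funext fun k => Subtype.ext <| Matrix.ext fun i j => by
        change (if j = σ k.1 k.1.2 then b.repr (C i (x + x')) k else 0) =
          (if j = σ k.1 k.1.2 then b.repr (C i x) k else 0) +
            (if j = σ k.1 k.1.2 then b.repr (C i x') k else 0)
        split_ifs <;> simp
      map_smul' := fun M x => funext fun k => Subtype.ext <| Matrix.ext fun i j => by
        change (if j = σ k.1 k.1.2 then b.repr (C i (M • x)) k else 0) = (M.1 *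
          Matrix.of fun i j => if j = σ k.1 k.1.2 then b.repr (C i x) k else 0) i j
        rw [hCsmul, Matrix.mul_apply]
        simp only [Matrix.of_apply]
        split_ifs <;> simp }
  refine Module.Projective.of_split f (Fintype.linearCombination _ y) (LinearMap.ext fun x => ?_)
  rw [LinearMap.comp_apply, LinearMap.id_apply, Fintype.linearCombination_apply, ← sub_eq_zero]
  refine hCinj _ fun i => ?_
  rw [map_sub, sub_eq_zero, map_sum]
  conv_rhs => rw [← b.sum_repr (C i x)]
  refine Finset.sum_congr rfl fun k _ => ?_
  rw [hCsmul, Finset.sum_eq_single (σ k.1 k.1.2), hy]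
  · change (if _ then _ else _) • _ = _
    rw [if_pos rfl]
  · intro l _ hl
    change (if _ then _ else _) • _ = _
    rw [if_neg hl, zero_smul]
  · simp

end Projective

end NormalOrders

namespace NormalOrders

open CategoryTheory Abelian

/-! ### Auslander's theorem on cyclic modules -/

section Auslander

variable {A : Type v} [Ring A]

/-- The obstruction to extending a map `I → N` to `A` lies in `Ext¹(A ⧸ I, N)`. -/
theorem baer_of_subsingleton_ext (N : ModuleCat.{v} A)
    (h : ∀ I : Ideal A, Subsingleton (Ext (ModuleCat.of A (A ⧸ I)) N 1)) : Module.Baer A N := by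
  intro I g
  have hS : (I.mkQ.shortComplexKer).ShortExact :=
    LinearMap.shortExact_shortComplexKer I.mkQ_surjective
  let e : LinearMap.ker I.mkQ →ₗ[A] N := g.comp (LinearEquiv.ofEq _ _ I.ker_mkQ).toLinearMap
  obtain ⟨x, hx⟩ := Ext.contravariant_sequence_exact₁ hS N (Ext.mk₀ (ModuleCat.ofHom e))
    (add_zero 1) ((h I).elim _ _)
  obtain ⟨φ, rfl⟩ := (Ext.mk₀_bijective _ _).2 x
  rw [Ext.mk₀_comp_mk₀, (Ext.mk₀_bijective _ _).1.eq_iff] at hx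
  refine ⟨φ.hom, fun x hxI => ?_⟩
  have h1 := congrArg (fun f => f.hom (⟨x, by rwa [I.ker_mkQ]⟩ : LinearMap.ker I.mkQ)) hx
  exact h1

/-- Dimension shifting along an embedding into an injective module reduces to Baer's criterion. -/
theorem hasInjectiveDimensionLT_of_subsingleton_ext (k : ℕ) (N : ModuleCat.{v} A)
    (h : ∀ I : Ideal A, Subsingleton (Ext (ModuleCat.of A (A ⧸ I)) N (k + 1))) :
    HasInjectiveDimensionLT N (k + 1) := by
  induction k generalizing N with
  | zero =>
    have := (baer_of_subsingleton_ext N h).injective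
    have : Injective N := Module.injective_object_of_injective_module A N
    infer_instance
  | succ k ih =>
    obtain ⟨p⟩ := EnoughInjectives.presentation N
    have hS := p.shortExact_shortComplex
    refine (hS.hasInjectiveDimensionLT_X₃_iff k p.injective).1 (ih _ fun I => ?_)
    refine subsingleton_of_forall_eq 0 fun x => ?_
    obtain ⟨y, rfl⟩ := Ext.covariant_sequence_exact₃ (ModuleCat.of A (A ⧸ I)) hS x rfl
      ((h I).elim _ _)
    have : Injective p.shortComplex.X₂ := p.injective
    rw [y.eq_zero_of_hasInjectiveDimensionLT 1 (by omega), Ext.zero_comp]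

/-- Auslander's theorem: the projective dimensions of all modules are bounded by those of cyclic
modules. -/
theorem hasProjectiveDimensionLT_of_cyclic (k : ℕ)
    (h : ∀ I : Ideal A, HasProjectiveDimensionLT (ModuleCat.of A (A ⧸ I)) (k + 1))
    (M : ModuleCat.{v} A) : HasProjectiveDimensionLT M (k + 1) := by
  refine (hasProjectiveDimensionLT_iff M (k + 1)).2 fun i hi N e => ?_
  have := hasInjectiveDimensionLT_of_subsingleton_ext k N fun I =>
    HasProjectiveDimensionLT.subsingleton _ (k + 1) (k + 1) le_rfl _
  exact e.eq_zero_of_hasInjectiveDimensionLT (k + 1) hi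

end Auslander

/-! ### Global dimension two from projectivity of saturated modules -/

section GlobalDimension

open IsLocalRing

variable (R : Type u) [CommRing R] [IsDomain R] [IsNoetherianRing R] [IsLocalRing R]
  (A : Type v) [Ring A] [Algebra R A]

/-- The finite torsion-free saturated modules of the algebra `A` are projective. -/
def ProjectiveOfSaturated : Prop :=
  ∀ (X : Type v) [AddCommGroup X] [Module R X] [Module A X] [IsScalarTower R A X]
    [Module.Finite R X] [Module.IsTorsionFree R X], IsSaturated R X → Module.Projective A X

variable {R A}

theorem IsSaturated.ker {X Y : Type*} [AddCommGroup X] [Module R X] [AddCommGroup Y]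
    [Module R Y] [Module.IsTorsionFree R Y] (hX : IsSaturated R X) (f : X →ₗ[R] Y) :
    IsSaturated R (LinearMap.ker f) := by
  refine hX.of_injective (LinearMap.ker f).subtype Subtype.val_injective fun c hc x hx => ?_
  rw [Submodule.range_subtype, LinearMap.mem_ker, map_smul] at *
  exact (smul_eq_zero.1 hx).resolve_left hc

/-- A second syzygy is the kernel of a map from a power of `A` to a torsion-free module. It is
therefore saturated, hence projective. -/
theorem ProjectiveOfSaturated.hasProjectiveDimensionLT (h : ProjectiveOfSaturated R A)
    [Module.Finite R A] [Module.IsTorsionFree R A] (hA : IsSaturated R A) (M : ModuleCat.{v} A)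
    [Module.Finite A M] : HasProjectiveDimensionLT M 3 := by
  have : IsNoetherianRing A := IsNoetherianRing.of_finite R A
  obtain ⟨n, f, hf⟩ := Module.Finite.exists_fin' A M
  obtain ⟨m, g, hg⟩ := Module.Finite.exists_fin' A (LinearMap.ker f)
  have h1 := LinearMap.shortExact_shortComplexKer hf
  have h2 := LinearMap.shortExact_shortComplexKer hg
  have : Module.Finite R (LinearMap.ker g) := Module.Finite.trans A _
  have h3 : Module.Projective A (LinearMap.ker g) := by
    refine h _ ?_
    exact (IsSaturated.pi fun _ : Fin m => hA).ker (g.restrictScalars R)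
  have h4 : Projective (ModuleCat.of A (LinearMap.ker g)) :=
    (IsProjective.iff_projective _).1 h3
  have h5 : ∀ k : ℕ, Projective (ModuleCat.of A (Fin k → A)) := fun k =>
    (IsProjective.iff_projective _).1 inferInstance
  refine (h1.hasProjectiveDimensionLT_X₃_iff 1 (h5 n)).2 ?_
  refine (h2.hasProjectiveDimensionLT_X₃_iff 0 (h5 m)).2 ?_
  exact projective_iff_hasProjectiveDimensionLT_one.1 h4

/-- The module is `A ⧸ mA`. If its projective dimension were at most one, `mA` would be projective,
so a summand of a power of `A`, and saturated; but it is proper by Nakayama, and a proper `mA` is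
not saturated. -/
theorem exists_not_hasProjectiveDimensionLT_two (hm : maximalIdeal R ≠ ⊥) [Nontrivial A]
    [Module.Finite R A] [Module.IsTorsionFree R A] (hA : IsSaturated R A) :
    ∃ M : ModuleCat.{v} A, ¬ HasProjectiveDimensionLT M 2 := by
  have : IsNoetherianRing A := IsNoetherianRing.of_finite R A
  let I : Ideal A := Ideal.span (algebraMap R A '' maximalIdeal R)
  have hI : ∀ a ∈ maximalIdeal R, algebraMap R A a ∈ I := fun a ha =>
    Ideal.subset_span ⟨a, ha, rfl⟩
  have hI1 : (1 : A) ∉ I := by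
    intro h1
    have h2 : ∀ x ∈ I, x ∈ maximalIdeal R • (⊤ : Submodule R A) := by
      intro x hx
      refine Submodule.span_induction ?_ (zero_mem _) (fun _ _ _ _ => add_mem) ?_ hx
      · rintro _ ⟨a, ha, rfl⟩
        rw [Algebra.algebraMap_eq_smul_one]
        exact Submodule.smul_mem_smul ha trivial
      · intro b x _ hx
        have := Submodule.mem_map_of_mem (f := LinearMap.mulLeft R b) hx
        rw [Submodule.map_smul''] at this
        exact Submodule.smul_mono le_rfl le_top this
    have h3 : (⊤ : Submodule R A) ≤ maximalIdeal R • ⊤ := fun x _ =>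
      h2 x (by simpa using I.mul_mem_left x h1)
    exact top_ne_bot (Submodule.eq_bot_of_le_smul_of_le_jacobson_bot _ _
      Module.Finite.fg_top h3 (IsLocalRing.maximalIdeal_le_jacobson _))
  refine ⟨ModuleCat.of A (A ⧸ I), fun hpd => ?_⟩
  have hS : (I.mkQ.shortComplexKer).ShortExact :=
    LinearMap.shortExact_shortComplexKer I.mkQ_surjective
  have h5 : Projective (ModuleCat.of A A) := (IsProjective.iff_projective _).1 inferInstance
  have h6 := projective_iff_hasProjectiveDimensionLT_one.2
    ((hS.hasProjectiveDimensionLT_X₃_iff 0 h5).1 hpd)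
  have h7 : Module.Projective A (LinearMap.ker I.mkQ) := (IsProjective.iff_projective _).2 h6
  rw [I.ker_mkQ] at h7
  obtain ⟨n, f, hf⟩ := Module.Finite.exists_fin' A I
  obtain ⟨g, hg⟩ := Module.projective_lifting_property f LinearMap.id hf
  have hsat : IsSaturated R I := (IsSaturated.pi fun _ : Fin n => hA).of_retract
    (g.restrictScalars R) (f.restrictScalars R) fun y => LinearMap.congr_fun hg y
  obtain ⟨c, hc, hc0⟩ := Submodule.exists_mem_ne_zero_of_ne_bot hm
  -- For `a ∈ m` one has `a · c = c · a` with `a ∈ mA`, so saturation would divide `c` by itself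
  -- inside `mA`, giving `1 ∈ mA`.
  obtain ⟨y, hy⟩ := hsat c hc0 ⟨algebraMap R A c, hI c hc⟩ fun a ha =>
    ⟨⟨algebraMap R A a, hI a ha⟩, Subtype.ext (by
      change a • algebraMap R A c = c • algebraMap R A a
      rw [Algebra.smul_def, Algebra.smul_def, Algebra.commutes])⟩
  have hy' : algebraMap R A c = c • (y : A) := congrArg Subtype.val hy
  rw [Algebra.algebraMap_eq_smul_one, ← sub_eq_zero, ← smul_sub] at hy'
  rw [sub_eq_zero.1 ((smul_eq_zero.1 hy').resolve_left hc0)] at hI1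
  exact hI1 y.2

theorem ProjectiveOfSaturated.leftGlobalDimension_eq_two (h : ProjectiveOfSaturated R A)
    (hm : maximalIdeal R ≠ ⊥) [Nontrivial A] [Module.Finite R A] [Module.IsTorsionFree R A]
    (hA : IsSaturated R A) : leftGlobalDimension A = 2 := by
  refine le_antisymm (iSup_le fun M => ?_) ?_
  · refine (projectiveDimension_le_iff M 2).2 ?_
    exact hasProjectiveDimensionLT_of_cyclic 2
      (fun I => h.hasProjectiveDimensionLT hA (ModuleCat.of A (A ⧸ I))) M
  · obtain ⟨M, hM⟩ := exists_not_hasProjectiveDimensionLT_two hm hA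
    exact ((projectiveDimension_ge_iff M 2).2 hM).trans (le_iSup (fun M => projectiveDimension M) M)

end GlobalDimension

section Transport

variable {R : Type u} [CommRing R] [IsDomain R] [IsLocalRing R]

theorem projective_of_ringEquiv {A : Type*} [Ring A] {B : Type*} [Ring B] (e : A ≃+* B)
    {X : Type*} [AddCommGroup X] [Module A X] [Module B X] (he : ∀ (a : A) (x : X), e a • x = a • x)
    [Module.Projective A X] : Module.Projective B X := by
  have := RingHomInvPair.of_ringEquiv e
  have := RingHomInvPair.of_ringEquiv e.symm
  let f : X ≃ₛₗ[(e : A →+* B)] X :=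
    { AddEquiv.refl X with map_smul' := fun a x => (he a x).symm }
  exact Module.Projective.of_equiv f

theorem ProjectiveOfSaturated.of_algEquiv {A B : Type v} [Ring A] [Algebra R A] [Ring B]
    [Algebra R B] (h : ProjectiveOfSaturated R A) (e : A ≃ₐ[R] B) : ProjectiveOfSaturated R B := by
  intro X _ _ _ _ _ _ hX
  let _ : Module A X := Module.compHom X (e : A →+* B)
  have he : ∀ (a : A) (x : X), e a • x = a • x := fun _ _ => rfl
  have : IsScalarTower R A X := ⟨fun r a x => by
    rw [← he, ← he, map_smul, smul_assoc]⟩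
  have := h X hX
  exact projective_of_ringEquiv e.toRingEquiv he

end Transport

/-! ### Left and right global dimension of block triangular orders -/

section Block

open IsLocalRing MulOpposite

/-- The opposite of a block triangular order is block triangular. -/
def blockTriangularOpEquiv {R : Type*} [CommRing R] {D : Type*} [Ring D] [Algebra R D] {ι : Type*}
    [Fintype ι] [DecidableEq ι] {h h' : ι → ℕ} (hh : ∀ i j, h' j < h' i ↔ h i < h j) {z : D}
    (hz : IsNormalElement z) :
    (blockTriangular R h z hz)ᵐᵒᵖ ≃ₐ[R] blockTriangular R h' (op z) hz.op where
  toFun x := ⟨Matrix.of fun i j => op (x.unop.1 j i), fun i j hij =>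
    (hz.op_dvd_iff _).2 (x.unop.2 j i ((hh i j).1 hij))⟩
  invFun y := op ⟨Matrix.of fun i j => unop (y.1 j i), fun i j hij =>
    (hz.op_dvd_iff (y.1 j i)).1 (y.2 j i ((hh j i).2 hij))⟩
  left_inv _ := rfl
  right_inv _ := rfl
  map_mul' x y := Subtype.ext <| Matrix.ext fun i j => by
    change op ((y.unop.1 * x.unop.1) j i) = ((Matrix.of fun i j => op (x.unop.1 j i)) *
      (Matrix.of fun i j => op (y.unop.1 j i)) : Matrix ι ι Dᵐᵒᵖ) i j
    simp [Matrix.mul_apply]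
  map_add' _ _ := rfl
  commutes' r := Subtype.ext <| Matrix.ext fun i j => by
    change op (algebraMap R (Matrix ι ι D) r j i) = algebraMap R (Matrix ι ι Dᵐᵒᵖ) r i j
    rw [Matrix.algebraMap_matrix_apply, Matrix.algebraMap_matrix_apply]
    simp only [eq_comm]
    split_ifs <;> rfl

variable {R : Type u} [CommRing R] [IsDomain R] [IsNoetherianRing R] [IsLocalRing R]
  {D : Type v} [Ring D] [Algebra R D] {q : Ideal R} {z : D} {ι : Type*} [Fintype ι]
  [DecidableEq ι] {h : ι → ℕ}

theorem IsUniformizing.leftGlobalDimension_eq_two (hD : IsUniformizing R q z)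
    (hdim : ringKrullDim R = 2) [q.IsPrime] (hq : q.height = 1) {e : ℕ} (he : 0 < e) {κ : Type}
    [Fintype κ] [DecidableEq κ] {h : κ → ℕ}
    (hlt : ∀ i, h i < e) (hsurj : ∀ j < e, ∃ i, h i = j) {A : Type v} [Ring A] [Algebra R A]
    [Module.Finite R A] [Module.IsTorsionFree R A] [Nontrivial A] (hA : IsSaturated R A)
    (f : blockTriangular R h z hD.isNormal ≃ₐ[R] A) : leftGlobalDimension A = 2 := by
  have h1 : ProjectiveOfSaturated R (blockTriangular R h z hD.isNormal) := by
    intro X _ _ _ _ _ _ hX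
    exact hD.projective_of_isSaturated hdim hq he hlt hsurj hX
  refine (h1.of_algEquiv f).leftGlobalDimension_eq_two ?_ hA
  intro hbot
  have := (IsLocalRing.isField_iff_maximalIdeal_eq (R := R)).2 hbot
  have h0 := ringKrullDim_eq_zero_of_isField this
  rw [hdim] at h0
  exact absurd h0 (by norm_num)

/-- Transposition turns the opposite order into a block triangular order over the opposite of `D`,
with the blocks numbered backwards by `e - 1 - h i`. -/
theorem IsUniformizing.rightGlobalDimension_eq_two (hD : IsUniformizing R q z)
    (hdim : ringKrullDim R = 2) [q.IsPrime] (hq : q.height = 1) {e : ℕ} (he : 0 < e) {κ : Type}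
    [Fintype κ] [DecidableEq κ] {h : κ → ℕ}
    (hlt : ∀ i, h i < e) (hsurj : ∀ j < e, ∃ i, h i = j) {A : Type v} [Ring A] [Algebra R A]
    [Module.Finite R A] [Module.IsTorsionFree R A] [Nontrivial A] (hA : IsSaturated R A)
    (f : blockTriangular R h z hD.isNormal ≃ₐ[R] A) : rightGlobalDimension A = 2 := by
  have hh : ∀ i j, e - 1 - h j < e - 1 - h i ↔ h i < h j := fun i j => by
    have := hlt i; have := hlt j; omega
  have : Module.Finite R Aᵐᵒᵖ := Module.Finite.equiv (opLinearEquiv R)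
  have : Module.IsTorsionFree R Aᵐᵒᵖ :=
    Function.Injective.moduleIsTorsionFree unop unop_injective fun _ _ => rfl
  exact hD.op.leftGlobalDimension_eq_two hdim hq he (h := fun i => e - 1 - h i)
    (fun i => by have := hlt i; omega)
    (fun j hj => by obtain ⟨i, hi⟩ := hsurj (e - 1 - j) (by omega); exact ⟨i, by omega⟩)
    (hA.of_linearEquiv (opLinearEquiv R))
    ((blockTriangularOpEquiv (R := R) hh hD.isNormal).symm.trans (AlgEquiv.op f))

end Block

end NormalOrders

namespace NormalOrders

open IsLocalRing

/-! ### Embedding an order into matrices over `D` -/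

theorem exists_smul_eq_of_finite {R Q ι : Type*} [CommRing R] [IsDomain R] [Ring Q] [Algebra R Q]
    [Finite ι] {D : Type*} [Ring D] [Algebra R D] (j : D →ₐ[R] Q)
    (h : ∀ x : Q, ∃ r : R, r ≠ 0 ∧ ∃ a, r • x = j a) (x : ι → Q) :
    ∃ r : R, r ≠ 0 ∧ ∃ a : ι → D, ∀ i, r • x i = j (a i) := by
  classical
  cases nonempty_fintype ι
  choose r hr a ha using fun i => h (x i)
  refine ⟨∏ i, r i, Finset.prod_ne_zero_iff.2 fun i _ => hr i,
    fun i => (∏ k ∈ Finset.univ.erase i, r k) • a i, fun i => ?_⟩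
  rw [map_smul, ← ha, smul_smul, Finset.prod_erase_mul _ _ (Finset.mem_univ i)]

section Embedding

variable {R : Type*} [CommRing R] [IsDomain R] [IsNoetherianRing R] [IsLocalRing R]

theorem mem_bot_of_mem_saturation (hm : maximalIdeal R ≠ ⊥) {V : Type*} [AddCommGroup V]
    [Module R V] [Module.IsTorsionFree R V] {v : V} (hv : v ∈ saturation (⊥ : Submodule R V)) :
    v = 0 := by
  obtain ⟨k, hk⟩ := hv
  obtain ⟨a, ha, ha0⟩ := Submodule.exists_mem_ne_zero_of_ne_bot (pow_ne_zero k hm)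
  exact (smul_eq_zero.1 (hk a ha)).resolve_left ha0

variable {D : Type*} [Ring D] [Algebra R D] {q : Ideal R} {z : D}

/-- A corner of a matrix algebra over the quotient ring of `D` contains, up to conjugation and
commensurability, every order in it inside a matrix algebra over `D`. -/
theorem IsUniformizing.exists_algHom_matrix (hD : IsUniformizing R q z) (K : Type*) [Field K]
    [Algebra R K] [IsFractionRing R K] (hR : IsSaturated R R)
    (hdim : ringKrullDim R = 2) [q.IsPrime] (hq : q.height = 1) (hm : maximalIdeal R ≠ ⊥)
    {Q : Type*} [Ring Q] [Algebra K Q] [Algebra R Q] [IsScalarTower R K Q] [FiniteDimensional K Q]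
    (j : D →ₐ[R] Q) (hj : ∀ x : Q, ∃ r : R, r ≠ 0 ∧ ∃ a, r • x = j a)
    {A : Type*} [Ring A] [Algebra R A] [Module.Finite R A] {P : Type*} [Fintype P] [DecidableEq P]
    (σ : A →ₗ[R] Matrix P P Q) (hσmul : ∀ a b, σ (a * b) = σ a * σ b)
    (hσinj : Function.Injective σ)
    (hσ : ∀ Y : Matrix P P Q, σ 1 * Y * σ 1 = Y → ∃ r : R, r ≠ 0 ∧ ∃ a, r • Y = σ a) :
    ∃ (n : ℕ) (φ : A →ₐ[R] Matrix (Fin n) (Fin n) D), Function.Injective φ ∧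
      ∀ X, ∃ r : R, r ≠ 0 ∧ ∃ a, φ a = r • X := by
  have := hD.finite
  have htf : Module.IsTorsionFree R (P → Q) := by
    have : Module.IsTorsionFree R Q := Module.IsTorsionFree.trans_faithfulSMul R K Q
    infer_instance
  let _ : Module D (P → Q) := Module.compHom (P → Q) (j : D →+* Q)
  have hsmul : ∀ (d : D) (v : P → Q), d • v = j d • v := fun _ _ => rfl
  have : IsScalarTower R D (P → Q) := ⟨fun r d v => by
    rw [hsmul, hsmul, map_smul, smul_assoc]⟩
  have hsmulvec : ∀ (d : D) (v : P → Q) (Y : Matrix P P Q),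
      Matrix.vecMul (d • v) Y = d • Matrix.vecMul v Y := fun d v Y =>
    Matrix.smul_vecMul (j d) v Y
  let s : (P → A) →ₗ[R] (P → Q) :=
    { toFun := fun μ k => ∑ p, σ (μ p) p k
      map_add' := fun μ ν => funext fun k => by
        simp only [Pi.add_apply, map_add, Matrix.add_apply, Finset.sum_add_distrib]
      map_smul' := fun r μ => funext fun k => by
        simp only [Pi.smul_apply, map_smul, Matrix.smul_apply, Finset.smul_sum, RingHom.id_apply] }
  let B : D →ₗ[R] (P → A) →ₗ[R] (P → Q) := LinearMap.mk₂ R (fun δ μ => δ • s μ)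
    (fun _ _ _ => add_smul _ _ _) (fun _ _ _ => smul_assoc _ _ _)
    (fun δ μ ν => by rw [map_add, smul_add])
    (fun r δ μ => by rw [map_smul, smul_comm])
  have hB : ∀ δ μ, B δ μ = δ • s μ := fun _ _ => rfl
  -- `M₀` is the left `D`-span of the rows of all `σ a`. It is stable under right multiplication by
  -- `σ a`, and `σ 1` acts on it as the identity although `σ` need not be unital. Its saturation `M`
  -- keeps these properties and is free over `D`.
  let M₀ : Submodule R (P → Q) := Submodule.map₂ B ⊤ ⊤
  have hM₀fg : M₀.FG := Submodule.FG.map₂ B Module.Finite.fg_top Module.Finite.fg_top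
  have hvec : ∀ (a : A) (μ : P → A), Matrix.vecMul (s μ) (σ a) = s fun p => μ p * a := by
    intro a μ
    ext k
    change ∑ l, (∑ p, σ (μ p) p l) * σ a l k = ∑ p, σ (μ p * a) p k
    simp only [Finset.sum_mul, hσmul, Matrix.mul_apply]
    exact Finset.sum_comm
  have hM₀D : ∀ (d : D), ∀ v ∈ M₀, Algebra.lsmul R R (P → Q) d v ∈ M₀ := by
    intro d
    refine Submodule.map₂_le (r := M₀.comap (Algebra.lsmul R R (P → Q) d)) |>.2 ?_
    intro δ _ μ _
    change d • B δ μ ∈ M₀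
    rw [hB, ← mul_smul, ← hB]
    exact Submodule.apply_mem_map₂ _ trivial trivial
  let ρ₀ : Matrix P P Q → (P → Q) →ₗ[R] P → Q := fun Y =>
    { toFun := fun v => Matrix.vecMul v Y
      map_add' := fun _ _ => Matrix.add_vecMul _ _ _
      map_smul' := fun r v => Matrix.smul_vecMul r v Y }
  have hM₀A : ∀ (a : A), ∀ v ∈ M₀, ρ₀ (σ a) v ∈ M₀ := by
    intro a
    refine Submodule.map₂_le (r := M₀.comap (ρ₀ (σ a))) |>.2 ?_
    intro δ _ μ _
    change Matrix.vecMul (B δ μ) (σ a) ∈ M₀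
    rw [hB, hsmulvec, hvec, ← hB _ (fun p => μ p * a)]
    exact Submodule.apply_mem_map₂ _ trivial trivial
  have hM₀one : ∀ v ∈ M₀, (ρ₀ (σ 1) - LinearMap.id : (P → Q) →ₗ[R] P → Q) v ∈ (⊥ : Submodule R (P → Q)) := by
    refine Submodule.map₂_le (r := (⊥ : Submodule R (P → Q)).comap _) |>.2 ?_
    intro δ _ μ _
    change Matrix.vecMul (B δ μ) (σ 1) - B δ μ = 0
    rw [hB, hsmulvec, hvec, sub_eq_zero]
    simp only [mul_one]
  let M : Submodule D (P → Q) :=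
    { saturation M₀ with
      smul_mem' := fun d v hv => map_saturation_le (Algebra.lsmul R R (P → Q) d) (hM₀D d) hv }
  have hMmem : ∀ v, v ∈ M ↔ v ∈ saturation M₀ := fun _ => Iff.rfl
  have hMfin : Module.Finite R M :=
    Module.Finite.iff_fg.2 (saturation_fg K hR hM₀fg : (saturation M₀).FG)
  have hMsat : IsSaturated R M := isSaturated_saturation K M₀
  have hMA : ∀ (a : A), ∀ v ∈ M, Matrix.vecMul v (σ a) ∈ M := fun a v hv =>
    map_saturation_le (ρ₀ (σ a)) (hM₀A a) hv
  have hMone : ∀ v ∈ M, Matrix.vecMul v (σ 1) = v := fun v hv =>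
    sub_eq_zero.1 (mem_bot_of_mem_saturation hm (map_saturation_le
      (ρ₀ (σ 1) - LinearMap.id : (P → Q) →ₗ[R] P → Q) hM₀one hv))
  have hrow : ∀ p, σ 1 p ∈ M := by
    intro p
    refine le_saturation M₀ ?_
    have : σ 1 p = B 1 (Pi.single p 1) := by
      ext k
      rw [hB, one_smul]
      change _ = ∑ p', σ ((Pi.single p 1 : P → A) p') p' k
      rw [Finset.sum_eq_single p]
      · rw [Pi.single_eq_same]
      · intro p' _ hp'
        rw [Pi.single_eq_of_ne hp', map_zero]; rfl
      · simp
    rw [this]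
    exact Submodule.apply_mem_map₂ _ trivial trivial
  obtain ⟨n, ⟨b⟩⟩ := hD.exists_basis hdim hq (X := M) hMsat
  have hreprR : ∀ (r : R) (x : M) k, b.repr (r • x) k = r • b.repr x k := fun r x k => by
    rw [← algebraMap_smul D r x, map_smul, Finsupp.smul_apply, smul_eq_mul, Algebra.smul_def]
  let ρ : A → M →ₗ[D] M := fun a =>
    { toFun := fun v => ⟨Matrix.vecMul v.1 (σ a), hMA a v v.2⟩
      map_add' := fun _ _ => Subtype.ext (Matrix.add_vecMul _ _ _)
      map_smul' := fun d v => Subtype.ext (hsmulvec d v (σ a)) }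
  have hrepr : ∀ (T : M →ₗ[D] M) (x : M) k,
      b.repr (T x) k = ∑ i, b.repr x i * b.repr (T (b i)) k := by
    intro T x k
    conv_lhs => rw [← b.sum_repr x]
    simp only [map_sum, map_smul, Finsupp.finsetSum_apply, Finsupp.smul_apply, smul_eq_mul]
  -- Matrices act on row vectors from the right, commuting with `D` on the left, so taking
  -- coordinates in the basis of `M` preserves the order of products.
  let φ : A →ₐ[R] Matrix (Fin n) (Fin n) D := AlgHom.ofLinearMap
    { toFun := fun a => Matrix.of fun i k => b.repr (ρ a (b i)) k
      map_add' := fun a a' => Matrix.ext fun i k => by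
        have : ρ (a + a') (b i) = ρ a (b i) + ρ a' (b i) := Subtype.ext (by
          change Matrix.vecMul _ _ = Matrix.vecMul _ _ + Matrix.vecMul _ _
          rw [map_add, Matrix.vecMul_add])
        simp [this]
      map_smul' := fun r a => Matrix.ext fun i k => by
        have : ρ (r • a) (b i) = r • ρ a (b i) := Subtype.ext (by
          change Matrix.vecMul _ _ = r • Matrix.vecMul _ _
          rw [map_smul, Matrix.vecMul_smul])
        simp [this, hreprR] }
    (Matrix.ext fun i k => by
      have : ρ 1 (b i) = b i := Subtype.ext (hMone _ (b i).2)
      simp [this, Matrix.one_apply, Finsupp.single_apply])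
    (fun a a' => Matrix.ext fun i k => by
      have : ρ (a * a') (b i) = ρ a' (ρ a (b i)) := Subtype.ext (by
        change Matrix.vecMul _ _ = Matrix.vecMul (Matrix.vecMul _ _) _
        rw [hσmul, Matrix.vecMul_vecMul])
      simp only [LinearMap.coe_mk, AddHom.coe_mk, Matrix.of_apply, Matrix.mul_apply]
      rw [this, hrepr])
  have hφ : ∀ a i k, φ a i k = b.repr (ρ a (b i)) k := fun _ _ _ => rfl
  refine ⟨n, φ, (injective_iff_map_eq_zero φ).2 fun a ha => hσinj ?_, fun X => ?_⟩
  · have h1 : ∀ x, ρ a x = 0 := fun x => b.repr.injective <| Finsupp.ext fun k => by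
      rw [hrepr, map_zero]
      refine Finset.sum_eq_zero fun i _ => ?_
      rw [← hφ, ha]
      exact mul_zero _
    have h2 : σ 1 * σ a = 0 := Matrix.ext fun p k => by
      have := congrArg (fun x : M => x.1 k) (h1 ⟨_, hrow p⟩)
      exact this
    rw [← one_mul a, hσmul, h2, map_zero]
  · let T : M →ₗ[D] M := b.constr ℕ fun i => ∑ k, X i k • b k
    have hT : ∀ i, T (b i) = ∑ k, X i k • b k := fun i => b.constr_basis ℕ _ i
    -- A `D`-endomorphism of `M` is right multiplication by the matrix of its values on the rows of
    -- `σ 1`, as one sees after clearing denominators. Cutting this matrix down to the corner of `σ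
    -- 1` makes a multiple of it some `σ a`.
    let Y : Matrix P P Q := Matrix.of fun p => (T ⟨_, hrow p⟩ : P → Q)
    have hY : ∀ x : M, (T x : P → Q) = Matrix.vecMul x.1 Y := by
      intro x
      obtain ⟨r, hr, δ, hδ⟩ := exists_smul_eq_of_finite j hj x.1
      have h3 : r • x = ∑ p, δ p • (⟨_, hrow p⟩ : M) := Subtype.ext (by
        rw [Submodule.coe_sum]
        conv_lhs => rw [Submodule.coe_smul_of_tower, ← hMone x.1 x.2]
        ext k
        rw [Pi.smul_apply, Matrix.vecMul, dotProduct, Finset.smul_sum, Finset.sum_apply]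
        refine Finset.sum_congr rfl fun p _ => ?_
        rw [← smul_mul_assoc, hδ]
        rfl)
      have h4 : r • (T x : P → Q) = r • Matrix.vecMul x.1 Y := by
        have h5 := congrArg (fun x => (T x : P → Q)) h3
        simp only [map_sum, map_smul, LinearMap.map_smul_of_tower, Submodule.coe_sum,
          Submodule.coe_smul_of_tower] at h5
        rw [h5]
        ext k
        rw [Pi.smul_apply, Matrix.vecMul, dotProduct, Finset.smul_sum, Finset.sum_apply]
        refine Finset.sum_congr rfl fun p _ => ?_
        rw [← smul_mul_assoc, hδ]
        rfl
      rw [← sub_eq_zero, ← smul_sub] at h4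
      exact sub_eq_zero.1 ((smul_eq_zero.1 h4).resolve_left hr)
    have hE : σ 1 * σ 1 = σ 1 := by rw [← hσmul, one_mul]
    obtain ⟨r, hr, a, ha⟩ := hσ (σ 1 * Y * σ 1) (by
      rw [← mul_assoc, ← mul_assoc, hE, mul_assoc, hE])
    refine ⟨r, hr, a, Matrix.ext fun i k => ?_⟩
    have h6 : ρ a (b i) = r • T (b i) := Subtype.ext (by
      change Matrix.vecMul _ _ = r • (T (b i) : P → Q)
      rw [← ha, Matrix.vecMul_smul, ← Matrix.vecMul_vecMul, ← Matrix.vecMul_vecMul,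
        hMone _ (b i).2, ← hY, hMone _ (T (b i)).2])
    rw [hφ, h6, hreprR, hT]
    simp [Finsupp.single_apply]

end Embedding

/-! ### Using the Brauer class -/

section Brauer

variable {R : Type u} [CommRing R] [IsDomain R] [IsNoetherianRing R]

/-- An order which is Brauer equivalent to `Δ_d` embeds into a matrix algebra over `Δ`, as a
subalgebra of full rank. -/
theorem IsNiceNormalElement.exists_algHom_matrix [IsIntegrallyClosed R] [HenselianLocalRing R]
    (hdim : ringKrullDim R = 2) {D : Type v} [Ring D] [Algebra R D]
    {q : CodimOnePrime R} {z : D} (hz : IsNiceNormalElement q z) {d : ℕ} (hd : 0 < d)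
    {L : Type v} [Ring L] [Algebra R L] (hL : IsOrder R L)
    (hclass : brauerClass hL = brauerClass (hz.isOrder_triangularModulo hd)) :
    ∃ (n : ℕ) (φ : L →ₐ[R] Matrix (Fin n) (Fin n) D), Function.Injective φ ∧
      ∀ X, ∃ r : R, r ≠ 0 ∧ ∃ a, φ a = r • X := by
  have hD := hz.isUniformizing hdim
  have := hD.finite
  have := hL.finite
  have := hL.torsionFree
  have hm : maximalIdeal R ≠ ⊥ := by
    intro hbot
    have h0 := ringKrullDim_eq_zero_of_isField ((isField_iff_maximalIdeal_eq (R := R)).2 hbot)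
    rw [hdim] at h0
    exact absurd h0 (by norm_num)
  obtain ⟨n, m, hn, -, ⟨θ⟩⟩ : ∃ n m : ℕ, n ≠ 0 ∧ m ≠ 0 ∧
      Nonempty (Matrix (Fin n) (Fin n) (FractionRing R ⊗[R] L) ≃ₐ[FractionRing R]
        Matrix (Fin m) (Fin m)
          (FractionRing R ⊗[R] triangularModulo (R := R) d z hz.isNormal)) :=
    Quotient.exact hclass
  let τ := AlgEquiv.ofBijective _ (triangularToMatrix_bijective (d := d) hz.isMaximalOrder.isOrder
    hz.isDivision hz.isNormal hz.ne_zero)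
  let Θ := ((θ.trans τ.mapMatrix).trans (Matrix.compAlgEquiv (Fin m) (Fin d)
    (FractionRing R ⊗[R] D) (FractionRing R))).restrictScalars R
  let o : Fin n := ⟨0, Nat.pos_of_ne_zero hn⟩
  let i : L →ₐ[R] FractionRing R ⊗[R] L := Algebra.TensorProduct.includeRight
  -- Brauer equivalence only identifies matrix algebras over the two central simple algebras, so `L`
  -- enters as the corner of one diagonal matrix unit, a nonunital embedding.
  let σ : L →ₗ[R] Matrix (Fin m × Fin d) (Fin m × Fin d) (FractionRing R ⊗[R] D) :=
    Θ.toLinearMap ∘ₗ Matrix.singleLinearMap R o o ∘ₗ i.toLinearMap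
  have hσ : ∀ a, σ a = Θ (Matrix.single o o (i a)) := fun _ => rfl
  have hinj : Function.Injective i := (injective_iff_map_eq_zero i).2 fun a ha =>
    one_tmul_injective ha
  refine hD.exists_algHom_matrix (FractionRing R) (isSaturated_self R hdim) hdim q.2 hm
    Algebra.TensorProduct.includeRight exists_smul_eq_tmul σ (fun a b => ?_) (fun a b hab => ?_)
    fun Y hY => ?_
  · rw [hσ, hσ, hσ, ← map_mul, Matrix.single_mul_single_same, map_mul]
  · exact hinj (by simpa using congrFun (congrFun (Θ.injective hab) o) o)
  · obtain ⟨W, rfl⟩ := Θ.surjective Y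
    rw [hσ, ← map_mul, ← map_mul, map_one] at hY
    have hW := Θ.injective hY
    obtain ⟨r, hr, a, ha⟩ := exists_smul_eq_tmul (W o o)
    refine ⟨r, hr, a, ?_⟩
    rw [hσ, ← map_smul, ← hW, Matrix.single_mul_mul_single, Matrix.smul_single, one_mul, mul_one]
    exact congrArg (fun x => Θ (Matrix.single o o x)) ha

end Brauer

end NormalOrders

/-! ### Subrings with principal radical -/

namespace NormalOrders

/-- A finite geometric series times `1 + y x` is `1 - (-y x) ^ k`, which has a left inverse once the
power lies in the radical. -/
theorem mem_jacobson_of_forall_pow {H : Type*} [Ring H] {x : H}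
    (h : ∀ a : H, ∃ k : ℕ, (a * x) ^ k ∈ Ring.jacobson H) : x ∈ Ring.jacobson H := by
  rw [← Ideal.jacobson_bot, Ideal.mem_jacobson_iff]
  intro y
  obtain ⟨k, hk⟩ := h (-y)
  rw [← Ideal.jacobson_bot, Ideal.mem_jacobson_iff] at hk
  obtain ⟨u, hu⟩ := hk (-1)
  refine ⟨u * ∑ i ∈ Finset.range k, (-y * x) ^ i, ?_⟩
  rw [Ideal.mem_bot] at hu ⊢
  have h1 := geom_sum_mul (-y * x) k
  have h2 : (∑ i ∈ Finset.range k, (-y * x) ^ i) * (1 + y * x) = 1 - (-y * x) ^ k := by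
    rw [← neg_sub, ← h1]; noncomm_ring
  calc _ = u * ((∑ i ∈ Finset.range k, (-y * x) ^ i) * (1 + y * x)) - 1 := by noncomm_ring
    _ = u * -1 * (-y * x) ^ k + u - 1 := by rw [h2]; noncomm_ring
    _ = 0 := hu

theorem exists_mul_eq_of_mem_jacobson_iff {H : Type*} [Ring H] {t : H}
    (hJ : ∀ x : H, x ∈ Ring.jacobson H ↔ ∃ a, x = a * t) (x : H) : ∃ a, t * x = a * t :=
  (hJ _).1 ((Ring.jacobson H).mul_mem_right x ((hJ t).2 ⟨1, (one_mul t).symm⟩))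

section Overring

variable {H Γ G : Type*} [Ring H] [Ring Γ] [Ring G] {ι : H →+* Γ} {π : Γ →+* G} {t : H}

theorem exists_map_mul_eq_mul_pow (ht : ∀ x : H, ∃ a, t * x = a * t) (x : H) (j : ℕ) :
    ∃ Y : G, π (ι t) ^ j * π (ι x) = Y * π (ι t) ^ j := by
  have key : ∀ (j : ℕ) (x : H), ∃ a : H, t ^ j * x = a * t ^ j := by
    intro j
    induction j with
    | zero => exact fun x => ⟨x, by simp⟩
    | succ j ih =>
      intro x
      obtain ⟨a, ha⟩ := ht x
      obtain ⟨b, hb⟩ := ih a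
      exact ⟨b, by rw [pow_succ, mul_assoc, ha, ← mul_assoc, hb, mul_assoc]⟩
  obtain ⟨a, ha⟩ := key j x
  exact ⟨π (ι a), by simp only [← map_pow, ← map_mul, ha]⟩

theorem pow_eq_mul_pow {T y : G} (hy : ∀ j : ℕ, ∃ Y : G, T ^ j * y = Y * T ^ (j + 1)) (k : ℕ) :
    ∃ Y : G, y ^ k = Y * T ^ k := by
  induction k with
  | zero => exact ⟨1, by simp⟩
  | succ k ih =>
    obtain ⟨Y, hY⟩ := ih
    obtain ⟨Y', hY'⟩ := hy k
    exact ⟨Y * Y', by rw [pow_succ, hY, mul_assoc, hY', mul_assoc]⟩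

theorem mem_jacobson_of_forall_exists
    (hnil : ∀ x : H, IsNilpotent (π (ι x)) → ∃ k : ℕ, x ^ k ∈ Ring.jacobson H)
    (hT : IsNilpotent (π (ι t))) (ht : ∀ x : H, ∃ a, t * x = a * t) {x : H}
    (hx : ∀ j : ℕ, ∃ Y : G, π (ι t) ^ j * π (ι x) = Y * π (ι t) ^ (j + 1)) :
    x ∈ Ring.jacobson H := by
  refine mem_jacobson_of_forall_pow fun a => hnil _ ?_
  obtain ⟨n, hn⟩ := hT
  obtain ⟨Y, hY⟩ := pow_eq_mul_pow (T := π (ι t)) (y := π (ι (a * x))) (fun j => by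
    obtain ⟨Y, hY⟩ := exists_map_mul_eq_mul_pow (π := π) (ι := ι) ht a j
    obtain ⟨Y', hY'⟩ := hx j
    exact ⟨Y * Y', by rw [map_mul, map_mul, ← mul_assoc, hY, mul_assoc, hY', mul_assoc]⟩) n
  exact ⟨n, by rw [hY, hn, mul_zero]⟩

/-- With `T = π (ι t)`, elements `a t` shift the filtration `G T ^ j` by one step, because `t`
normalises `H` from one side. Conversely, if `x` shifts it, so does every `a x`, which is then
nilpotent in `G`, and `hnil` puts a power of it in the radical. -/
theorem mem_jacobson_iff_forall_exists
    (hnil : ∀ x : H, IsNilpotent (π (ι x)) → ∃ k : ℕ, x ^ k ∈ Ring.jacobson H)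
    (hT : IsNilpotent (π (ι t))) (hJ : ∀ x : H, x ∈ Ring.jacobson H ↔ ∃ a, x = a * t) (x : H) :
    x ∈ Ring.jacobson H ↔
      ∀ j : ℕ, ∃ Y : G, π (ι t) ^ j * π (ι x) = Y * π (ι t) ^ (j + 1) := by
  refine ⟨fun hx j => ?_, mem_jacobson_of_forall_exists hnil hT
    (exists_mul_eq_of_mem_jacobson_iff hJ)⟩
  obtain ⟨a, rfl⟩ := (hJ x).1 hx
  obtain ⟨Y, hY⟩ := exists_map_mul_eq_mul_pow (π := π) (ι := ι)
    (exists_mul_eq_of_mem_jacobson_iff hJ) a j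
  exact ⟨Y, by rw [map_mul, map_mul, ← mul_assoc, hY, mul_assoc, pow_succ]⟩

/-- A subring with principal radical is determined by the residue class of a generator of its
radical. -/
theorem mem_range_iff_forall_exists
    (hnil : ∀ x : H, IsNilpotent (π (ι x)) → ∃ k : ℕ, x ^ k ∈ Ring.jacobson H)
    (hT : IsNilpotent (π (ι t))) (hJ : ∀ x : H, x ∈ Ring.jacobson H ↔ ∃ a, x = a * t)
    (hfull : ∀ x : Γ, ∃ k : ℕ, x * ι t ^ k ∈ ι.range) (hreg : ∀ x : Γ, x * ι t = 0 → x = 0)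
    (x : Γ) : x ∈ ι.range ↔ ∀ j : ℕ, ∃ Y : G, π (ι t) ^ j * π x = Y * π (ι t) ^ j := by
  constructor
  · rintro ⟨x, rfl⟩ j
    exact exists_map_mul_eq_mul_pow (exists_mul_eq_of_mem_jacobson_iff hJ) x j
  · intro hx
    have key : ∀ k : ℕ, x * ι t ^ k ∈ ι.range → x ∈ ι.range := by
      intro k
      induction k with
      | zero => simp
      | succ k ih =>
        rintro ⟨y, hy⟩
        -- `y = x t ^ (k + 1)` shifts the filtration by at least one step, so it is `a t` with `a ∈
        -- H`. Cancelling `t` lowers the exponent.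
        have hyJ : y ∈ Ring.jacobson H := by
          refine (mem_jacobson_iff_forall_exists hnil hT hJ y).2 fun j => ?_
          obtain ⟨Y, hY⟩ := hx j
          refine ⟨Y * π (ι t) ^ k, ?_⟩
          rw [hy, map_mul, ← mul_assoc, hY, map_pow, mul_assoc, mul_assoc, ← pow_add, ← pow_add]
          congr 2
          omega
        obtain ⟨a, rfl⟩ := (hJ y).1 hyJ
        refine ih ⟨a, ?_⟩
        rw [← sub_eq_zero]
        refine hreg _ ?_
        rw [sub_mul, ← map_mul, hy, pow_succ, mul_assoc, sub_self]
    obtain ⟨k, hk⟩ := hfull x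
    exact key k hk

end Overring

/-! ### Counting central idempotents modulo the radical -/

section Idempotents

/-- A nonzero idempotent is not in the Jacobson radical, so it avoids some maximal ideal; that ideal
contains every idempotent orthogonal to it. -/
theorem card_le_card_maximalSpectrum {Z κ : Type*} [CommRing Z] [Finite (MaximalSpectrum Z)]
    (e : κ → Z) (he : ∀ i, e i * e i = e i) (h0 : ∀ i, e i ≠ 0)
    (horth : ∀ i j, i ≠ j → e i * e j = 0) : Nat.card κ ≤ Nat.card (MaximalSpectrum Z) := by
  have key : ∀ i, ∃ m : MaximalSpectrum Z, e i ∉ m.asIdeal := by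
    intro i
    by_contra! hm
    have h1 : e i ∈ (⊥ : Ideal Z).jacobson := by
      rw [Ideal.mem_jacobson_iff]
      rw [← Ideal.mem_jacobson_iff, Ideal.jacobson, Ideal.mem_sInf]
      exact fun {I} hI => hm ⟨I, hI.2⟩
    rw [Ideal.mem_jacobson_bot] at h1
    have h2 := h1 (-1)
    have h3 : (e i * -1 + 1) * e i = 0 := by
      linear_combination -he i
    exact h0 i (h2.mul_right_eq_zero.1 h3)
  choose m hm using key
  refine Nat.card_le_card_of_injective m fun i j hij => ?_
  by_contra hne
  have h4 : e i * e j ∈ (m i).asIdeal := by rw [horth i j hne]; exact zero_mem _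
  rcases (m i).isMaximal.isPrime.mem_or_mem h4 with h | h
  · exact hm i h
  · rw [hij] at h; exact hm j h

/-- A reduced artinian ring contains an orthogonal family of nonzero idempotents indexed by its
maximal ideals. -/
theorem exists_orthogonal_idempotents (Z : Type*) [CommRing Z] [IsArtinianRing Z] [IsReduced Z] :
    ∃ e : MaximalSpectrum Z → Z, (∀ i, e i * e i = e i) ∧ (∀ i, e i ≠ 0) ∧
      ∀ i j, i ≠ j → e i * e j = 0 := by
  classical
  let E := IsArtinianRing.equivPi Z
  refine ⟨fun m => E.symm (Pi.single m 1), fun m => ?_, fun m h => ?_, fun m n h => ?_⟩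
  · rw [← map_mul, ← Pi.single_mul, one_mul]
  · have h1 := congrFun (E.symm.injective (h.trans (map_zero E.symm).symm)) m
    rw [Pi.single_eq_same] at h1
    have := Ideal.Quotient.nontrivial_iff.2 m.isMaximal.ne_top
    exact one_ne_zero h1
  · rw [← map_mul, ← map_zero E.symm]
    congr 1
    ext k
    by_cases hk : k = m
    · subst hk; simp [h]
    · simp [hk]

variable {H Γ G : Type*} [Ring H] [Ring Γ] [Ring G] {ι : H →+* Γ} {π : Γ →+* G} {t : H}

/-- A subring with principal radical which is not maximal has more central idempotents modulo its
radical. -/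
theorem card_lt_card_maximalSpectrum_center [IsSemisimpleRing G]
    (hπ : Function.Surjective π)
    (hnil : ∀ x : H, IsNilpotent (π (ι x)) → ∃ k : ℕ, x ^ k ∈ Ring.jacobson H)
    (hT : IsNilpotent (π (ι t))) (hJ : ∀ x : H, x ∈ Ring.jacobson H ↔ ∃ a, x = a * t)
    (hfull : ∀ x : Γ, ∃ k : ℕ, x * ι t ^ k ∈ ι.range) (hreg : ∀ x : Γ, x * ι t = 0 → x = 0)
    {κ : Type*} [Finite κ] (ε : κ → G) (hε : ∀ i, ε i * ε i = ε i) (hε0 : ∀ i, ε i ≠ 0)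
    (hεorth : ∀ i j, i ≠ j → ε i * ε j = 0) (hεcomm : ∀ i x, ε i * x = x * ε i)
    [Finite (MaximalSpectrum (Subring.center (H ⧸ Ring.jacobson H)))] (hT0 : π (ι t) ≠ 0) :
    Nat.card κ < Nat.card (MaximalSpectrum (Subring.center (H ⧸ Ring.jacobson H))) := by
  set T := π (ι t) with hTdef
  -- The left ideal `G T` is generated by an idempotent `f`. It is the extra idempotent, and the
  -- given `ε i` are cut down to `(1 - f) ε i`.
  obtain ⟨f, hf, hspan⟩ := IsSemisimpleRing.ideal_eq_span_idempotent (Ideal.span {T})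
  have hfT : ∃ g, f = g * T := by
    have : f ∈ Ideal.span {T} := hspan ▸ Ideal.mem_span_singleton_self f
    obtain ⟨g, hg⟩ := Ideal.mem_span_singleton'.1 this
    exact ⟨g, hg.symm⟩
  obtain ⟨g, hg⟩ := hfT
  have hTf : T * f = T := by
    have : T ∈ Ideal.span {f} := hspan ▸ Ideal.mem_span_singleton_self T
    obtain ⟨a, ha⟩ := Ideal.mem_span_singleton'.1 this
    rw [← ha, mul_assoc, hf]
  have hH := mem_range_iff_forall_exists hnil hT hJ hfull hreg
  have hJ' := mem_jacobson_iff_forall_exists hnil hT hJ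
  have hpowf : ∀ j : ℕ, T ^ (j + 1) * f = T ^ (j + 1) := fun j => by
    rw [pow_succ, mul_assoc, hTf]
  have hfpow : ∀ x : H, f * π (ι x) = f * π (ι x) * f := by
    intro x
    obtain ⟨Y, hY⟩ := (hH (ι x)).1 ⟨x, rfl⟩ 1
    rw [pow_one] at hY
    have h1 : f * π (ι x) = g * Y * T := by rw [hg, mul_assoc, hY, mul_assoc]
    rw [h1, mul_assoc (g * Y), hTf]
  have hlift : ∀ y : G, (∀ j : ℕ, ∃ Y, T ^ j * y = Y * T ^ j) → ∃ x : H, π (ι x) = y := by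
    intro y hy
    obtain ⟨w, rfl⟩ := hπ y
    obtain ⟨x, rfl⟩ := (hH w).2 hy
    exact ⟨x, rfl⟩
  let c : Option κ → G := fun o => o.elim f fun i => (1 - f) * ε i
  have hcT : ∀ (o : Option κ) (j : ℕ), T ^ (j + 1) * c o = if o = none then T ^ (j + 1) else 0 := by
    rintro (_ | i) j
    · simpa [c] using hpowf j
    · simp only [c, Option.elim_some, reduceCtorEq, if_false]
      rw [← mul_assoc, mul_sub, mul_one, hpowf, sub_self, zero_mul]
  have hcomm : ∀ (o : Option κ) (x : H), (c o * π (ι x) - π (ι x) * c o) * f =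
      c o * π (ι x) - π (ι x) * c o := by
    have h1 : ∀ x : H, (f * π (ι x) - π (ι x) * f) * f = f * π (ι x) - π (ι x) * f := fun x => by
      rw [sub_mul, ← hfpow, mul_assoc, hf]
    rintro (_ | i) x
    · exact h1 x
    · have h2 : c (some i) * π (ι x) - π (ι x) * c (some i) =
          -(ε i * (f * π (ι x) - π (ι x) * f)) := by
        simp only [c, Option.elim_some]
        rw [mul_assoc, hεcomm, ← mul_assoc, ← mul_assoc, ← hεcomm, ← hεcomm]
        noncomm_ring
      rw [h2, neg_mul, mul_assoc, h1]
  have hf' : f * f = f := hf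
  have hff : (1 - f) * f = 0 := by rw [sub_mul, hf', one_mul, sub_self]
  have hcid : ∀ o, c o * c o = c o := by
    rintro (_ | i)
    · exact hf'
    · change (1 - f) * ε i * ((1 - f) * ε i) = (1 - f) * ε i
      rw [mul_assoc, ← mul_assoc (ε i), hεcomm, mul_assoc (1 - f), hε, ← mul_assoc, mul_sub (1 - f),
        hff, mul_one, sub_zero]
  have hcc : ∀ o o', o ≠ o' → c o * c o' = 0 := by
    rintro (_ | i) (_ | j) hij
    · exact absurd rfl hij
    · change f * ((1 - f) * ε j) = 0
      rw [← mul_assoc, mul_sub, hf', mul_one, sub_self, zero_mul]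
    · change (1 - f) * ε i * f = 0
      rw [mul_assoc, hεcomm, ← mul_assoc, hff, zero_mul]
    · change (1 - f) * ε i * ((1 - f) * ε j) = 0
      rw [mul_assoc, ← mul_assoc (ε i), hεcomm, mul_assoc (1 - f), hεorth i j (by rintro rfl; exact hij rfl),
        mul_zero, mul_zero]
  -- `T ^ (j + 1) c o` is either `T ^ (j + 1)` or `0`, so these idempotents preserve the filtration
  -- and lift to `H`.
  have hX : ∀ o, ∃ x : H, π (ι x) = c o := fun o => hlift _ fun j => by
    cases j with
    | zero => exact ⟨c o, by simp⟩
    | succ j =>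
      rw [hcT]
      split_ifs
      · exact ⟨1, (one_mul _).symm⟩
      · exact ⟨0, (zero_mul _).symm⟩
  choose X hX using hX
  have hzero : ∀ x : H, π (ι x) = 0 → x ∈ Ring.jacobson H := fun x hx =>
    (hJ' x).2 fun j => ⟨0, by rw [hx, mul_zero, zero_mul]⟩
  have hcen : ∀ o, Ideal.Quotient.mk (Ring.jacobson H) (X o) ∈
      Subring.center (H ⧸ Ring.jacobson H) := by
    intro o
    rw [Subring.mem_center_iff]
    intro y
    obtain ⟨x, rfl⟩ := Ideal.Quotient.mk_surjective y
    rw [← map_mul, ← map_mul, eq_comm, Ideal.Quotient.eq]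
    -- A commutator with `c o` lies in `G f = G T` and is annihilated on the left by `T ^ (j + 1)`,
    -- hence it shifts the filtration.
    refine (hJ' _).2 fun j => ?_
    rw [map_sub, map_sub, map_mul, map_mul, map_mul, map_mul, hX]
    cases j with
    | zero =>
      refine ⟨(c o * π (ι x) - π (ι x) * c o) * g, ?_⟩
      rw [pow_zero, one_mul, zero_add, pow_one, mul_assoc, ← hTdef, ← hg, hcomm]
    | succ j =>
      refine ⟨0, ?_⟩
      obtain ⟨Y, hY⟩ := (hH (ι x)).1 ⟨x, rfl⟩ (j + 1)
      rw [zero_mul, mul_sub, ← mul_assoc, ← mul_assoc, hY, mul_assoc Y, ← hTdef, hcT]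
      split_ifs
      · rw [← hY, sub_self]
      · rw [zero_mul, mul_zero, sub_self]
  -- If the lift of `f` were in the radical, then `T ∈ G T ^ 2`, and iteration kills the nilpotent
  -- `T`. If that of `(1 - f) ε i` were, then `ε i = g ε i T`, and iteration kills `ε i`.
  have hne : ∀ o, X o ∉ Ring.jacobson H := by
    rintro (_ | i) h
    · obtain ⟨Y, hY⟩ := (hJ' _).1 h 1
      rw [hX, pow_one, ← hTdef] at hY
      change T * f = _ at hY
      rw [hTf] at hY
      have key : ∀ k : ℕ, T = Y ^ k * T ^ (k + 1) := by
        intro k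
        induction k with
        | zero => simp
        | succ k ih =>
          rw [pow_succ, mul_assoc, add_assoc, add_comm k, pow_add T (1 + 1), ← mul_assoc Y, ← hY,
            ← pow_succ', ← ih]
      obtain ⟨k, hk⟩ := hT
      exact hT0 (by rw [key k, pow_succ, hk, zero_mul, mul_zero])
    · obtain ⟨Y, hY⟩ := (hJ' _).1 h 0
      rw [hX, pow_zero, one_mul, zero_add, pow_one, ← hTdef] at hY
      have h1 : c (some i) = 0 := by
        rw [← hcc (some i) none (by simp)]
        change _ = _ * f
        rw [hY, mul_assoc, hTf]
      have h2 : ε i = g * ε i * T := by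
        change (1 - f) * ε i = 0 at h1
        rw [sub_mul, one_mul, sub_eq_zero] at h1
        rw [mul_assoc, hεcomm, ← mul_assoc, ← hg, ← hεcomm, hεcomm]
        exact h1
      have key : ∀ k : ℕ, ε i = g ^ k * ε i * T ^ k := by
        intro k
        induction k with
        | zero => simp
        | succ k ih =>
          conv_lhs => rw [ih, h2]
          rw [pow_succ, pow_succ']
          simp only [mul_assoc]
      obtain ⟨k, hk⟩ := hT
      exact hε0 i (by rw [key k, hk, mul_zero])
  have := card_le_card_maximalSpectrum
    (fun o => (⟨_, hcen o⟩ : Subring.center (H ⧸ Ring.jacobson H)))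
    (fun o => Subtype.ext (by
      change Ideal.Quotient.mk _ (X o) * Ideal.Quotient.mk _ (X o) = Ideal.Quotient.mk _ (X o)
      rw [← map_mul, Ideal.Quotient.eq]
      exact hzero _ (by rw [map_sub, map_sub, map_mul, map_mul, hX, hcid, sub_self])))
    (fun o h => hne o (Ideal.Quotient.eq_zero_iff_mem.1 (congrArg Subtype.val h)))
    (fun o o' hoo => Subtype.ext (by
      change Ideal.Quotient.mk _ (X o) * Ideal.Quotient.mk _ (X o') = 0
      rw [← map_mul, Ideal.Quotient.eq_zero_iff_mem]
      exact hzero _ (by rw [map_mul, map_mul, hX, hX, hcc o o' hoo])))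
  rw [Finite.card_option] at this
  exact this

end Idempotents

end NormalOrders

namespace NormalOrders

/-! ### Orders over a discrete valuation ring -/

section DVR

variable {O : Type*} [CommRing O] [IsDomain O] [IsDiscreteValuationRing O] {ϖ : O}

theorem exists_one_add_mul_eq_one {A : Type*} [Ring A] {x : A} (hx : x ∈ Ring.jacobson A) :
    ∃ w, (1 + x) * w = 1 := by
  have key : ∀ x ∈ Ring.jacobson A, ∃ w, w * (1 + x) = 1 := by
    intro x hx
    rw [← Ideal.jacobson_bot, Ideal.mem_jacobson_iff] at hx
    obtain ⟨w, hw⟩ := hx 1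
    rw [Ideal.mem_bot, sub_eq_zero, mul_one] at hw
    exact ⟨w, by rw [mul_add, mul_one, add_comm, hw]⟩
  obtain ⟨w, hw⟩ := key x hx
  obtain ⟨w', hw'⟩ := key (-(w * x)) (neg_mem ((Ring.jacobson A).mul_mem_left w hx))
  have h1 : 1 + -(w * x) = w := by
    rw [← hw]; noncomm_ring
  rw [h1] at hw'
  have h2 : w' = 1 + x := by
    have := congrArg (w' * ·) hw
    simpa [← mul_assoc, hw'] using this.symm
  exact ⟨w, by rw [← h2, hw']⟩

theorem smul_mem_jacobson (hϖ : Irreducible ϖ) {A : Type*} [Ring A] [Algebra O A]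
    [Module.Finite O A] (x : A) : ϖ • x ∈ Ring.jacobson A := by
  rw [← Ideal.jacobson_bot, Ideal.mem_jacobson_iff]
  intro y
  have h : (⊤ : Submodule O A) ≤ LinearMap.range (LinearMap.mulRight O (1 + y * ϖ • x)) := by
    refine Submodule.le_of_le_smul_of_le_jacobson_bot (I := IsLocalRing.maximalIdeal O)
      Module.Finite.fg_top (IsLocalRing.maximalIdeal_le_jacobson _) fun a _ => ?_
    have h1 : a = a * (1 + y * ϖ • x) + ϖ • -(a * y * x) := by
      rw [mul_add, mul_smul_comm, mul_smul_comm, smul_neg, mul_assoc, mul_one, add_neg_cancel_right]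
    rw [h1]
    refine Submodule.add_mem_sup ⟨a, rfl⟩ (Submodule.smul_mem_smul ?_ trivial)
    rw [hϖ.maximalIdeal_eq]
    exact Ideal.mem_span_singleton_self ϖ
  obtain ⟨z, hz⟩ := h (x := 1) trivial
  refine ⟨z, ?_⟩
  rw [Ideal.mem_bot, sub_eq_zero, ← hz]
  change _ = z * (1 + y * ϖ • x)
  rw [mul_add, mul_one, mul_assoc, add_comm]

open Polynomial in
-- The induction strips factors `X` from an integral equation of `x`, working modulo `ϖ`. When the
-- constant term becomes a unit, the polynomial takes an invertible value at `x`, because `x` is in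
-- the radical; what remains is a power of `x` in `ϖ A`.
theorem exists_pow_eq_smul_of_mem_jacobson (hϖ : Irreducible ϖ) {A : Type*} [Ring A] [Algebra O A]
    [Module.Finite O A] {x : A} (hx : x ∈ Ring.jacobson A) : ∃ (m : ℕ) (y : A), x ^ m = ϖ • y := by
  have key : ∀ (n : ℕ) (p : O[X]) (j : ℕ), p.natDegree = n → (∃ i, IsUnit (p.coeff i)) →
      (∃ y, x ^ j * aeval x p = ϖ • y) → ∃ (m : ℕ) (y : A), x ^ m = ϖ • y := by
    intro n
    induction n using Nat.strong_induction_on with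
    | _ n ih =>
      rintro p j rfl ⟨i, hi⟩ ⟨y, hy⟩
      have hX := p.divX_mul_X_add
      have hp : aeval x p = x * aeval x p.divX + algebraMap O A (p.coeff 0) := by
        conv_lhs => rw [← hX]
        rw [mul_comm, map_add, map_mul, aeval_X, aeval_C]
      by_cases h0 : IsUnit (p.coeff 0)
      · have hu : ∃ w, aeval x p * w = 1 := by
          obtain ⟨c, hc⟩ := h0
          obtain ⟨w, hw⟩ := exists_one_add_mul_eq_one ((Ring.jacobson A).mul_mem_right
            (aeval x p.divX * algebraMap O A (↑c⁻¹ : O)) hx)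
          refine ⟨algebraMap O A (↑c⁻¹ : O) * w, ?_⟩
          rw [← mul_assoc, hp, add_mul, ← hc, ← map_mul, Units.mul_inv, map_one, mul_assoc, add_comm]
          exact hw
        obtain ⟨w, hw⟩ := hu
        exact ⟨j, y * w, by rw [← smul_mul_assoc, ← hy, mul_assoc, hw, mul_one]⟩
      · have hd : p.natDegree ≠ 0 := by
          intro hd
          have : i = 0 := by
            by_contra hi0
            rw [coeff_eq_zero_of_natDegree_lt (by omega)] at hi
            exact not_isUnit_zero hi
          exact h0 (this ▸ hi)
        have hdeg : p.divX.natDegree = p.natDegree - 1 :=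
          Polynomial.natDegree_divX_eq_natDegree_tsub_one
        obtain ⟨c, hc⟩ : ϖ ∣ p.coeff 0 := by
          rw [← Ideal.mem_span_singleton, ← hϖ.maximalIdeal_eq]
          exact h0
        refine ih (p.natDegree - 1) (by omega) p.divX (j + 1) hdeg ⟨i - 1, ?_⟩
          ⟨y - x ^ j * algebraMap O A c, ?_⟩
        · rw [coeff_divX, Nat.sub_add_cancel]
          · exact hi
          · rw [Nat.one_le_iff_ne_zero]
            rintro rfl
            exact h0 hi
        · rw [smul_sub, ← hy, hp, hc, map_mul, pow_succ, mul_add, mul_assoc,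
            Algebra.algebraMap_eq_smul_one ϖ, smul_one_mul, mul_smul_comm, add_sub_cancel_right]
  obtain ⟨p, hp, hpx⟩ := Algebra.IsIntegral.isIntegral (R := O) x
  exact key _ p 0 rfl ⟨p.natDegree, by rw [hp.coeff_natDegree]; exact isUnit_one⟩
    ⟨0, by rw [smul_zero, aeval_def, hpx, mul_zero]⟩

theorem isArtinian_of_smul_eq_zero (hϖ : Irreducible ϖ) (M : Type*) [AddCommGroup M] [Module O M]
    [Module.Finite O M] (h : ∀ x : M, ϖ • x = 0) : IsArtinian O M := by
  obtain ⟨n, f, hf⟩ := Module.Finite.exists_fin' O M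
  have hmax : (Ideal.span {ϖ}).IsMaximal := hϖ.maximalIdeal_eq ▸ IsLocalRing.maximalIdeal.isMaximal O
  have : IsSimpleModule O (O ⧸ Ideal.span {ϖ}) :=
    isSimpleModule_iff_isCoatom.2 (Ideal.isMaximal_def.1 hmax)
  let g : (Fin n → O ⧸ Ideal.span {ϖ}) →ₗ[O] M := ∑ i, (Submodule.liftQ (Ideal.span {ϖ})
    (LinearMap.toSpanSingleton O M (f (Pi.single i 1))) (by
      rw [Ideal.span, Submodule.span_singleton_le_iff_mem, LinearMap.mem_ker]
      exact h _)) ∘ₗ LinearMap.proj i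
  refine isArtinian_of_surjective _ g fun x => ?_
  obtain ⟨y, rfl⟩ := hf x
  refine ⟨fun i => Submodule.Quotient.mk (y i), ?_⟩
  simp only [g, LinearMap.sum_apply, LinearMap.comp_apply, LinearMap.proj_apply,
    Submodule.liftQ_apply, LinearMap.toSpanSingleton_apply]
  conv_rhs => rw [pi_eq_sum_univ' y, map_sum]
  exact Finset.sum_congr rfl fun i _ => by rw [← map_smul]

variable (A : Type*) [Ring A] [Algebra O A] [Module.Finite O A]

theorem isSemisimpleRing_quotient_jacobson (hϖ : Irreducible ϖ) :
    IsSemisimpleRing (A ⧸ Ring.jacobson A) := by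
  have : IsArtinian O (A ⧸ Ring.jacobson A) := isArtinian_of_smul_eq_zero hϖ _ fun x => by
    obtain ⟨x, rfl⟩ := Ideal.Quotient.mk_surjective x
    exact Ideal.Quotient.eq_zero_iff_mem.2 (smul_mem_jacobson hϖ x)
  have : IsArtinianRing (A ⧸ Ring.jacobson A) := isArtinian_of_tower O this
  exact IsArtinianRing.isSemisimpleRing_iff_jacobson.2 (Ring.jacobson_quotient_jacobson A)

theorem isArtinianRing_center_quotient_jacobson (hϖ : Irreducible ϖ) :
    IsArtinianRing (Subring.center (A ⧸ Ring.jacobson A)) := by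
  have : IsArtinian O (A ⧸ Ring.jacobson A) := isArtinian_of_smul_eq_zero hϖ _ fun x => by
    obtain ⟨x, rfl⟩ := Ideal.Quotient.mk_surjective x
    exact Ideal.Quotient.eq_zero_iff_mem.2 (smul_mem_jacobson hϖ x)
  have h1 : IsArtinian O (Subalgebra.center O (A ⧸ Ring.jacobson A)) :=
    isArtinian_submodule' (Subalgebra.toSubmodule (Subalgebra.center O (A ⧸ Ring.jacobson A)))
  have h2 : IsArtinianRing (Subalgebra.center O (A ⧸ Ring.jacobson A)) := isArtinian_of_tower O h1
  exact h2

/-- A central nilpotent generates a nil ideal, which lies in the radical. -/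
theorem isReduced_center_of_isSemisimpleRing (A : Type*) [Ring A] [IsSemisimpleRing A] :
    IsReduced (Subring.center A) := by
  refine ⟨fun x hx => ?_⟩
  obtain ⟨k, hk⟩ := hx
  have h1 : (x : A) ∈ Ring.jacobson A := by
    refine mem_jacobson_of_forall_pow fun a => ⟨k, ?_⟩
    have h2 : Commute a x := Subring.mem_center_iff.1 x.2 a
    rw [h2.mul_pow, ← SubmonoidClass.coe_pow, hk]
    simp
  rw [IsSemisimpleRing.jacobson_eq_bot] at h1
  exact Subtype.ext h1

variable {A} {Γ G : Type*} [Ring Γ] [Algebra O Γ] [Module.Finite O Γ] [Ring G]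
  {ι : A →ₐ[O] Γ} {π : Γ →+* G}

/-- Elements which are nilpotent modulo the radical of a commensurable overring are nilpotent modulo
the radical. -/
theorem exists_pow_mem_jacobson_of_isNilpotent (hϖ : Irreducible ϖ) (hι : Function.Injective ι)
    {k : ℕ} (hk : ∀ X, ∃ a, ι a = ϖ ^ k • X) (hπ : ∀ x, π x = 0 ↔ x ∈ Ring.jacobson Γ) (x : A)
    (hx : IsNilpotent (π (ι x))) : ∃ n : ℕ, x ^ n ∈ Ring.jacobson A := by
  obtain ⟨n, hn⟩ := hx
  rw [← map_pow, hπ] at hn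
  obtain ⟨m, y, hy⟩ := exists_pow_eq_smul_of_mem_jacobson hϖ hn
  -- One exponent more than the conductor: `k` factors `ϖ` bring `y ^ (k + 1)` into `A`, and the
  -- last one puts the result in the radical.
  obtain ⟨a, ha⟩ := hk (y ^ (k + 1))
  refine ⟨n * m * (k + 1), ?_⟩
  rw [show x ^ (n * m * (k + 1)) = ϖ • a from hι ?_]
  · exact smul_mem_jacobson hϖ a
  · rw [map_smul, ha, smul_smul, ← pow_succ', ← smul_pow, ← hy, map_pow, pow_mul, pow_mul]

/-- A power of `t` is divisible by `ϖ`, so a higher one is divisible by the conductor `ϖ ^ k`. -/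
theorem exists_smul_pow_eq (hϖ : Irreducible ϖ) {k : ℕ} (hk : ∀ X, ∃ a, ι a = ϖ ^ k • X) {t : A}
    (ht : t ∈ Ring.jacobson A) (x : Γ) : ∃ k : ℕ, x * ι t ^ k ∈ (ι : A →+* Γ).range := by
  obtain ⟨m, y, hy⟩ := exists_pow_eq_smul_of_mem_jacobson hϖ ht
  obtain ⟨a, ha⟩ := hk (x * ι y ^ k)
  exact ⟨m * k, a, by rw [pow_mul, ← map_pow, hy, map_smul, smul_pow, mul_smul_comm]; exact ha⟩

theorem isNilpotent_of_mem_jacobson (hϖ : Irreducible ϖ)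
    (hπ : ∀ x, π x = 0 ↔ x ∈ Ring.jacobson Γ) {t : A}
    (ht : t ∈ Ring.jacobson A) : IsNilpotent (π (ι t)) := by
  obtain ⟨m, y, hy⟩ := exists_pow_eq_smul_of_mem_jacobson hϖ ht
  exact ⟨m, by rw [← map_pow, ← map_pow, hy, map_smul, hπ]; exact smul_mem_jacobson hϖ _⟩

/-- `ϖ` lies in the radical, so `ϖ = a t`. Hence `t y = 0` implies `y = 0`; being integral, `t` then
divides a nonzero constant, and regularity on the other side follows. -/
theorem eq_zero_of_mul_eq_zero (hϖ : Irreducible ϖ) [Nontrivial Γ] [Module.IsTorsionFree O Γ] {t : A}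
    (hJ : ∀ x : A, x ∈ Ring.jacobson A ↔ ∃ a, x = a * t) (x : Γ) (hx : x * ι t = 0) : x = 0 := by
  obtain ⟨a, ha⟩ := (hJ _).1 (smul_mem_jacobson hϖ 1)
  have h1 : ι a * ι t = ϖ • 1 := by rw [← map_mul, ← ha, map_smul, map_one]
  obtain ⟨u, r, hr, h2, -⟩ := exists_mul_eq_algebraMap (R := O) (b := ι t) (fun y hy => by
    have h3 : ϖ • y = 0 := by rw [← smul_one_mul, ← h1, mul_assoc, hy, mul_zero]
    exact (smul_eq_zero.1 h3).resolve_left hϖ.ne_zero) (Algebra.IsIntegral.isIntegral _)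
  have h4 : r • x = 0 := by
    rw [Algebra.smul_def, Algebra.commutes, ← h2, ← mul_assoc, hx, zero_mul]
  refine (smul_eq_zero.1 h4).resolve_left fun h0 => hr ?_
  rw [h0, map_zero]

theorem exists_pow_smul_eq (hϖ : Irreducible ϖ) {r : O} (hr : r ≠ 0)
    (h : ∀ X, ∃ a, ι a = r • X) : ∃ k : ℕ, ∀ X, ∃ a, ι a = ϖ ^ k • X := by
  obtain ⟨k, u, hu⟩ := IsDiscreteValuationRing.associated_pow_irreducible hr hϖ
  refine ⟨k, fun X => ?_⟩
  obtain ⟨a, ha⟩ := h ((u : O) • X)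
  exact ⟨a, by rw [ha, smul_smul, hu]⟩

end DVR

section Matrix

variable {S : Type*} [Ring S] {κ : Type*} [Fintype κ] [DecidableEq κ]

/-- Reduction of a matrix modulo the radical. -/
def residueMatrix (S : Type*) [Ring S] (κ : Type*) [Fintype κ] [DecidableEq κ] :
    Matrix κ κ S →+* Matrix κ κ (S ⧸ Ring.jacobson S) :=
  (Ideal.Quotient.mk (Ring.jacobson S)).mapMatrix

theorem residueMatrix_surjective : Function.Surjective (residueMatrix S κ) := by
  intro Y
  choose X hX using fun i j => Ideal.Quotient.mk_surjective (Y i j)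
  exact ⟨Matrix.of X, Matrix.ext hX⟩

theorem residueMatrix_eq_zero_iff [IsSemisimpleRing (S ⧸ Ring.jacobson S)] (X : Matrix κ κ S) :
    residueMatrix S κ X = 0 ↔ X ∈ Ring.jacobson (Matrix κ κ S) := by
  constructor
  · intro h
    rw [← Ideal.jacobson_bot, ← Ideal.matrix_bot]
    refine Ideal.matrix_jacobson_le ⊥ ?_
    intro i j
    rw [Ideal.jacobson_bot]
    exact Ideal.Quotient.eq_zero_iff_mem.1 (congrFun (congrFun h i) j)
  · intro h
    have : RingHomSurjective (residueMatrix S κ) := ⟨residueMatrix_surjective⟩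
    have h1 : residueMatrix S κ X ∈ Ring.jacobson (Matrix κ κ (S ⧸ Ring.jacobson S)) :=
      Ring.le_comap_jacobson (residueMatrix S κ) h
    rwa [IsSemisimpleRing.jacobson_eq_bot (R := Matrix κ κ (S ⧸ Ring.jacobson S))] at h1

end Matrix

end NormalOrders

namespace NormalOrders

open IsLocalRing

/-! ### Localisation at height one primes -/

section Localised

variable {R : Type u} [CommRing R] [IsDomain R] (p : PrimeSpectrum R)

/-- The localisation is a local Dedekind domain that is not a field. -/
theorem isDiscreteValuationRing_of_height_eq_one [IsNoetherianRing R] [IsIntegrallyClosed R]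
    (hp : p.asIdeal.height = 1) :
    IsDiscreteValuationRing (Localization.AtPrime p.asIdeal) := by
  have h0 : p.asIdeal ≠ ⊥ := by
    intro h
    rw [h, Ideal.height_bot] at hp
    exact zero_ne_one hp
  have hdom : IsDomain (Localization.AtPrime p.asIdeal) :=
    IsLocalization.isDomain_localization p.asIdeal.primeCompl_le_nonZeroDivisors
  have hic : IsIntegrallyClosed (Localization.AtPrime p.asIdeal) :=
    isIntegrallyClosed_of_isLocalization _ p.asIdeal.primeCompl p.asIdeal.primeCompl_le_nonZeroDivisors
  have hinj : Function.Injective (algebraMap R (Localization.AtPrime p.asIdeal)) :=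
    IsLocalization.injective _ p.asIdeal.primeCompl_le_nonZeroDivisors
  have hnf : ¬ IsField (Localization.AtPrime p.asIdeal) := by
    intro hf
    obtain ⟨a, ha, ha0⟩ := Submodule.exists_mem_ne_zero_of_ne_bot h0
    have h1 : algebraMap R (Localization.AtPrime p.asIdeal) a ≠ 0 :=
      fun h => ha0 (hinj (by rw [h, map_zero]))
    obtain ⟨b, hb⟩ := hf.mul_inv_cancel h1
    exact ((IsLocalization.AtPrime.isUnit_to_map_iff (Localization.AtPrime p.asIdeal) p.asIdeal
      a).1 (IsUnit.of_mul_eq_one _ hb)) ha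
  have hd : Ring.DimensionLEOne (Localization.AtPrime p.asIdeal) := by
    refine ⟨fun {P} hP0 hP => ?_⟩
    have hle : P.comap (algebraMap R _) ≤ p.asIdeal := by
      intro a ha
      by_contra hap
      exact hP.ne_top (Ideal.eq_top_of_isUnit_mem _ ha
        ((IsLocalization.AtPrime.isUnit_to_map_iff (Localization.AtPrime p.asIdeal) p.asIdeal
          a).2 hap))
    have heq : P.comap (algebraMap R _) = p.asIdeal := by
      by_contra hne
      have h1 := Ideal.height_add_one_le_of_lt_of_isPrime (lt_of_le_of_ne hle hne)
      rw [hp] at h1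
      have h2 : (P.comap (algebraMap R _)).height = 0 := by
        by_contra h3
        have h4 := add_le_add_left (Order.one_le_iff_ne_zero.2 h3) 1
        exact absurd (h4.trans h1) (by norm_num)
      rw [Ideal.height_eq_zero_iff_eq_bot] at h2
      obtain ⟨x, hx, hx0⟩ := Submodule.exists_mem_ne_zero_of_ne_bot hP0
      obtain ⟨a, s, rfl⟩ := IsLocalization.exists_mk'_eq p.asIdeal.primeCompl x
      have h5 : a ∈ P.comap (algebraMap R _) := by
        rw [Ideal.mem_comap, ← IsLocalization.mk'_spec _ a s]
        exact P.mul_mem_right _ hx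
      rw [h2, Ideal.mem_bot] at h5
      exact hx0 (by rw [h5, IsLocalization.mk'_zero])
    have h6 : IsLocalRing.maximalIdeal (Localization.AtPrime p.asIdeal) ≤ P := by
      rw [← Localization.AtPrime.map_eq_maximalIdeal]
      exact Ideal.map_le_iff_le_comap.2 heq.ge
    rw [← (IsLocalRing.maximalIdeal.isMaximal _).eq_of_le hP.ne_top h6]
    exact IsLocalRing.maximalIdeal.isMaximal _
  have : IsDedekindDomain (Localization.AtPrime p.asIdeal) := {}
  exact ((IsDiscreteValuationRing.TFAE (Localization.AtPrime p.asIdeal) hnf).out 0 2).2 this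

variable {A : Type v} [Ring A] [Algebra R A]

theorem isUnit_algebraMap_of_notMem {s : R} (hs : s ∉ p.asIdeal) :
    IsUnit (algebraMap R (Localization.AtPrime p.asIdeal) s) :=
  IsLocalization.map_units (M := p.asIdeal.primeCompl) _ ⟨s, hs⟩

theorem exists_smul_eq_one_tmul (x : LocalisedAt R A p) :
    ∃ s ∉ p.asIdeal, ∃ a : A, s • x = (1 : Localization.AtPrime p.asIdeal) ⊗ₜ[R] a := by
  obtain ⟨⟨a, s⟩, h⟩ := IsLocalizedModule.surj p.asIdeal.primeCompl
    (TensorProduct.mk R (Localization.AtPrime p.asIdeal) A 1) x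
  exact ⟨s, s.2, a, h⟩

theorem localised_smul_injective {X : Type*} [AddCommGroup X] [Module R X]
    [Module (Localization.AtPrime p.asIdeal) X]
    [IsScalarTower R (Localization.AtPrime p.asIdeal) X] {s : R} (hs : s ∉ p.asIdeal) {x y : X}
    (h : s • x = s • y) : x = y := by
  rw [← algebraMap_smul (Localization.AtPrime p.asIdeal) s x,
    ← algebraMap_smul (Localization.AtPrime p.asIdeal) s y] at h
  exact (isUnit_algebraMap_of_notMem p hs).smul_left_cancel.1 h

theorem localised_exists_smul_eq {X : Type*} [AddCommGroup X] [Module R X]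
    [Module (Localization.AtPrime p.asIdeal) X]
    [IsScalarTower R (Localization.AtPrime p.asIdeal) X] {s : R} (hs : s ∉ p.asIdeal) (x : X) :
    ∃ o : Localization.AtPrime p.asIdeal, s • o • x = x := by
  obtain ⟨o, ho⟩ := (isUnit_algebraMap_of_notMem p hs).exists_right_inv
  exact ⟨o, by rw [← algebraMap_smul (Localization.AtPrime p.asIdeal) s, smul_smul, ho, one_smul]⟩

theorem localised_one_tmul_injective [Module.IsTorsionFree R A] {a : A}
    (h : (1 : Localization.AtPrime p.asIdeal) ⊗ₜ[R] a = 0) : a = 0 := by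
  have h' : (TensorProduct.mk R (Localization.AtPrime p.asIdeal) A 1) a =
      (TensorProduct.mk R (Localization.AtPrime p.asIdeal) A 1) 0 := by simpa using h
  obtain ⟨c, hc⟩ := (IsLocalizedModule.eq_iff_exists p.asIdeal.primeCompl _).1 h'
  rw [smul_zero] at hc
  exact (smul_eq_zero.1 hc).resolve_left fun h0 => c.2 (by rw [h0]; exact zero_mem _)

theorem smul_localised_eq_zero [Module.IsTorsionFree R A] {r : R} (hr : r ≠ 0)
    {x : LocalisedAt R A p} (h : r • x = 0) : x = 0 := by
  obtain ⟨s, hs, a, ha⟩ := exists_smul_eq_one_tmul p x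
  have h1 : (1 : Localization.AtPrime p.asIdeal) ⊗ₜ[R] (r • a) = 0 := by
    rw [TensorProduct.tmul_smul, ← ha, smul_comm, h, smul_zero]
  have h2 := (smul_eq_zero.1 (localised_one_tmul_injective p h1)).resolve_left hr
  refine localised_smul_injective p hs ?_
  rw [ha, h2, TensorProduct.tmul_zero, smul_zero]

theorem isTorsionFree_localised [Module.IsTorsionFree R A] [IsDomain (Localization.AtPrime p.asIdeal)] :
    Module.IsTorsionFree (Localization.AtPrime p.asIdeal) (LocalisedAt R A p) := by
  refine Module.IsTorsionFree.of_smul_eq_zero fun o x h => ?_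
  obtain ⟨a, s, rfl⟩ := IsLocalization.exists_mk'_eq p.asIdeal.primeCompl o
  by_cases ha : a = 0
  · exact Or.inl (by rw [ha, IsLocalization.mk'_zero])
  · refine Or.inr (smul_localised_eq_zero p ha ?_)
    rw [← algebraMap_smul (Localization.AtPrime p.asIdeal) a x, ← IsLocalization.mk'_spec _ a s,
      mul_comm, mul_smul, h, smul_zero]

variable {D : Type v} [Ring D] [Algebra R D] {κ : Type*} [Fintype κ] [DecidableEq κ]

/-- The localisation of a homomorphism to a matrix algebra. -/
noncomputable def localisedMatrixHom (φ : A →ₐ[R] Matrix κ κ D) :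
    LocalisedAt R A p →ₐ[Localization.AtPrime p.asIdeal] Matrix κ κ (LocalisedAt R D p) :=
  Algebra.TensorProduct.lift (Algebra.ofId _ _)
    ((Algebra.TensorProduct.includeRight : D →ₐ[R] LocalisedAt R D p).mapMatrix.comp φ)
    (fun x _ => Algebra.commutes x _)

variable {p} (φ : A →ₐ[R] Matrix κ κ D)

theorem localisedMatrixHom_one_tmul (a : A) (i j : κ) :
    localisedMatrixHom p φ (1 ⊗ₜ[R] a) i j = 1 ⊗ₜ[R] φ a i j := by
  have e : localisedMatrixHom p φ (1 ⊗ₜ[R] a) = Algebra.ofId (Localization.AtPrime p.asIdeal) _ 1 *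
      ((Algebra.TensorProduct.includeRight : D →ₐ[R] LocalisedAt R D p).mapMatrix (φ a)) :=
    Algebra.TensorProduct.lift_tmul _ _ _ _ _
  rw [e, map_one, one_mul]
  rfl

theorem localisedMatrixHom_injective [Module.IsTorsionFree R D] (hφ : Function.Injective φ) :
    Function.Injective (localisedMatrixHom p φ) := by
  rw [injective_iff_map_eq_zero]
  intro x hx
  obtain ⟨s, hs, a, ha⟩ := exists_smul_eq_one_tmul p x
  have h1 : localisedMatrixHom p φ (1 ⊗ₜ[R] a) = 0 := by
    rw [← ha, ← algebraMap_smul (Localization.AtPrime p.asIdeal) s x, map_smul, hx, smul_zero]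
  have h2 : a = 0 := hφ (by
    rw [map_zero]
    ext i j
    refine localised_one_tmul_injective p ?_
    rw [← localisedMatrixHom_one_tmul, h1]; rfl)
  refine localised_smul_injective p hs ?_
  rw [ha, h2, TensorProduct.tmul_zero, smul_zero]

theorem exists_smul_eq_map_one_tmul (X : Matrix κ κ (LocalisedAt R D p)) :
    ∃ s ∉ p.asIdeal, ∃ Y : Matrix κ κ D, s • X =
      (Algebra.TensorProduct.includeRight : D →ₐ[R] LocalisedAt R D p).mapMatrix Y := by
  choose s hs a ha using fun ij : κ × κ => exists_smul_eq_one_tmul p (X ij.1 ij.2)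
  refine ⟨∏ ij, s ij, fun h => ?_,
    Matrix.of fun i j => (∏ k ∈ Finset.univ.erase (i, j), s k) • a (i, j), ?_⟩
  · obtain ⟨ij, -, h⟩ := (p.isPrime.prod_mem_iff).1 h
    exact hs ij h
  · ext i j
    change (∏ ij, s ij) • X i j = 1 ⊗ₜ[R] ((∏ k ∈ Finset.univ.erase (i, j), s k) • a (i, j))
    rw [TensorProduct.tmul_smul, ← ha, smul_smul, Finset.prod_erase_mul _ _ (Finset.mem_univ _)]

theorem localisedMatrixHom_one_tmul_eq (a : A) : localisedMatrixHom p φ (1 ⊗ₜ[R] a) =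
    (Algebra.TensorProduct.includeRight : D →ₐ[R] LocalisedAt R D p).mapMatrix (φ a) :=
  Matrix.ext fun _ _ => localisedMatrixHom_one_tmul φ a _ _

theorem localisedMatrixHom_smul (r : R) (x : LocalisedAt R A p) :
    localisedMatrixHom p φ (r • x) = r • localisedMatrixHom p φ x := by
  rw [← algebraMap_smul (Localization.AtPrime p.asIdeal) r x, map_smul, algebraMap_smul]

theorem exists_localisedMatrixHom_eq_smul {r : R} (h : ∀ X, ∃ a, φ a = r • X)
    (X : Matrix κ κ (LocalisedAt R D p)) : ∃ a, localisedMatrixHom p φ a = r • X := by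
  obtain ⟨s, hs, Y, hY⟩ := exists_smul_eq_map_one_tmul X
  obtain ⟨a, ha⟩ := h Y
  obtain ⟨x, hx⟩ := localised_exists_smul_eq p hs ((1 : Localization.AtPrime p.asIdeal) ⊗ₜ[R] a)
  refine ⟨x • 1 ⊗ₜ[R] a, localised_smul_injective p hs ?_⟩
  rw [← localisedMatrixHom_smul, hx, localisedMatrixHom_one_tmul_eq, ha, map_smul, ← hY, smul_comm]

/-- An element of the matrix algebra lies in the localisation of an order if and only if a multiple
lies in the order. -/
theorem mem_range_localisedMatrixHom_iff [Module.IsTorsionFree R D] (X : Matrix κ κ D) :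
    (Algebra.TensorProduct.includeRight : D →ₐ[R] LocalisedAt R D p).mapMatrix X ∈
      (localisedMatrixHom p φ).range ↔ ∃ s ∉ p.asIdeal, s • X ∈ φ.range := by
  constructor
  · rintro ⟨x, hx⟩
    obtain ⟨s, hs, a, ha⟩ := exists_smul_eq_one_tmul p x
    refine ⟨s, hs, a, ?_⟩
    have hx' : localisedMatrixHom p φ x =
      (Algebra.TensorProduct.includeRight : D →ₐ[R] LocalisedAt R D p).mapMatrix X := hx
    have h1 : localisedMatrixHom p φ (1 ⊗ₜ[R] a) =
        (Algebra.TensorProduct.includeRight : D →ₐ[R] LocalisedAt R D p).mapMatrix (s • X) := by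
      rw [← ha, localisedMatrixHom_smul, hx', map_smul]
    change φ a = s • X
    ext i j
    rw [← sub_eq_zero]
    refine localised_one_tmul_injective p ?_
    rw [TensorProduct.tmul_sub, ← localisedMatrixHom_one_tmul, h1, sub_eq_zero]
    rfl
  · rintro ⟨s, hs, a, ha⟩
    have ha' : φ a = s • X := ha
    obtain ⟨x, hx⟩ := localised_exists_smul_eq p hs ((1 : Localization.AtPrime p.asIdeal) ⊗ₜ[R] a)
    refine ⟨x • 1 ⊗ₜ[R] a, localised_smul_injective p hs ?_⟩
    change s • localisedMatrixHom p φ _ = _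
    rw [← localisedMatrixHom_smul, hx, localisedMatrixHom_one_tmul_eq, ha', map_smul]

end Localised

end NormalOrders

namespace NormalOrders

/-! ### Maximal ideals of centres -/

section Counting

theorem card_maximalSpectrum_congr {Z Z' : Type*} [CommRing Z] [CommRing Z'] (e : Z ≃+* Z') :
    Nat.card (MaximalSpectrum Z) = Nat.card (MaximalSpectrum Z') :=
  Nat.card_congr
    { toFun := fun m => ⟨m.asIdeal.comap e.symm, Ideal.comap_isMaximal_of_equiv e.symm⟩
      invFun := fun m => ⟨m.asIdeal.comap e, Ideal.comap_isMaximal_of_equiv e⟩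
      left_inv := fun m => MaximalSpectrum.ext (Ideal.ext fun x => by
        change e.symm (e x) ∈ m.asIdeal ↔ _
        rw [e.symm_apply_apply])
      right_inv := fun m => MaximalSpectrum.ext (Ideal.ext fun x => by
        change e (e.symm x) ∈ m.asIdeal ↔ _
        rw [e.apply_symm_apply]) }

theorem card_maximalSpectrum_center_of_surjective {H G : Type*} [Ring H] [Ring G] (ψ : H →+* G)
    (hψ : Function.Surjective ψ) (hker : ∀ x, ψ x = 0 ↔ x ∈ Ring.jacobson H) :
    Nat.card (MaximalSpectrum (Subring.center (H ⧸ Ring.jacobson H))) =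
      Nat.card (MaximalSpectrum (Subring.center G)) := by
  let f : H ⧸ Ring.jacobson H →+* G := Ideal.Quotient.lift _ ψ fun x hx => (hker x).2 hx
  have hf : Function.Bijective f := by
    constructor
    · rw [injective_iff_map_eq_zero]
      intro x hx
      obtain ⟨x, rfl⟩ := Ideal.Quotient.mk_surjective x
      rw [Ideal.Quotient.lift_mk] at hx
      exact Ideal.Quotient.eq_zero_iff_mem.2 ((hker x).1 hx)
    · intro y
      obtain ⟨x, rfl⟩ := hψ y
      exact ⟨Ideal.Quotient.mk _ x, Ideal.Quotient.lift_mk _ _ _⟩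
  exact card_maximalSpectrum_congr (Subring.centerCongr (RingEquiv.ofBijective f hf))

/-- The center of a matrix ring. -/
theorem nonempty_center_matrix_equiv (F κ : Type*) [Ring F] [Fintype κ] [DecidableEq κ] [Nonempty κ] :
    Nonempty (Subring.center F ≃+* Subring.center (Matrix κ κ F)) := by
  let f : Subring.center F →+* Subring.center (Matrix κ κ F) :=
    ((Matrix.scalar κ).comp (Subring.center F).subtype).codRestrict _ fun x => by
      rw [Matrix.subringCenter_eq_scalar_map]
      exact ⟨x, x.2, rfl⟩
  refine ⟨RingEquiv.ofBijective f ⟨fun x y h => ?_, fun y => ?_⟩⟩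
  · exact Subtype.ext (Matrix.scalar_inj.1 (congrArg Subtype.val h))
  · obtain ⟨x, hx, hxy⟩ := (Matrix.subringCenter_eq_scalar_map (n := κ) (R := F)).le y.2
    exact ⟨⟨x, hx⟩, Subtype.ext hxy⟩

/-- The center of a product. -/
def centerPiEquiv {κ : Type*} (B : κ → Type*) [∀ i, Ring (B i)] :
    Subring.center (∀ i, B i) ≃+* ∀ i, Subring.center (B i) where
  toFun x i := ⟨x.1 i, by
    classical
    rw [Subring.mem_center_iff]
    intro b
    have := congrFun (Subring.mem_center_iff.1 x.2 (Pi.single i b)) i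
    simpa using this⟩
  invFun y := ⟨fun i => y i, by
    rw [Subring.mem_center_iff]
    intro b
    ext i
    exact Subring.mem_center_iff.1 (y i).2 (b i)⟩
  left_inv _ := rfl
  right_inv _ := rfl
  map_mul' _ _ := rfl
  map_add' _ _ := rfl

theorem card_maximalSpectrum_pi_field (κ k : Type*) [Finite κ] [Field k] :
    Nat.card (MaximalSpectrum (κ → k)) = Nat.card κ := by
  have e := IsArtinianRing.primeSpectrumEquivMaximalSpectrum (R := κ → k)
  rw [← Nat.card_congr e, ← Nat.card_congr (Equiv.ofBijective _
    (PrimeSpectrum.sigmaToPi_bijective fun _ : κ => k)), Nat.card_congr (Equiv.sigmaUnique κ _)]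

theorem card_maximalSpectrum_center_pi_matrix {κ : Type*} [Finite κ] (F : Type*) [DivisionRing F]
    (ι : κ → Type*) [∀ i, Fintype (ι i)] [∀ i, DecidableEq (ι i)] [∀ i, Nonempty (ι i)] :
    Nat.card (MaximalSpectrum (Subring.center (∀ i, Matrix (ι i) (ι i) F))) = Nat.card κ := by
  rw [card_maximalSpectrum_congr ((centerPiEquiv _).trans (RingEquiv.piCongrRight fun i =>
    (nonempty_center_matrix_equiv F (ι i)).some.symm))]
  exact card_maximalSpectrum_pi_field κ _

end Counting

end NormalOrders

namespace NormalOrders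

theorem exists_uniform_denominator {R : Type*} [CommRing R] [IsDomain R] {A M : Type*}
    [AddCommGroup A] [Module R A] [AddCommGroup M] [Module R M] [Module.Finite R M] (φ : A →ₗ[R] M)
    (h : ∀ X, ∃ r : R, r ≠ 0 ∧ ∃ a, φ a = r • X) : ∃ r : R, r ≠ 0 ∧ ∀ X, ∃ a, φ a = r • X := by
  obtain ⟨n, g, hg⟩ := Submodule.fg_iff_exists_fin_generating_family.1 (Module.Finite.fg_top (R := R) (M := M))
  choose r hr a ha using fun i => h (g i)
  refine ⟨∏ i, r i, Finset.prod_ne_zero_iff.2 fun i _ => hr i, fun X => ?_⟩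
  have hX : X ∈ (LinearMap.range φ).comap (LinearMap.lsmul R M (∏ i, r i)) := by
    have h1 : Submodule.span R (Set.range g) ≤
        (LinearMap.range φ).comap (LinearMap.lsmul R M (∏ i, r i)) := by
      rw [Submodule.span_le]
      rintro _ ⟨i, rfl⟩
      refine ⟨(∏ j ∈ Finset.univ.erase i, r j) • a i, ?_⟩
      rw [map_smul, ha, smul_smul, Finset.prod_erase_mul _ _ (Finset.mem_univ i)]
      rfl
    rw [hg] at h1
    exact h1 trivial
  exact hX

theorem mem_jacobson_iff_of_bijective {H Γ : Type*} [Ring H] [Ring Γ] (f : H →+* Γ)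
    (hf : Function.Bijective f) (x : H) : f x ∈ Ring.jacobson Γ ↔ x ∈ Ring.jacobson H := by
  let e := RingEquiv.ofBijective f hf
  constructor
  · intro h
    have : RingHomSurjective (e.symm : Γ →+* H) := ⟨e.symm.surjective⟩
    have h1 : e.symm (f x) ∈ Ring.jacobson H := Ring.le_comap_jacobson (e.symm : Γ →+* H) h
    rwa [show f x = e x from rfl, e.symm_apply_apply] at h1
  · intro h
    have : RingHomSurjective f := ⟨hf.2⟩
    exact Ring.le_comap_jacobson f h

/-! ### Orders of full rank in a matrix algebra over a discrete valuation ring -/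

section DVR

theorem residueMatrix_eq_zero_iff_mem_jacobson (O : Type*) [CommRing O] [IsDomain O]
    [IsDiscreteValuationRing O] {S : Type*} [Ring S] [Algebra O S] [Module.Finite O S] {κ : Type*}
    [Fintype κ] [DecidableEq κ] (X : Matrix κ κ S) :
    residueMatrix S κ X = 0 ↔ X ∈ Ring.jacobson (Matrix κ κ S) := by
  obtain ⟨ϖ, hϖ⟩ := IsDiscreteValuationRing.exists_irreducible O
  have := isSemisimpleRing_quotient_jacobson S hϖ
  exact residueMatrix_eq_zero_iff X

theorem finite_maximalSpectrum_center (O : Type*) [CommRing O] [IsDomain O]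
    [IsDiscreteValuationRing O] (A : Type*) [Ring A] [Algebra O A] [Module.Finite O A] :
    Finite (MaximalSpectrum (Subring.center (A ⧸ Ring.jacobson A))) := by
  obtain ⟨ϖ, hϖ⟩ := IsDiscreteValuationRing.exists_irreducible O
  have := isArtinianRing_center_quotient_jacobson A hϖ
  infer_instance

variable {O : Type*} [CommRing O] [IsDomain O] [IsDiscreteValuationRing O]
  {A : Type*} [Ring A] [Algebra O A] [Module.Finite O A]
  {S : Type*} [Ring S] [Algebra O S] [Module.Finite O S]
  {κ : Type*} [Fintype κ] [DecidableEq κ] {ι : A →ₐ[O] Matrix κ κ S}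

theorem exists_pow_mem_jacobson_of_isNilpotent_residueMatrix (hι : Function.Injective ι)
    {r : O} (hr : r ≠ 0) (h : ∀ X, ∃ a, ι a = r • X) (x : A)
    (hx : IsNilpotent (residueMatrix S κ (ι x))) : ∃ k : ℕ, x ^ k ∈ Ring.jacobson A := by
  obtain ⟨ϖ, hϖ⟩ := IsDiscreteValuationRing.exists_irreducible O
  have : Module.Finite O (Matrix κ κ S) := inferInstanceAs (Module.Finite O (κ → κ → S))
  obtain ⟨k, hk⟩ := exists_pow_smul_eq hϖ hr h
  exact exists_pow_mem_jacobson_of_isNilpotent hϖ hι hk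
    (residueMatrix_eq_zero_iff_mem_jacobson O) x hx

/-- The generator of the radical of an order with principal radical, together with its formal
properties. -/
theorem exists_generator_jacobson [Nontrivial S] [Module.IsTorsionFree O S] [Nonempty κ]
    {r : O} (hr : r ≠ 0) (h : ∀ X, ∃ a, ι a = r • X) (hrad : HasPrincipalRadical A) :
    ∃ t : A, (∀ x, x ∈ Ring.jacobson A ↔ ∃ a, x = a * t) ∧
      IsNilpotent (residueMatrix S κ (ι t)) ∧
      (∀ x, ∃ k : ℕ, x * ι t ^ k ∈ (ι : A →+* Matrix κ κ S).range) ∧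
      ∀ x, x * ι t = 0 → x = 0 := by
  obtain ⟨ϖ, hϖ⟩ := IsDiscreteValuationRing.exists_irreducible O
  have : Module.Finite O (Matrix κ κ S) := inferInstanceAs (Module.Finite O (κ → κ → S))
  have : Module.IsTorsionFree O (Matrix κ κ S) :=
    inferInstanceAs (Module.IsTorsionFree O (κ → κ → S))
  obtain ⟨k, hk⟩ := exists_pow_smul_eq hϖ hr h
  obtain ⟨t, hJ⟩ := hrad.1
  have ht : t ∈ Ring.jacobson A := (hJ t).2 ⟨1, (one_mul t).symm⟩
  exact ⟨t, hJ, isNilpotent_of_mem_jacobson hϖ (residueMatrix_eq_zero_iff_mem_jacobson O) ht,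
    exists_smul_pow_eq hϖ hk ht, eq_zero_of_mul_eq_zero hϖ hJ⟩

theorem card_maximalSpectrum_center_of_bijective [Nonempty κ] (hι : Function.Bijective ι) :
    Nat.card (MaximalSpectrum (Subring.center (A ⧸ Ring.jacobson A))) =
      Nat.card (MaximalSpectrum (Subring.center (S ⧸ Ring.jacobson S))) := by
  rw [card_maximalSpectrum_center_of_surjective
    ((residueMatrix S κ).comp (ι : A →+* Matrix κ κ S))
    (residueMatrix_surjective.comp hι.2) fun x => ?_]
  · exact card_maximalSpectrum_congr (nonempty_center_matrix_equiv _ κ).some.symm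
  · exact (residueMatrix_eq_zero_iff_mem_jacobson O _).trans
      (mem_jacobson_iff_of_bijective (ι : A →+* Matrix κ κ S) hι x)

/-- An order with principal radical and with as few idempotents modulo the radical as a full matrix
algebra is a full matrix algebra. -/
theorem surjective_of_card_maximalSpectrum_center_eq [Nontrivial S] [Module.IsTorsionFree O S]
    [Nonempty κ] (hι : Function.Injective ι)
    {r : O} (hr : r ≠ 0) (h : ∀ X, ∃ a, ι a = r • X) (hrad : HasPrincipalRadical A)
    (hidx : Nat.card (MaximalSpectrum (Subring.center (A ⧸ Ring.jacobson A))) =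
      Nat.card (MaximalSpectrum (Subring.center (S ⧸ Ring.jacobson S)))) :
    Function.Surjective ι := by
  obtain ⟨ϖ, hϖ⟩ := IsDiscreteValuationRing.exists_irreducible O
  have hss := isSemisimpleRing_quotient_jacobson S hϖ
  have hart := isArtinianRing_center_quotient_jacobson S hϖ
  have hfin := finite_maximalSpectrum_center O A
  have hred := isReduced_center_of_isSemisimpleRing (S ⧸ Ring.jacobson S)
  obtain ⟨t, hJ, hT, hfull, hreg⟩ := exists_generator_jacobson hr h hrad
  have hnil := exists_pow_mem_jacobson_of_isNilpotent_residueMatrix hι hr h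
  obtain ⟨e, he, he0, heo⟩ := exists_orthogonal_idempotents
    (Subring.center (S ⧸ Ring.jacobson S))
  -- If the residue of `t` were nonzero, the scalar matrices of the central idempotents of `S ⧸ rad
  -- S` would lead to one idempotent more than the index allows. With zero residue every matrix
  -- satisfies the membership criterion.
  have hT0 : residueMatrix S κ (ι t) = 0 := by
    by_contra hT0
    refine absurd (card_lt_card_maximalSpectrum_center
      (ι := (ι : A →+* Matrix κ κ S)) residueMatrix_surjective hnil hT hJ hfull hreg
      (fun i => Matrix.scalar κ (e i : S ⧸ Ring.jacobson S))
      (fun i => ?_) (fun i h0 => ?_) (fun i j hij => ?_) (fun i x => ?_) hT0) hidx.not_gt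
    · rw [← map_mul, ← Subring.coe_mul, he]
    · refine he0 i (Subtype.ext ?_)
      rw [← map_zero (Matrix.scalar κ)] at h0
      exact Matrix.scalar_inj.1 h0
    · rw [← map_mul, ← Subring.coe_mul, heo i j hij]
      exact map_zero _
    · exact Matrix.scalar_commute _ (fun y => (Subring.mem_center_iff.1 (e i).2 y).symm) x
  intro x
  obtain ⟨y, hy⟩ := (mem_range_iff_forall_exists (ι := (ι : A →+* Matrix κ κ S))
    hnil hT hJ hfull hreg x).2 fun j => by
      cases j with
      | zero => exact ⟨residueMatrix S κ x, by simp⟩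
      | succ j =>
        refine ⟨0, ?_⟩
        change residueMatrix S κ (ι t) ^ (j + 1) * _ = _
        rw [hT0, pow_succ, mul_zero, zero_mul, zero_mul]
  exact ⟨y, hy⟩

end DVR

section Local

variable {R : Type u} [CommRing R] [IsDomain R] [IsNoetherianRing R] [IsIntegrallyClosed R]
  {A : Type v} [Ring A] [Algebra R A] [Module.Finite R A]
  {D : Type v} [Ring D] [Algebra R D] [Module.Finite R D] [Module.IsTorsionFree R D] [Nontrivial D]
  {κ : Type*} [Fintype κ] [DecidableEq κ] {p : CodimOnePrime R}

theorem nontrivial_localised : Nontrivial (LocalisedAt R D p.1) :=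
  ⟨1, 0, fun h => one_ne_zero (α := D) (localised_one_tmul_injective p.1 h)⟩

theorem exists_ne_zero_localisedMatrixHom_eq_smul {φ : A →ₐ[R] Matrix κ κ D} {r : R} (hr : r ≠ 0)
    (h : ∀ X, ∃ a, φ a = r • X) : ∃ r : Localization.AtPrime p.1.asIdeal, r ≠ 0 ∧
      ∀ X, ∃ a, localisedMatrixHom p.1 φ a = r • X := by
  refine ⟨algebraMap R _ r, fun h0 => hr (IsLocalization.injective
    (Localization.AtPrime p.1.asIdeal) p.1.asIdeal.primeCompl_le_nonZeroDivisors
    (by rw [h0, map_zero])), fun X => ?_⟩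
  obtain ⟨a, ha⟩ := exists_localisedMatrixHom_eq_smul (p := p.1) φ h X
  exact ⟨a, by rw [ha, algebraMap_smul]⟩

/-- An order with principal radical at `p` is maximal at `p` if an order which is a full matrix
algebra at `p` has the same index. -/
theorem localisedMatrixHom_surjective_of_localIndex_eq [Nonempty κ]
    {A' : Type v} [Ring A'] [Algebra R A'] [Module.Finite R A'] {κ' : Type*} [Fintype κ']
    [DecidableEq κ'] [Nonempty κ'] {φ' : A' →ₐ[R] Matrix κ' κ' D} (hφ' : Function.Injective φ')
    (hs : Function.Surjective (localisedMatrixHom p.1 φ'))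
    {φ : A →ₐ[R] Matrix κ κ D} (hφ : Function.Injective φ)
    {r : R} (hr : r ≠ 0) (h : ∀ X, ∃ a, φ a = r • X)
    (hrad : HasPrincipalRadical (LocalisedAt R A p.1)) (hidx : localIndex R A p = localIndex R A' p) :
    Function.Surjective (localisedMatrixHom p.1 φ) := by
  have hdom : IsDomain (Localization.AtPrime p.1.asIdeal) :=
    IsLocalization.isDomain_localization p.1.asIdeal.primeCompl_le_nonZeroDivisors
  have := isDiscreteValuationRing_of_height_eq_one p.1 p.2
  have := nontrivial_localised (D := D) (p := p)
  have := isTorsionFree_localised (A := D) p.1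
  obtain ⟨r', hr', h'⟩ := exists_ne_zero_localisedMatrixHom_eq_smul (p := p) hr h
  exact surjective_of_card_maximalSpectrum_center_eq (localisedMatrixHom_injective φ hφ) hr' h' hrad
    (hidx.trans (card_maximalSpectrum_center_of_bijective (O := Localization.AtPrime p.1.asIdeal)
      ⟨localisedMatrixHom_injective φ' hφ', hs⟩))

end Local

end NormalOrders

namespace NormalOrders

/-! ### Conjugation to an adapted basis -/

section ChangeOfBasis

variable (R : Type*) [CommRing R] {D : Type*} [Ring D] [Algebra R D] {κ ι : Type*} [Fintype κ]
  [DecidableEq κ] [Fintype ι] [DecidableEq ι]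

/-- Conjugation by a pair of mutually inverse matrices. -/
def conjMatrix (P : Matrix ι κ D) (Q : Matrix κ ι D) (hPQ : P * Q = 1) (hQP : Q * P = 1) :
    Matrix κ κ D ≃ₐ[R] Matrix ι ι D where
  toFun X := P * X * Q
  invFun Y := Q * Y * P
  left_inv X := by
    calc Q * (P * X * Q) * P = (Q * P) * X * (Q * P) := by simp only [Matrix.mul_assoc]
      _ = X := by rw [hQP, Matrix.one_mul, Matrix.mul_one]
  right_inv Y := by
    calc P * (Q * Y * P) * Q = (P * Q) * Y * (P * Q) := by simp only [Matrix.mul_assoc]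
      _ = Y := by rw [hPQ, Matrix.one_mul, Matrix.mul_one]
  map_mul' X Y := by
    calc P * (X * Y) * Q = P * (X * ((1 : Matrix κ κ D) * (Y * Q))) := by
          simp only [Matrix.mul_assoc, Matrix.one_mul]
      _ = P * X * Q * (P * Y * Q) := by rw [← hQP]; simp only [Matrix.mul_assoc]
  map_add' X Y := by rw [Matrix.mul_add, Matrix.add_mul]
  commutes' r := by
    rw [Algebra.algebraMap_eq_smul_one, Algebra.algebraMap_eq_smul_one, Matrix.mul_smul,
      Matrix.smul_mul, Matrix.mul_one, hPQ]

variable {R} in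
theorem exists_matrix_of_basis (b : Module.Basis ι D (κ → D)) :
    ∃ (P : Matrix ι κ D) (Q : Matrix κ ι D), P * Q = 1 ∧ Q * P = 1 ∧ (∀ k, P k = b k) ∧
      ∀ v k, Matrix.vecMul v Q k = b.repr v k := by
  let P : Matrix ι κ D := Matrix.of fun k => b k
  let Q : Matrix κ ι D := Matrix.of fun i k => b.repr (Pi.single i 1) k
  have hQ : ∀ v k, Matrix.vecMul v Q k = b.repr v k := by
    intro v k
    conv_rhs => rw [pi_eq_sum_univ' v, map_sum, Finsupp.finsetSum_apply]
    refine Finset.sum_congr rfl fun i _ => ?_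
    rw [map_smul, Finsupp.smul_apply]
    rfl
  refine ⟨P, Q, ?_, ?_, fun _ => rfl, hQ⟩
  · ext k l
    rw [Matrix.mul_apply_eq_vecMul, hQ, Matrix.one_apply]
    change b.repr (b k) l = _
    rw [b.repr_self, Finsupp.single_apply]
  · refine Matrix.ext_iff_vecMul.2 fun v => ?_
    rw [← Matrix.vecMul_vecMul, Matrix.vecMul_eq_sum, Matrix.vecMul_one]
    simp only [hQ]
    exact b.sum_repr v

end ChangeOfBasis

theorem exists_eq_mul_of_forall_row {F κ ι : Type*} [Ring F] [Fintype κ] {B : Matrix ι κ F}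
    {C : Matrix κ κ F} (h : ∀ i, ∃ w, B i = Matrix.vecMul w C) : ∃ Y : Matrix ι κ F, B = Y * C := by
  choose w hw using h
  exact ⟨Matrix.of w, Matrix.ext fun i j => congrFun (hw i) j⟩

/-! ### The chain of row spaces of a nilpotent matrix -/

section Chain

variable {R : Type*} [CommRing R] [IsDomain R] [IsNoetherianRing R] [IsLocalRing R] {q : Ideal R} [q.IsPrime] {D : Type*} [Ring D]
  [Algebra R D] {z : D} {F : Type*} [Ring F] {f : D →+* F} {κ : Type*} [Fintype κ] [DecidableEq κ]

/-- The ring `F` is a skew field of fractions of `D ⧸ z D`. -/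
structure IsResidueField (R : Type*) [CommRing R] (q : Ideal R) {D : Type*} [Ring D] [Algebra R D]
    (z : D) {F : Type*} [Ring F] (f : D →+* F) : Prop where
  eq_zero_iff : ∀ x, f x = 0 ↔ z ∣ x
  isUnit_algebraMap : ∀ r : R, r ∉ q → IsUnit (f (algebraMap R D r))
  exists_mul_eq : ∀ y : F, ∃ r : R, r ∉ q ∧ ∃ d, f (algebraMap R D r) * y = f d

theorem IsResidueField.isUnit (hf : IsResidueField R q z f) (hD : IsUniformizing R q z) {b : D}
    (hb : ¬ z ∣ b) : IsUnit (f b) := by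
  obtain ⟨u, r, hr, h1, h2⟩ := hD.exists_inv b hb
  rw [← hf.eq_zero_iff, map_sub, sub_eq_zero, map_mul] at h1 h2
  have hu := hf.isUnit_algebraMap r hr
  rw [isUnit_iff_exists_and_exists]
  obtain ⟨c, hc⟩ := hu.exists_right_inv
  obtain ⟨c', hc'⟩ := hu.exists_left_inv
  exact ⟨⟨f u * c, by rw [← mul_assoc, h2, hc]⟩, ⟨c' * f u, by rw [mul_assoc, h1, hc']⟩⟩

theorem IsResidueField.exists_smul_eq (hf : IsResidueField R q z f) (w : κ → F) :
    ∃ r : R, r ∉ q ∧ ∃ v : κ → D, f (algebraMap R D r) • w = f ∘ v := by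
  choose r hr d hd using fun i => hf.exists_mul_eq (w i)
  refine ⟨∏ i, r i, fun h => ?_,
    fun i => algebraMap R D (∏ j ∈ Finset.univ.erase i, r j) * d i, funext fun i => ?_⟩
  · obtain ⟨i, -, hi⟩ := (Ideal.IsPrime.prod_mem_iff (p := q)).1 h
    exact hr i hi
  · change f (algebraMap R D (∏ i, r i)) * w i = f _
    rw [← Finset.prod_erase_mul _ _ (Finset.mem_univ i), map_mul, map_mul, mul_assoc, hd, map_mul]

/-- The lattice of the row vectors whose residue class lies in the row space of a matrix. -/
def rowLattice (f : D →+* F) (C : Matrix κ κ F) : Submodule D (κ → D) where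
  carrier := {v | ∃ w, f ∘ v = Matrix.vecMul w C}
  add_mem' := by
    rintro v v' ⟨w, hw⟩ ⟨w', hw'⟩
    exact ⟨w + w', by rw [Matrix.add_vecMul, ← hw, ← hw']; ext; simp⟩
  zero_mem' := ⟨0, by rw [Matrix.zero_vecMul]; ext; simp⟩
  smul_mem' := by
    rintro a v ⟨w, hw⟩
    exact ⟨f a • w, by rw [Matrix.smul_vecMul, ← hw]; ext; simp⟩

theorem mem_rowLattice {C : Matrix κ κ F} {v : κ → D} :
    v ∈ rowLattice f C ↔ ∃ w, f ∘ v = Matrix.vecMul w C := Iff.rfl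

theorem map_vecMul_eq (v : κ → D) (X : Matrix κ κ D) :
    f ∘ Matrix.vecMul v X = Matrix.vecMul (f ∘ v) (f.mapMatrix X) := by
  ext i
  simp [Matrix.vecMul, dotProduct]

theorem IsResidueField.exists_row (hf : IsResidueField R q z f) {C B : Matrix κ κ F}
    (h : ∀ v ∈ rowLattice f C, ∃ w, Matrix.vecMul (f ∘ v) B = Matrix.vecMul w C) : ∃ Y, C * B = Y * C := by
  refine exists_eq_mul_of_forall_row fun i => ?_
  obtain ⟨r, hr, v, hv⟩ := hf.exists_smul_eq (C i)
  obtain ⟨c, hc⟩ := (hf.isUnit_algebraMap r hr).exists_left_inv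
  have hCi : C i = Matrix.vecMul (Pi.single i 1) C := by
    rw [Matrix.single_one_vecMul]; rfl
  obtain ⟨w, hw⟩ := h v ⟨f (algebraMap R D r) • Pi.single i 1, by
    rw [Matrix.smul_vecMul, ← hCi, hv]⟩
  refine ⟨c • w, ?_⟩
  rw [Matrix.smul_vecMul, ← hw, ← Matrix.smul_vecMul, ← hv, smul_smul, hc, one_smul]
  rfl

/-- This replaces a condition on residues over `F` by stability of a `D`-lattice. Vectors over `F`
become residues of vectors over `D` after scaling by constants outside `q`, which are units in `F`.
-/
theorem IsResidueField.exists_mul_eq_iff (hf : IsResidueField R q z f) (C : Matrix κ κ F) (X : Matrix κ κ D) :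
    (∃ Y, C * f.mapMatrix X = Y * C) ↔
      ∀ v ∈ rowLattice f C, Matrix.vecMul v X ∈ rowLattice f C := by
  constructor
  · rintro ⟨Y, hY⟩ v ⟨w, hw⟩
    exact ⟨Matrix.vecMul w Y, by
      rw [map_vecMul_eq, hw, Matrix.vecMul_vecMul, hY, Matrix.vecMul_vecMul]⟩
  · intro h
    refine hf.exists_row fun v hv => ?_
    obtain ⟨w, hw⟩ := h v hv
    exact ⟨w, by rw [← map_vecMul_eq, hw]⟩

theorem IsResidueField.rowLattice_pure (hf : IsResidueField R q z f) (hD : IsUniformizing R q z)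
    (C : Matrix κ κ F) (b : D) (v : κ → D) (hb : ¬ z ∣ b) (hv : b • v ∈ rowLattice f C) :
    v ∈ rowLattice f C := by
  obtain ⟨c, hc⟩ := (hf.isUnit hD hb).exists_left_inv
  obtain ⟨w, hw⟩ := hv
  refine ⟨c • w, ?_⟩
  rw [Matrix.smul_vecMul, ← hw]
  ext i
  simp [← mul_assoc, hc]

theorem rowLattice_one : rowLattice f (1 : Matrix κ κ F) = ⊤ :=
  eq_top_iff.2 fun v _ => ⟨f ∘ v, by rw [Matrix.vecMul_one]⟩

theorem IsResidueField.rowLattice_zero (hf : IsResidueField R q z f) (hz : IsNormalElement z) :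
    rowLattice f (0 : Matrix κ κ F) = normalMultiples (κ → D) hz := by
  ext v
  rw [mem_rowLattice]
  simp only [Matrix.vecMul_zero, exists_const]
  constructor
  · intro h
    choose y hy using fun i => (hf.eq_zero_iff (v i)).1 (congrFun h i)
    exact ⟨y, funext hy⟩
  · rintro ⟨y, rfl⟩
    ext i
    exact (hf.eq_zero_iff _).2 ⟨y i, rfl⟩

theorem rowLattice_mul_le (B C : Matrix κ κ F) : rowLattice f (B * C) ≤ rowLattice f C := by
  rintro v ⟨w, hw⟩
  exact ⟨Matrix.vecMul w B, by rw [hw, Matrix.vecMul_vecMul]⟩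

theorem IsResidueField.exists_eq_mul_of_le (hf : IsResidueField R q z f) {B C : Matrix κ κ F}
    (h : rowLattice f B ≤ rowLattice f C) : ∃ Y, B = Y * C := by
  refine exists_eq_mul_of_forall_row fun i => ?_
  obtain ⟨r, hr, v, hv⟩ := hf.exists_smul_eq (B i)
  obtain ⟨c, hc⟩ := (hf.isUnit_algebraMap r hr).exists_left_inv
  obtain ⟨w, hw⟩ := h (x := v) ⟨f (algebraMap R D r) • Pi.single i 1, by
    rw [Matrix.smul_vecMul, Matrix.single_one_vecMul, ← hv]; rfl⟩
  exact ⟨c • w, by rw [Matrix.smul_vecMul, ← hw, ← hv, smul_smul, hc, one_smul]⟩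

/-- The idealiser of the chain of the row spaces of the powers of a nilpotent matrix is a block
triangular order. -/
theorem IsResidueField.exists_algEquiv (hf : IsResidueField R q z f) (hD : IsUniformizing R q z)
    [Nontrivial F] [Nonempty κ]
    {T : Matrix κ κ F} (hT : IsNilpotent T) :
    ∃ (e : ℕ) (n : Fin e → ℕ) (E : Matrix κ κ D ≃ₐ[R]
      Matrix (Σ j : Fin e, Fin (n j)) (Σ j : Fin e, Fin (n j)) D), 0 < e ∧ (∀ j, 0 < n j) ∧
      ∀ X, E X ∈ blockTriangular R (fun k => k.1.1) z hD.isNormal ↔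
        ∀ j : ℕ, ∃ Y, T ^ j * f.mapMatrix X = Y * T ^ j := by
  have hfin := hD.finite
  have htf := hD.torsionFree
  classical
  let e := nilpotencyClass T
  have hTe : T ^ e = 0 := pow_nilpotencyClass hT
  have hmin : ∀ j < e, T ^ j ≠ 0 := fun j hj h => hj.not_ge (Nat.sInf_le h)
  have he : 0 < e := by
    rw [Nat.pos_iff_ne_zero]
    intro h0
    rw [h0, pow_zero] at hTe
    exact one_ne_zero hTe
  obtain ⟨n, b, hb⟩ := hD.exists_adapted_basis (X := κ → D) e (fun j => rowLattice f (T ^ j))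
    (by rw [pow_zero, rowLattice_one]) (by rw [hTe, hf.rowLattice_zero hD.isNormal])
    (fun i j hij => by
      beta_reduce
      rw [← Nat.sub_add_cancel hij, pow_add]
      exact rowLattice_mul_le _ _)
    fun j _ b x hb hx => hf.rowLattice_pure hD _ b x hb hx
  obtain ⟨P, Q, hPQ, hQP, hP, hQ⟩ := exists_matrix_of_basis b
  refine ⟨e, n, conjMatrix R P Q hPQ hQP, he, fun j => ?_, fun X => ?_⟩
  · rw [Nat.pos_iff_ne_zero]
    intro hj
    have hle : rowLattice f (T ^ j.1) ≤ rowLattice f (T ^ (j.1 + 1)) := by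
      intro v hv
      rw [hb _ j.2]
      rw [hb _ j.2.le] at hv
      intro k hk
      rcases (Nat.lt_succ_iff_lt_or_eq.1 hk) with hk | hk
      · exact hv k hk
      · have : k.1 = j := Fin.ext hk
        exact absurd (k.2.2.trans_eq ((congrArg n this).trans hj)) (Nat.not_lt_zero _)
    obtain ⟨Y, hY⟩ := hf.exists_eq_mul_of_le hle
    -- An empty block would make two consecutive row spaces coincide; iteration would give `T ^ j =
    -- 0` below the nilpotency class.
    have key : ∀ k : ℕ, T ^ j.1 = Y ^ k * T ^ (j.1 + k) := by
      intro k
      induction k with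
      | zero => simp
      | succ k ih =>
        calc T ^ j.1 = Y * T ^ j.1 * T := by rw [mul_assoc, ← pow_succ, ← hY]
          _ = Y * (Y ^ k * T ^ (j.1 + k)) * T := by rw [← ih]
          _ = _ := by rw [pow_succ' Y, ← add_assoc, pow_succ T]; simp only [mul_assoc]
    refine hmin j j.2 ?_
    rw [key e, add_comm, pow_add, hTe, zero_mul, mul_zero]
  · have hlat : ∀ j ≤ e, ∀ v, v ∈ rowLattice f (T ^ j) ↔ ∀ k, k.1.1 < j → z ∣ Matrix.vecMul v Q k := by
      intro j hj v
      simp only [hQ]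
      exact hb j hj v
    have hXQ : ∀ v, Matrix.vecMul (Matrix.vecMul v X) Q =
        Matrix.vecMul (Matrix.vecMul v Q) (P * X * Q) := fun v => by
      rw [Matrix.vecMul_vecMul, Matrix.vecMul_vecMul, ← Matrix.mul_assoc, ← Matrix.mul_assoc, hQP,
        Matrix.one_mul]
    change (∀ k l, l.1.1 < k.1.1 → z ∣ (P * X * Q) k l) ↔ _
    simp only [hf.exists_mul_eq_iff]
    constructor
    · intro h j v hv
      rcases le_total j e with hj | hj
      · rw [hlat j hj] at hv ⊢
        intro l hl
        rw [hXQ]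
        refine Finset.dvd_sum fun k _ => ?_
        rcases lt_or_ge k.1.1 j with hk | hk
        · exact (hv k hk).mul_right _
        · exact hD.isNormal.dvd_mul_left _ (h k l (hl.trans_le hk))
      · have h0 : T ^ j = 0 := by rw [← Nat.sub_add_cancel hj, pow_add, hTe, mul_zero]
        rw [h0, hf.rowLattice_zero hD.isNormal] at hv ⊢
        obtain ⟨y, rfl⟩ := hv
        refine ⟨Matrix.vecMul y X, ?_⟩
        exact Matrix.smul_vecMul z y X
    · intro h k l hlk
      -- Testing stability on the basis vector `b k`, which lies in the lattice of its own block,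
      -- yields the divisibility of row `k`.
      have hrow : ∀ k, Matrix.vecMul (b k) Q = Pi.single k 1 := fun k => by
        ext l
        rw [hQ, b.repr_self, Finsupp.single_apply, Pi.single_apply]
        simp only [eq_comm]
      have h1 : b k ∈ rowLattice f (T ^ k.1.1) := (hlat _ k.1.2.le _).2 fun l hl => by
        rw [hrow, Pi.single_eq_of_ne (by rintro rfl; exact hl.false)]
        exact dvd_zero z
      have h2 := (hlat _ k.1.2.le _).1 (h _ _ h1) l hlk
      rwa [hXQ, hrow, Matrix.single_one_vecMul] at h2

end Chain

end NormalOrders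

namespace NormalOrders

theorem sum_eq_sum_subtype {κ M : Type*} [Fintype κ] [AddCommMonoid M] (p : κ → Prop)
    [DecidablePred p] (f : κ → M) (hf : ∀ i, ¬ p i → f i = 0) : ∑ i, f i = ∑ i : {i // p i}, f i := by
  rw [← Finset.sum_subtype (Finset.univ.filter p) (by simp) f]
  exact (Finset.sum_filter_of_ne fun i _ hi => by by_contra h; exact hi (hf i h)).symm

/-! ### Radical, index and block sizes of block triangular rings -/

section BlockIndex

variable {H S κ : Type*} [Ring H] [Ring S] [Fintype κ] [DecidableEq κ] {h : κ → ℕ}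
  {ι : H →+* Matrix κ κ S}

/-- The diagonal blocks of a ring of block triangular matrices. -/
def diagonalBlocks {F : Type*} [Ring F] (π : H →+* Matrix κ κ F) (hπ : ∀ x i j, h j < h i → π x i j = 0)
    (e : ℕ) : H →+* ∀ j : Fin e, Matrix {i // h i = j} {i // h i = j} F where
  toFun x _ := (π x).submatrix Subtype.val Subtype.val
  map_one' := by
    ext j k l
    simp [Matrix.one_apply, Subtype.ext_iff]
  map_zero' := by
    ext j k l
    simp
  map_add' x y := by
    ext j k l
    simp
  map_mul' x y := by
    ext j k l
    change π (x * y) k l = ∑ i : {i // h i = j}, π x k i * π y i l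
    rw [map_mul, Matrix.mul_apply]
    refine sum_eq_sum_subtype _ (fun i => π x k i * π y i l) fun i hi => ?_
    rcases lt_or_gt_of_ne hi with hi | hi
    · rw [hπ x k i (hi.trans_eq k.2.symm), zero_mul]
    · rw [hπ y i l (l.2.trans_lt hi), mul_zero]

theorem isNilpotent_of_strictly_blockTriangular {F : Type*} [Ring F] {M : Matrix κ κ F} {e : ℕ}
    (hlt : ∀ i, h i < e) (hM : ∀ i j, h j ≤ h i → M i j = 0) : IsNilpotent M := by
  have key : ∀ k : ℕ, ∀ i j, h j < h i + k → (M ^ k) i j = 0 := by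
    intro k
    induction k with
    | zero =>
      intro i j hij
      rw [pow_zero, Matrix.one_apply_ne]
      rintro rfl
      simp at hij
    | succ k ih =>
      intro i j hij
      rw [pow_succ, Matrix.mul_apply]
      refine Finset.sum_eq_zero fun l _ => ?_
      by_cases hl : h l < h i + k
      · rw [ih i l hl, zero_mul]
      · rw [hM l j (by omega), mul_zero]
  exact ⟨e, Matrix.ext fun i j => key e i j (by have := hlt j; omega)⟩

theorem residueMatrix_apply_eq_zero_iff (X : Matrix κ κ S) (i j : κ) :
    residueMatrix S κ X i j = 0 ↔ X i j ∈ Ring.jacobson S := Ideal.Quotient.eq_zero_iff_mem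

theorem residueMatrix_eq_zero_of_lt
    (hι : ∀ X, X ∈ ι.range ↔ ∀ i j, h j < h i → X i j ∈ Ring.jacobson S) (x : H) (i j : κ)
    (hij : h j < h i) : (residueMatrix S κ).comp ι x i j = 0 :=
  (residueMatrix_apply_eq_zero_iff _ i j).2 ((hι _).1 ⟨x, rfl⟩ i j hij)

theorem diagonalBlocks_surjective
    (hι : ∀ X, X ∈ ι.range ↔ ∀ i j, h j < h i → X i j ∈ Ring.jacobson S) (e : ℕ) :
    Function.Surjective (diagonalBlocks _ (residueMatrix_eq_zero_of_lt hι) e) := by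
  intro Y
  obtain ⟨X, hX⟩ := residueMatrix_surjective (S := S) (Matrix.of fun i i' =>
    if hi : h i = h i' ∧ h i < e then Y ⟨h i, hi.2⟩ ⟨i, rfl⟩ ⟨i', hi.1.symm⟩ else 0)
  obtain ⟨x, rfl⟩ := (hι X).2 fun i j hij => by
    rw [← residueMatrix_apply_eq_zero_iff, hX, Matrix.of_apply, dif_neg fun hi => hij.ne' hi.1]
  refine ⟨x, ?_⟩
  ext ⟨j, hj⟩ ⟨k, hk⟩ ⟨l, hl⟩
  change residueMatrix S κ (ι x) k l = _
  obtain rfl : h k = j := hk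
  rw [hX, Matrix.of_apply, dif_pos ⟨hl.symm, hj⟩]

variable {e : ℕ} [IsSemisimpleRing (S ⧸ Ring.jacobson S)]

/-- The diagonal blocks map onto a semisimple ring, so the radical goes to zero. If the diagonal
blocks of `x` vanish, every `a x` is strictly block triangular modulo the radical, hence nilpotent
there. -/
theorem mem_jacobson_iff_of_blockTriangular
    (hι : ∀ X, X ∈ ι.range ↔ ∀ i j, h j < h i → X i j ∈ Ring.jacobson S)
    (hnil : ∀ x, IsNilpotent (residueMatrix S κ (ι x)) → ∃ k : ℕ, x ^ k ∈ Ring.jacobson H)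
    (hlt : ∀ i, h i < e) (x : H) :
    diagonalBlocks _ (residueMatrix_eq_zero_of_lt hι) e x = 0 ↔ x ∈ Ring.jacobson H := by
  constructor
  · intro hx
    refine mem_jacobson_of_forall_pow fun a => hnil _ ?_
    refine isNilpotent_of_strictly_blockTriangular hlt fun i j hij => ?_
    rcases hij.lt_or_eq with hij | hij
    · exact residueMatrix_eq_zero_of_lt hι _ i j hij
    · have h1 : diagonalBlocks _ (residueMatrix_eq_zero_of_lt hι) e (a * x) = 0 := by
        rw [map_mul, hx, mul_zero]
      exact congrFun (congrFun (congrFun h1 ⟨h i, hlt i⟩) ⟨i, rfl⟩) ⟨j, hij⟩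
  · intro hx
    have : RingHomSurjective (diagonalBlocks _ (residueMatrix_eq_zero_of_lt hι) e) :=
      ⟨diagonalBlocks_surjective hι e⟩
    have h1 := Ring.le_comap_jacobson (diagonalBlocks _ (residueMatrix_eq_zero_of_lt hι) e) hx
    rwa [IsSemisimpleRing.jacobson_eq_bot
      (R := ∀ j : Fin e, Matrix {i // h i = j} {i // h i = j} (S ⧸ Ring.jacobson S))] at h1

theorem mem_jacobson_iff_forall_apply_mem
    (hι : ∀ X, X ∈ ι.range ↔ ∀ i j, h j < h i → X i j ∈ Ring.jacobson S)
    (hnil : ∀ x, IsNilpotent (residueMatrix S κ (ι x)) → ∃ k : ℕ, x ^ k ∈ Ring.jacobson H)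
    (hlt : ∀ i, h i < e) (x : H) :
    x ∈ Ring.jacobson H ↔ ∀ i j, h j ≤ h i → ι x i j ∈ Ring.jacobson S := by
  rw [← mem_jacobson_iff_of_blockTriangular hι hnil hlt]
  constructor
  · intro hx i j hij
    rcases hij.lt_or_eq with hij | hij
    · exact (hι _).1 ⟨x, rfl⟩ i j hij
    · rw [← residueMatrix_apply_eq_zero_iff]
      exact congrFun (congrFun (congrFun hx ⟨h i, hlt i⟩) ⟨i, rfl⟩) ⟨j, hij⟩
  · intro hx
    ext j k l
    exact (residueMatrix_apply_eq_zero_iff _ _ _).2 (hx k l (l.2.trans k.2.symm).le)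

theorem card_maximalSpectrum_center_of_blockTriangular [Nontrivial (S ⧸ Ring.jacobson S)]
    (hι : ∀ X, X ∈ ι.range ↔ ∀ i j, h j < h i → X i j ∈ Ring.jacobson S)
    (hnil : ∀ x, IsNilpotent (residueMatrix S κ (ι x)) → ∃ k : ℕ, x ^ k ∈ Ring.jacobson H)
    (hlt : ∀ i, h i < e) (hsurj : ∀ j < e, ∃ i, h i = j)
    (hF : ∀ a : S ⧸ Ring.jacobson S, IsUnit a ∨ a = 0) :
    Nat.card (MaximalSpectrum (Subring.center (H ⧸ Ring.jacobson H))) = e := by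
  have : ∀ j : Fin e, Nonempty {i // h i = j} := fun j => by
    obtain ⟨i, hi⟩ := hsurj j j.2
    exact ⟨⟨i, hi⟩⟩
  rw [card_maximalSpectrum_center_of_surjective _ (diagonalBlocks_surjective hι e)
    (mem_jacobson_iff_of_blockTriangular hι hnil hlt)]
  refine (@card_maximalSpectrum_center_pi_matrix (Fin e) _ (S ⧸ Ring.jacobson S)
    (DivisionRing.ofIsUnitOrEqZero hF) (fun j => {i // h i = j}) _ _ _).trans (Nat.card_fin e)

/-- Modulo the radical the hypothesis provides a left inverse of the block of `τ` with rows in `a`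
and columns in `b`; the inequality is the strong rank condition. -/
theorem card_block_le [Nontrivial (S ⧸ Ring.jacobson S)]
    {a b : ℕ} {τ : Matrix κ κ S}
    (hy : ∀ l, h l = b → ∃ y : κ → S, (∀ m, h m ≠ a → ∀ l', h l' = b → y m * τ m l' ∈ Ring.jacobson S) ∧
      ∀ l', h l' = b → ∑ m, y m * τ m l' = if l = l' then 1 else 0) :
    Nat.card {i // h i = b} ≤ Nat.card {i // h i = a} := by
  choose y hy0 hy1 using hy
  let mk := Ideal.Quotient.mk (Ring.jacobson S)
  let Y : Matrix {i // h i = b} {i // h i = a} (S ⧸ Ring.jacobson S) :=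
    Matrix.of fun l m => mk (y l l.2 m)
  let B : Matrix {i // h i = a} {i // h i = b} (S ⧸ Ring.jacobson S) :=
    Matrix.of fun m l => mk (τ m l)
  have hYB : Y * B = 1 := by
    ext l l'
    have h1 := congrArg mk (hy1 l l.2 l' l'.2)
    rw [map_sum, sum_eq_sum_subtype (fun i => h i = a) _ fun m hm =>
      Ideal.Quotient.eq_zero_iff_mem.2 (hy0 l l.2 m hm l' l'.2)] at h1
    rw [Matrix.mul_apply, Matrix.one_apply]
    simp only [map_mul, apply_ite mk, map_one, map_zero, Subtype.coe_inj] at h1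
    exact h1
  rw [Nat.card_eq_fintype_card, Nat.card_eq_fintype_card]
  refine card_le_of_injective (S ⧸ Ring.jacobson S) (Matrix.vecMulLinear Y) fun v w hvw => ?_
  have h2 := congrArg (fun v => Matrix.vecMul v B) hvw
  simpa [Matrix.vecMulLinear_apply, Matrix.vecMul_vecMul, hYB] using h2

/-- If the radical of a block triangular order is principal, then its diagonal blocks have the same
size. -/
theorem card_block_eq [Nontrivial (S ⧸ Ring.jacobson S)] {t : H}
    (hι : ∀ X, X ∈ ι.range ↔ ∀ i j, h j < h i → X i j ∈ Ring.jacobson S)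
    (hnil : ∀ x, IsNilpotent (residueMatrix S κ (ι x)) → ∃ k : ℕ, x ^ k ∈ Ring.jacobson H)
    (hlt : ∀ i, h i < e) (hsurj : ∀ j < e, ∃ i, h i = j)
    (ht : ∀ x, x ∈ Ring.jacobson H ↔ ∃ a, x = a * t) {ζ : S}
    (hζ : Ring.jacobson S = Ideal.span {ζ}) (hreg : ∀ x, x * ζ = 0 → x = 0) :
    ∀ j < e, Nat.card {i // h i = j} = Nat.card {i // h i = 0} := by
  have hJ := mem_jacobson_iff_forall_apply_mem hι hnil hlt
  have htJ : t ∈ Ring.jacobson H := (ht t).2 ⟨1, (one_mul t).symm⟩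
  have hsingle : ∀ k l (s : S), (h l ≤ h k → s ∈ Ring.jacobson S) →
      ∃ a, Matrix.single k l s = ι a * ι t := by
    intro k l s hs
    have hmem : ∀ i j, h j ≤ h i → Matrix.single k l s i j ∈ Ring.jacobson S := fun i j hij => by
      by_cases hc : k = i ∧ l = j
      · obtain ⟨rfl, rfl⟩ := hc
        rw [Matrix.single_apply_same]
        exact hs hij
      · rw [Matrix.single_apply, if_neg hc]
        exact zero_mem _
    obtain ⟨x, hx⟩ := (hι (Matrix.single k l s)).2 fun i j hij => hmem i j hij.le
    obtain ⟨a, rfl⟩ := (ht x).1 ((hJ x).2 fun i j hij => by rw [hx]; exact hmem i j hij)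
    exact ⟨a, by rw [← hx, map_mul]⟩
  -- A matrix unit from block `j` to block `j + 1` lies in the radical and so is `a t`. In this
  -- product only the indices of block `j` contribute modulo the radical: below it the factor from
  -- `a` vanishes, above it the one from `t`.
  have hstep : ∀ j, j + 1 < e → Nat.card {i // h i = j + 1} ≤ Nat.card {i // h i = j} := by
    intro j hj
    obtain ⟨k, rfl⟩ := hsurj j (by omega)
    refine card_block_le (τ := ι t) fun l hl => ?_
    obtain ⟨a, ha⟩ := hsingle k l 1 (by omega)
    refine ⟨ι a k, fun m hm l' hl' => ?_, fun l' hl' => ?_⟩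
    · rcases lt_or_gt_of_ne hm with hm | hm
      · exact (Ring.jacobson S).mul_mem_right _ ((hι _).1 ⟨a, rfl⟩ k m hm)
      · exact (Ring.jacobson S).mul_mem_left _ ((hJ t).1 htJ m l' (by omega))
    · have h1 := congrFun (congrFun ha k) l'
      rw [Matrix.mul_apply, Matrix.single_apply] at h1
      simpa using h1.symm
  -- Closing the cycle from the last block to block `0` requires the entry `ζ`. The columns of `t`
  -- in block `0` lie entirely in the radical, so `ζ` can be divided out of them.
  have hwrap : Nat.card {i // h i = 0} ≤ Nat.card {i // h i = e - 1} := by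
    have hc : ∀ m l', ∃ c, h l' = 0 → c * ζ = ι t m l' := fun m l' => by
      by_cases hl' : h l' = 0
      · obtain ⟨c, hc⟩ := Ideal.mem_span_singleton'.1 (hζ ▸ (hJ t).1 htJ m l' (by omega))
        exact ⟨c, fun _ => hc⟩
      · exact ⟨0, fun h => absurd h hl'⟩
    choose τ hτ using hc
    refine card_block_le (τ := Matrix.of τ) fun l hl => ?_
    have := hlt l
    obtain ⟨k, hk⟩ := hsurj (e - 1) (by omega)
    obtain ⟨a, ha⟩ := hsingle k l ζ fun _ => hζ ▸ Ideal.mem_span_singleton_self ζ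
    refine ⟨ι a k, fun m hm l' hl' => ?_, fun l' hl' => ?_⟩
    · have := hlt m
      exact (Ring.jacobson S).mul_mem_right _ ((hι _).1 ⟨a, rfl⟩ k m (by omega))
    · have h1 := congrFun (congrFun ha k) l'
      rw [Matrix.mul_apply, Matrix.single_apply] at h1
      rw [← sub_eq_zero]
      refine hreg _ ?_
      rw [sub_mul, Finset.sum_mul, sub_eq_zero]
      refine (Finset.sum_congr rfl fun m _ => ?_).trans (h1.symm.trans ?_)
      · rw [mul_assoc, Matrix.of_apply, hτ m l' hl']
      · simp
  have hle : ∀ j < e, Nat.card {i // h i = j} ≤ Nat.card {i // h i = 0} := by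
    intro j
    induction j with
    | zero => exact fun _ => le_rfl
    | succ j ih => exact fun hj => (hstep j hj).trans (ih (by omega))
  have hge : ∀ k < e, Nat.card {i // h i = e - 1} ≤ Nat.card {i // h i = e - 1 - k} := by
    intro k
    induction k with
    | zero => exact fun _ => le_rfl
    | succ k ih =>
      intro hk
      have h1 := hstep (e - 1 - (k + 1)) (by omega)
      rw [show e - 1 - (k + 1) + 1 = e - 1 - k by omega] at h1
      exact (ih (by omega)).trans h1
  intro j hj
  refine (hle j hj).antisymm (hwrap.trans ?_)
  have h1 := hge (e - 1 - j) (by omega)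
  rwa [show e - 1 - (e - 1 - j) = j by omega] at h1

end BlockIndex

end NormalOrders

namespace NormalOrders

/-! ### Block triangular orders at the primes of height one -/

section AtPrime

variable {R : Type u} [CommRing R] [IsDomain R] [IsNoetherianRing R] [IsIntegrallyClosed R]
  [IsLocalRing R] {D : Type v} [Ring D] [Algebra R D] {q : CodimOnePrime R} {z : D}

theorem localised_smul_mem_iff (p : PrimeSpectrum R) {s : R} (hs : s ∉ p.asIdeal)
    (I : Ideal (LocalisedAt R D p)) (x : LocalisedAt R D p) : s • x ∈ I ↔ x ∈ I := by
  constructor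
  · intro h
    obtain ⟨o, ho⟩ := localised_exists_smul_eq p hs x
    rw [← ho, smul_comm, ← smul_one_mul]
    exact I.mul_mem_left _ h
  · intro h
    rw [← smul_one_mul]
    exact I.mul_mem_left _ h

/-- The homomorphism from `D` to the residue ring of the localisation of `D`. -/
noncomputable def residueHom (D : Type v) [Ring D] [Algebra R D] (p : PrimeSpectrum R) :
    D →+* LocalisedAt R D p ⧸ Ring.jacobson (LocalisedAt R D p) :=
  (Ideal.Quotient.mk _).comp (Algebra.TensorProduct.includeRight : D →ₐ[R] LocalisedAt R D p)

theorem residueHom_eq_zero_iff (p : PrimeSpectrum R) (x : D) :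
    residueHom D p x = 0 ↔ (1 : Localization.AtPrime p.asIdeal) ⊗ₜ[R] x ∈
      Ring.jacobson (LocalisedAt R D p) := Ideal.Quotient.eq_zero_iff_mem

theorem residueHom_algebraMap_mul (p : PrimeSpectrum R) (r : R) (y : LocalisedAt R D p) :
    residueHom D p (algebraMap R D r) * Ideal.Quotient.mk _ y =
      Ideal.Quotient.mk (Ring.jacobson (LocalisedAt R D p)) (r • y) := by
  have h1 : ((1 : Localization.AtPrime p.asIdeal) ⊗ₜ[R] algebraMap R D r : LocalisedAt R D p) * y =
      r • y := by
    rw [Algebra.algebraMap_eq_smul_one, TensorProduct.tmul_smul, ← Algebra.TensorProduct.one_def,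
      smul_one_mul]
  exact (RingHom.map_mul (Ideal.Quotient.mk (Ring.jacobson (LocalisedAt R D p))) _ _).symm.trans
    (congrArg _ h1)

/-- If `x` becomes a multiple of `z` after localisation, then `z ∣ s x` for some `s ∉ q`. As `z` is
completely prime and does not divide `s`, it divides `x`. -/
theorem IsUniformizing.isResidueField (hD : IsUniformizing R q.1.asIdeal z)
    (hrad : Ring.jacobson (LocalisedAt R D q.1) =
      Ideal.span {(1 : Localization.AtPrime q.1.asIdeal) ⊗ₜ[R] z}) :
    IsResidueField R q.1.asIdeal z (residueHom D q.1) where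
  eq_zero_iff x := by
    have := hD.torsionFree
    rw [residueHom_eq_zero_iff, hrad, Ideal.mem_span_singleton']
    constructor
    · rintro ⟨y, hy⟩
      obtain ⟨s, hs, b, hb⟩ := exists_smul_eq_one_tmul q.1 y
      have h1 : s • x = b * z := by
        rw [← sub_eq_zero]
        refine localised_one_tmul_injective q.1 ?_
        rw [TensorProduct.tmul_sub, TensorProduct.tmul_smul, ← hy, ← smul_mul_assoc, hb,
          Algebra.TensorProduct.tmul_mul_tmul, one_mul, sub_self]
      have h2 : z ∣ algebraMap R D s * x := by
        rw [← Algebra.smul_def, h1]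
        exact (hD.isNormal.dvd_iff _).2 ⟨b, rfl⟩
      exact (hD.dvd_or_dvd _ _ h2).resolve_left fun h => hs ((hD.dvd_algebraMap_iff s).1 h)
    · intro h
      obtain ⟨b, rfl⟩ := (hD.isNormal.dvd_iff _).1 h
      exact ⟨1 ⊗ₜ b, by rw [Algebra.TensorProduct.tmul_mul_tmul, one_mul]⟩
  isUnit_algebraMap r hr := by
    have h1 := (isUnit_algebraMap_of_notMem q.1 hr).map
      (algebraMap (Localization.AtPrime q.1.asIdeal) (LocalisedAt R D q.1))
    have h2 := h1.map (Ideal.Quotient.mk (Ring.jacobson (LocalisedAt R D q.1)))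
    convert h2 using 1
    rw [← mul_one (residueHom D q.1 _), ← map_one (Ideal.Quotient.mk (Ring.jacobson _)),
      residueHom_algebraMap_mul, ← algebraMap_smul (Localization.AtPrime q.1.asIdeal) r,
      Algebra.algebraMap_eq_smul_one (A := LocalisedAt R D q.1)]
  exists_mul_eq y := by
    obtain ⟨y, rfl⟩ := Ideal.Quotient.mk_surjective y
    obtain ⟨s, hs, b, hb⟩ := exists_smul_eq_one_tmul q.1 y
    exact ⟨s, hs, b, by rw [residueHom_algebraMap_mul, hb]; rfl⟩

theorem IsResidueField.isUnit_or_eq_zero {R : Type*} [CommRing R] [IsDomain R] [IsNoetherianRing R]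
    [IsLocalRing R] {q : Ideal R} [q.IsPrime]
    {D : Type*} [Ring D] [Algebra R D] {z : D} {F : Type*} [Ring F] {f : D →+* F}
    (hf : IsResidueField R q z f) (hD : IsUniformizing R q z) (a : F) :
    IsUnit a ∨ a = 0 := by
  obtain ⟨r, hr, d, hd⟩ := hf.exists_mul_eq a
  have hu := hf.isUnit_algebraMap r hr
  by_cases h : z ∣ d
  · rw [(hf.eq_zero_iff d).2 h, hu.mul_right_eq_zero] at hd
    exact Or.inr hd
  · refine Or.inl ?_
    have h1 := hf.isUnit hD h
    rw [← hd] at h1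
    obtain ⟨c, hc⟩ := hu
    rw [← hc, Units.isUnit_units_mul] at h1
    exact h1

theorem IsResidueField.nontrivial {R : Type*} [CommRing R] [IsDomain R] [IsNoetherianRing R]
    [IsLocalRing R] {q : Ideal R} [q.IsPrime]
    {D : Type*} [Ring D] [Algebra R D] {z : D} {F : Type*} [Ring F] {f : D →+* F}
    (hf : IsResidueField R q z f) (hD : IsUniformizing R q z) : Nontrivial F := by
  refine ⟨1, 0, fun h => hD.not_isUnit ?_⟩
  rw [← map_one f, hf.eq_zero_iff] at h
  obtain ⟨w, hw⟩ := h
  obtain ⟨w', hw'⟩ := (hD.isNormal.dvd_iff 1).1 ⟨w, hw⟩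
  exact isUnit_iff_exists_and_exists.2 ⟨⟨w, hw.symm⟩, ⟨w', hw'.symm⟩⟩

variable {κ : Type*} [Fintype κ] [DecidableEq κ] {h : κ → ℕ}
  {A : Type v} [Ring A] [Algebra R A] [Module.Finite R A] {ψ : A →ₐ[R] Matrix κ κ D}

theorem IsUniformizing.exists_smul_mem_blockTriangular (hD : IsUniformizing R q.1.asIdeal z) {r : R}
    (hr : r ∈ q.1.asIdeal) (X : Matrix κ κ D) : r • X ∈ blockTriangular R h z hD.isNormal := by
  intro i j _
  rw [Matrix.smul_apply, Algebra.smul_def]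
  exact ((hD.dvd_algebraMap_iff r).2 hr).mul_right _

theorem localisedMatrixHom_surjective_of_notMem (p : PrimeSpectrum R) {r : R} (hr : r ∉ p.asIdeal)
    (h : ∀ X, ∃ a, ψ a = r • X) : Function.Surjective (localisedMatrixHom p ψ) := by
  intro X
  obtain ⟨a, ha⟩ := exists_localisedMatrixHom_eq_smul (p := p) ψ h X
  obtain ⟨x, hx⟩ := localised_exists_smul_eq p hr a
  refine ⟨x • a, ?_⟩
  have : Function.Injective fun X : Matrix κ κ (LocalisedAt R D p) => r • X := fun X Y hXY =>
    Matrix.ext fun i j => localised_smul_injective p hr (congrFun (congrFun hXY i) j)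
  refine this ?_
  change r • localisedMatrixHom p ψ _ = _
  rw [← localisedMatrixHom_smul, hx, ha]

theorem exists_mem_notMem (p : CodimOnePrime R) (hp : p ≠ q) : ∃ r ∈ q.1.asIdeal, r ∉ p.1.asIdeal := by
  by_contra! hle
  have hle : q.1.asIdeal ≤ p.1.asIdeal := hle
  refine hp (Subtype.ext (PrimeSpectrum.ext ?_))
  by_contra hne
  have h1 := Ideal.height_add_one_le_of_lt_of_isPrime (lt_of_le_of_ne hle (Ne.symm hne))
  rw [p.2, q.2] at h1
  exact absurd h1 (by norm_num)

/-- Away from `q`, a block triangular order is a full matrix algebra. -/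
theorem IsUniformizing.localisedMatrixHom_surjective (hD : IsUniformizing R q.1.asIdeal z)
    (hψ : ∀ X, (∃ a, ψ a = X) ↔ X ∈ blockTriangular R h z hD.isNormal) (p : CodimOnePrime R)
    (hp : p ≠ q) : Function.Surjective (localisedMatrixHom p.1 ψ) := by
  obtain ⟨r, hr, hrp⟩ := exists_mem_notMem p hp
  exact localisedMatrixHom_surjective_of_notMem p.1 hrp fun X =>
    (hψ _).2 (hD.exists_smul_mem_blockTriangular hr X)

theorem IsUniformizing.mem_range_localisedMatrixHom_iff (hD : IsUniformizing R q.1.asIdeal z)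
    (hrad : Ring.jacobson (LocalisedAt R D q.1) =
      Ideal.span {(1 : Localization.AtPrime q.1.asIdeal) ⊗ₜ[R] z})
    (hψ : ∀ X, (∃ a, ψ a = X) ↔ X ∈ blockTriangular R h z hD.isNormal)
    (X : Matrix κ κ (LocalisedAt R D q.1)) :
    X ∈ (localisedMatrixHom q.1 ψ : LocalisedAt R A q.1 →+* Matrix κ κ (LocalisedAt R D q.1)).range ↔
      ∀ i j, h j < h i → X i j ∈ Ring.jacobson (LocalisedAt R D q.1) := by
  have hf := hD.isResidueField hrad
  constructor
  · rintro ⟨x, rfl⟩ i j hij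
    obtain ⟨s, hs, a, ha⟩ := exists_smul_eq_one_tmul q.1 x
    rw [← localised_smul_mem_iff q.1 hs]
    have h1 : s • (localisedMatrixHom q.1 ψ x) i j = 1 ⊗ₜ ψ a i j := by
      rw [← localisedMatrixHom_one_tmul, ← ha, localisedMatrixHom_smul]
      rfl
    refine (congrArg (· ∈ Ring.jacobson (LocalisedAt R D q.1)) h1).mpr ?_
    rw [← residueHom_eq_zero_iff, hf.eq_zero_iff]
    exact (hψ _).1 ⟨a, rfl⟩ i j hij
  · intro hX
    obtain ⟨s, hs, Y, hY⟩ := exists_smul_eq_map_one_tmul X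
    obtain ⟨a, ha⟩ := (hψ Y).2 fun i j hij => by
      rw [← hf.eq_zero_iff, residueHom_eq_zero_iff]
      have h1 : s • X i j = 1 ⊗ₜ Y i j := congrFun (congrFun hY i) j
      rw [← h1, localised_smul_mem_iff q.1 hs]
      exact hX i j hij
    obtain ⟨x, hx⟩ := localised_exists_smul_eq q.1 hs
      ((1 : Localization.AtPrime q.1.asIdeal) ⊗ₜ[R] a : LocalisedAt R A q.1)
    refine ⟨x • 1 ⊗ₜ[R] a, Matrix.ext fun i j => localised_smul_injective q.1 hs ?_⟩
    change (s • localisedMatrixHom q.1 ψ _) i j = (s • X) i j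
    rw [← localisedMatrixHom_smul, hx, localisedMatrixHom_one_tmul_eq, ha, hY]

theorem IsUniformizing.exists_ne_zero_smul (hD : IsUniformizing R q.1.asIdeal z)
    (hψ : ∀ X, (∃ a, ψ a = X) ↔ X ∈ blockTriangular R h z hD.isNormal) :
    ∃ r : R, r ≠ 0 ∧ ∀ X, ∃ a, ψ a = r • X := by
  have h0 : q.1.asIdeal ≠ ⊥ := by
    intro h
    have := q.2
    rw [h, Ideal.height_bot] at this
    exact zero_ne_one this
  obtain ⟨r, hr, hr0⟩ := Submodule.exists_mem_ne_zero_of_ne_bot h0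
  exact ⟨r, hr0, fun X => (hψ _).2 (hD.exists_smul_mem_blockTriangular hr X)⟩

theorem IsUniformizing.exists_pow_mem_jacobson (hD : IsUniformizing R q.1.asIdeal z)
    (hinj : Function.Injective ψ)
    (hψ : ∀ X, (∃ a, ψ a = X) ↔ X ∈ blockTriangular R h z hD.isNormal) (x : LocalisedAt R A q.1)
    (hx : IsNilpotent (residueMatrix _ κ (localisedMatrixHom q.1 ψ x))) :
    ∃ k : ℕ, x ^ k ∈ Ring.jacobson (LocalisedAt R A q.1) := by
  have hdom : IsDomain (Localization.AtPrime q.1.asIdeal) :=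
    IsLocalization.isDomain_localization q.1.asIdeal.primeCompl_le_nonZeroDivisors
  have := isDiscreteValuationRing_of_height_eq_one q.1 q.2
  have := hD.finite
  have := hD.torsionFree
  have := hD.isDomain
  obtain ⟨r, hr, h⟩ := hD.exists_ne_zero_smul hψ
  obtain ⟨r', hr', h'⟩ := exists_ne_zero_localisedMatrixHom_eq_smul (p := q) hr h
  exact exists_pow_mem_jacobson_of_isNilpotent_residueMatrix (localisedMatrixHom_injective ψ hinj)
    hr' h' x hx

/-- The index of a block triangular order at `q` is the number of its blocks. -/
theorem IsUniformizing.localIndex_eq (hD : IsUniformizing R q.1.asIdeal z)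
    (hrad : Ring.jacobson (LocalisedAt R D q.1) =
      Ideal.span {(1 : Localization.AtPrime q.1.asIdeal) ⊗ₜ[R] z})
    (hinj : Function.Injective ψ)
    (hψ : ∀ X, (∃ a, ψ a = X) ↔ X ∈ blockTriangular R h z hD.isNormal)
    {e : ℕ} (hlt : ∀ i, h i < e) (hsurj : ∀ j < e, ∃ i, h i = j) : localIndex R A q = e := by
  have hdom : IsDomain (Localization.AtPrime q.1.asIdeal) :=
    IsLocalization.isDomain_localization q.1.asIdeal.primeCompl_le_nonZeroDivisors
  have := isDiscreteValuationRing_of_height_eq_one q.1 q.2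
  have := hD.finite
  have hf := hD.isResidueField hrad
  have := hf.nontrivial hD
  obtain ⟨ϖ, hϖ⟩ := IsDiscreteValuationRing.exists_irreducible (Localization.AtPrime q.1.asIdeal)
  have := isSemisimpleRing_quotient_jacobson (LocalisedAt R D q.1) hϖ
  exact card_maximalSpectrum_center_of_blockTriangular
    (hD.mem_range_localisedMatrixHom_iff hrad hψ) (hD.exists_pow_mem_jacobson hinj hψ) hlt hsurj
    (hf.isUnit_or_eq_zero hD)

/-- If the radical of a block triangular order is principal at `q`, then its diagonal blocks have
the same size. -/
theorem IsUniformizing.card_block_eq (hD : IsUniformizing R q.1.asIdeal z)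
    (hrad : Ring.jacobson (LocalisedAt R D q.1) =
      Ideal.span {(1 : Localization.AtPrime q.1.asIdeal) ⊗ₜ[R] z})
    (hinj : Function.Injective ψ)
    (hψ : ∀ X, (∃ a, ψ a = X) ↔ X ∈ blockTriangular R h z hD.isNormal)
    {e : ℕ} (hlt : ∀ i, h i < e) (hsurj : ∀ j < e, ∃ i, h i = j)
    (hA : HasPrincipalRadical (LocalisedAt R A q.1)) :
    ∀ j < e, Nat.card {i // h i = j} = Nat.card {i // h i = 0} := by
  have hdom : IsDomain (Localization.AtPrime q.1.asIdeal) :=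
    IsLocalization.isDomain_localization q.1.asIdeal.primeCompl_le_nonZeroDivisors
  have := isDiscreteValuationRing_of_height_eq_one q.1 q.2
  have := hD.finite
  have := hD.torsionFree
  have hf := hD.isResidueField hrad
  have := hf.nontrivial hD
  obtain ⟨ϖ, hϖ⟩ := IsDiscreteValuationRing.exists_irreducible (Localization.AtPrime q.1.asIdeal)
  have := isSemisimpleRing_quotient_jacobson (LocalisedAt R D q.1) hϖ
  obtain ⟨t, ht⟩ := hA.1
  refine NormalOrders.card_block_eq (hD.mem_range_localisedMatrixHom_iff hrad hψ)
    (hD.exists_pow_mem_jacobson hinj hψ) hlt hsurj ht hrad fun x hx => ?_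
  -- Regularity of `z` in the localisation comes from `z w = c`.
  obtain ⟨w, c, hc, h1, -⟩ := hD.exists_mul_eq
  refine smul_localised_eq_zero q.1 hc ?_
  have h2 : ((1 : Localization.AtPrime q.1.asIdeal) ⊗ₜ[R] z : LocalisedAt R D q.1) * (1 ⊗ₜ w) =
      c • (1 : LocalisedAt R D q.1) := by
    rw [Algebra.TensorProduct.tmul_mul_tmul, one_mul, h1, Algebra.algebraMap_eq_smul_one,
      TensorProduct.tmul_smul, Algebra.TensorProduct.one_def]
  rw [← mul_smul_one, ← h2, ← mul_assoc, hx, zero_mul]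

end AtPrime

end NormalOrders

namespace NormalOrders

open IsLocalRing

/-! ### From localisations back to the order -/

section Global

variable {R : Type u} [CommRing R] [IsDomain R] [IsNoetherianRing R] [IsIntegrallyClosed R]
  [IsLocalRing R] {D : Type v} [Ring D] [Algebra R D] {q : CodimOnePrime R} {z : D}
  {L : Type v} [Ring L] [Algebra R L]

/-- A saturated order is the intersection of its localisations at the primes of height one. -/
theorem exists_eq_of_forall_codimOnePrime (hdim : ringKrullDim R = 2) (hL : IsSaturated R L)
    {M : Type*} [AddCommGroup M] [Module R M] [Module.IsTorsionFree R M] {φ : L →ₗ[R] M}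
    (hφ : Function.Injective φ) {r : R} (hr : r ≠ 0) {X : M} (hX : ∃ a, φ a = r • X)
    (h : ∀ p : CodimOnePrime R, ∃ s ∉ p.1.asIdeal, ∃ a, φ a = s • X) : ∃ a, φ a = X := by
  let I : Ideal R := (LinearMap.range φ).comap (LinearMap.toSpanSingleton R M X)
  obtain ⟨k, hk⟩ := exists_maximalIdeal_pow_le hdim I
    (fun h0 => hr ((Submodule.eq_bot_iff I).1 h0 r hX)) fun p hp hp1 hle => by
      obtain ⟨s, hs, ha⟩ := h ⟨⟨p, hp⟩, hp1⟩
      exact hs (hle ha)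
  obtain ⟨a, ha⟩ := hX
  obtain ⟨y, hy⟩ := hL.of_pow hr k a fun c hc => by
    obtain ⟨b, hb⟩ : ∃ b, φ b = c • X := hk hc
    exact ⟨b, hφ (by rw [map_smul, map_smul, ha, hb, smul_comm])⟩
  refine ⟨y, ?_⟩
  rw [hy, map_smul] at ha
  rw [← sub_eq_zero]
  exact (smul_eq_zero.1 (by rw [smul_sub, ha, sub_self] : r • (φ y - X) = 0)).resolve_left hr

variable [Module.Finite R L]

/-- A normal order which is a full matrix algebra away from `q` is block triangular. -/
theorem IsUniformizing.exists_algHom_blockTriangular (hD : IsUniformizing R q.1.asIdeal z)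
    (hrad : Ring.jacobson (LocalisedAt R D q.1) =
      Ideal.span {(1 : Localization.AtPrime q.1.asIdeal) ⊗ₜ[R] z})
    (hdim : ringKrullDim R = 2) (hL : IsSaturated R L) {κ : Type*} [Fintype κ] [DecidableEq κ]
    [Nonempty κ] {φ : L →ₐ[R] Matrix κ κ D} (hφ : Function.Injective φ) {r : R} (hr : r ≠ 0)
    (h : ∀ X, ∃ a, φ a = r • X)
    (hsurj : ∀ p : CodimOnePrime R, p ≠ q → Function.Surjective (localisedMatrixHom p.1 φ))
    (hLq : HasPrincipalRadical (LocalisedAt R L q.1)) :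
    ∃ (e : ℕ) (n : Fin e → ℕ) (ψ : L →ₐ[R]
      Matrix (Σ j : Fin e, Fin (n j)) (Σ j : Fin e, Fin (n j)) D), 0 < e ∧ (∀ j, 0 < n j) ∧
      Function.Injective ψ ∧
      ∀ X, (∃ a, ψ a = X) ↔ X ∈ blockTriangular R (fun k => k.1.1) z hD.isNormal := by
  have hdom : IsDomain (Localization.AtPrime q.1.asIdeal) :=
    IsLocalization.isDomain_localization q.1.asIdeal.primeCompl_le_nonZeroDivisors
  have := isDiscreteValuationRing_of_height_eq_one q.1 q.2
  have := hD.finite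
  have := hD.torsionFree
  have := hD.isDomain
  have := nontrivial_localised (D := D) (p := q)
  have := isTorsionFree_localised (A := D) q.1
  have hf := hD.isResidueField hrad
  have := hf.nontrivial hD
  obtain ⟨r', hr', h'⟩ := exists_ne_zero_localisedMatrixHom_eq_smul (p := q) hr h
  obtain ⟨t, hJ, hT, hfull, hreg⟩ := exists_generator_jacobson hr' h' hLq
  have hnil := exists_pow_mem_jacobson_of_isNilpotent_residueMatrix
    (localisedMatrixHom_injective (p := q.1) φ hφ) hr' h'
  have hmem := mem_range_iff_forall_exists
    (ι := (localisedMatrixHom q.1 φ : LocalisedAt R L q.1 →+* Matrix κ κ (LocalisedAt R D q.1)))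
    hnil hT hJ hfull hreg
  obtain ⟨e, n, E, he, hn, hE⟩ := hf.exists_algEquiv hD hT
  have htf : Module.IsTorsionFree R (Matrix κ κ D) :=
    inferInstanceAs (Module.IsTorsionFree R (κ → κ → D))
  -- Membership in `L` is tested at height one primes only. At `q` it is preservation of the row
  -- spaces of powers of the residue of `t`, which `E` turns into block triangularity; elsewhere
  -- there is no condition.
  have key : ∀ X, (∃ a, φ a = X) ↔ E X ∈ blockTriangular R (fun k => k.1.1) z hD.isNormal := by
    intro X
    have h1 := NormalOrders.mem_range_localisedMatrixHom_iff (p := q.1) φ X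
    rw [hE]
    refine Iff.trans ?_ (hmem
      ((Algebra.TensorProduct.includeRight : D →ₐ[R] LocalisedAt R D q.1).mapMatrix X))
    refine Iff.trans ?_ h1.symm
    constructor
    · rintro ⟨a, rfl⟩
      exact ⟨1, fun h1 => q.1.isPrime.ne_top ((Ideal.eq_top_iff_one _).2 h1), a, (one_smul R _).symm⟩
    · intro hs
      refine exists_eq_of_forall_codimOnePrime (φ := φ.toLinearMap) hdim hL hφ hr (h X) fun p => ?_
      by_cases hp : p = q
      · subst hp
        exact hs
      · exact (NormalOrders.mem_range_localisedMatrixHom_iff (p := p.1) φ X).1 (hsurj p hp _)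
  refine ⟨e, n, E.toAlgHom.comp φ, he, hn, E.injective.comp hφ, fun X => ?_⟩
  have h2 := key (E.symm X)
  rw [E.apply_symm_apply] at h2
  rw [← h2]
  exact exists_congr fun a => E.eq_symm_apply.symm

end Global

/-! ### Degrees -/

section Degree

variable {R : Type u} [CommRing R] [IsDomain R]

theorem degree_congr {A B : Type v} [Ring A] [Algebra R A] [Ring B] [Algebra R B] (f : A ≃ₐ[R] B) :
    degree R A = degree R B := by
  rw [degree, degree, LinearEquiv.finrank_eq
    (f.toLinearEquiv.baseChange R (FractionRing R) A B)]

theorem degree_matrix {A : Type v} [Ring A] [Algebra R A] [Module.Finite R A] (n : ℕ) :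
    degree R (Matrix (Fin n) (Fin n) A) = n * degree R A := by
  have h1 : Module.finrank (FractionRing R) (FractionRing R ⊗[R] Matrix (Fin n) (Fin n) A) =
      n * (n * Module.finrank (FractionRing R) (FractionRing R ⊗[R] A)) := by
    have e : FractionRing R ⊗[R] Matrix (Fin n) (Fin n) A ≃ₗ[FractionRing R]
        Fin n → Fin n → FractionRing R ⊗[R] A :=
      (TensorProduct.piRight R (FractionRing R) (FractionRing R) fun _ : Fin n => Fin n → A).trans
        (LinearEquiv.piCongrRight fun _ =>
          TensorProduct.piRight R (FractionRing R) (FractionRing R) fun _ : Fin n => A)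
    rw [e.finrank_eq, Module.finrank_pi_fintype]
    simp only [Module.finrank_pi_fintype, Finset.sum_const, Finset.card_univ, Fintype.card_fin,
      smul_eq_mul]
  rw [degree, degree, h1, ← mul_assoc, Nat.cast_mul, Real.sqrt_mul (Nat.cast_nonneg _), Nat.cast_mul,
    Real.sqrt_mul_self (Nat.cast_nonneg _)]

theorem IsOrder.degree_ne_zero {A : Type v} [Ring A] [Algebra R A] (h : IsOrder R A) :
    degree R A ≠ 0 := by
  have := h.finite
  have := h.isSimple
  have : 0 < Module.finrank (FractionRing R) (FractionRing R ⊗[R] A) := Module.finrank_pos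
  rw [degree, Real.sqrt_ne_zero']
  exact_mod_cast this

theorem IsOrder.nontrivial {A : Type v} [Ring A] [Algebra R A] (h : IsOrder R A) : Nontrivial A := by
  have := h.isSimple
  by_contra hA
  rw [not_nontrivial_iff_subsingleton] at hA
  refine one_ne_zero (α := FractionRing R ⊗[R] A) ?_
  rw [Algebra.TensorProduct.one_def, Subsingleton.elim (1 : A) 0, TensorProduct.tmul_zero]

end Degree

/-! ### Matrices over the triangular order as block triangular matrices -/

section Matrices

variable {R : Type u} [CommRing R] {D : Type v} [Ring D] [Algebra R D] {z : D}

/-- Algebras with the same image under injective homomorphisms are isomorphic. -/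
theorem nonempty_algEquiv_of_range {A B C : Type*} [Ring A] [Algebra R A] [Ring B] [Algebra R B]
    [Ring C] [Algebra R C] {f : A →ₐ[R] C} {g : B →ₐ[R] C} (hf : Function.Injective f)
    (hg : Function.Injective g) (h : ∀ x, (∃ a, f a = x) ↔ ∃ b, g b = x) : Nonempty (A ≃ₐ[R] B) :=
  ⟨((AlgEquiv.ofInjective f hf).trans (Subalgebra.equivOfEq _ _ (SetLike.ext h))).trans
    (AlgEquiv.ofInjective g hg).symm⟩

variable [IsDomain R]

theorem exists_triangularModulo_iff {d : ℕ} (hz : IsNormalElement z) (X : Matrix (Fin d) (Fin d) D) :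
    (∃ a, (triangularModulo (R := R) d z hz).val a = X) ↔ X ∈ blockTriangular R Fin.val z hz := by
  constructor
  · rintro ⟨a, rfl⟩ i j hij
    obtain ⟨c, hc⟩ := a.2 i j hij
    exact ⟨c, hc.symm⟩
  · intro h
    exact ⟨⟨X, fun i j hij => by
      obtain ⟨c, hc⟩ := h i j hij
      exact ⟨c, hc.symm⟩⟩, rfl⟩

/-- A matrix algebra over the triangular order is block triangular. -/
theorem exists_algHom_matrix_triangularModulo (hz : IsNormalElement z) (d n : ℕ) :
    ∃ χ : Matrix (Fin n) (Fin n) (triangularModulo (R := R) d z hz) →ₐ[R]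
      Matrix (Σ _ : Fin d, Fin n) (Σ _ : Fin d, Fin n) D, Function.Injective χ ∧
      ∀ X, (∃ a, χ a = X) ↔ X ∈ blockTriangular R (fun k => k.1.1) z hz := by
  -- The position inside `Δ_d` becomes the outer index, so that it numbers the blocks.
  let ε : Fin n × Fin d ≃ Σ _ : Fin d, Fin n :=
    (Equiv.prodComm _ _).trans (Equiv.sigmaEquivProd _ _).symm
  let E : Matrix (Fin n) (Fin n) (Matrix (Fin d) (Fin d) D) ≃ₐ[R] _ :=
    (Matrix.compAlgEquiv (Fin n) (Fin d) D R).trans (Matrix.reindexAlgEquiv R D ε)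
  let χ := E.toAlgHom.comp (triangularModulo (R := R) d z hz).val.mapMatrix
  have hχ : ∀ M k l, χ M k l = (M k.2 l.2).1 k.1 l.1 := fun M k l => rfl
  refine ⟨χ, fun M N h => ?_, fun X => ⟨?_, fun hX => ?_⟩⟩
  · ext i j k l
    exact congrFun (congrFun h ⟨k, i⟩) ⟨l, j⟩
  · rintro ⟨M, rfl⟩ k l hkl
    rw [hχ]
    obtain ⟨c, hc⟩ := (M k.2 l.2).2 k.1 l.1 hkl
    exact ⟨c, hc.symm⟩
  · refine ⟨Matrix.of fun i j => ⟨Matrix.of fun k l => X ⟨k, i⟩ ⟨l, j⟩, fun k l hkl => ?_⟩, ?_⟩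
    · obtain ⟨c, hc⟩ := hX ⟨k, i⟩ ⟨l, j⟩ hkl
      exact ⟨c, hc.symm⟩
    · ext k l
      exact hχ _ k l

end Matrices

end NormalOrders

/-! ### The structure theorem -/

theorem mainTheorem4
    -- a noetherian normal two-dimensional Hensel local domain
    (R : Type u) [CommRing R] [IsDomain R] [IsNoetherianRing R] [IsIntegrallyClosed R]
    [HenselianLocalRing R] (hdim : ringKrullDim R = 2)
    -- a maximal order in a division ring, and a normal element `z` as required
    (D : Type v) [Ring D] [Algebra R D] (q : NormalOrders.CodimOnePrime R) (z : D)
    (hz : NormalOrders.IsNiceNormalElement q z) (d : ℕ) (hd : 0 < d)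
    -- a normal order with the same localised Brauer class as `Δ_d(z)`
    (L : Type v) [Ring L] [Algebra R L] (hL : NormalOrders.IsNormalOrder R L)
    (hclass : NormalOrders.localisedBrauerClass hL.isOrder =
      NormalOrders.localisedBrauerClass (hz.isOrder_triangularModulo hd)) :
    ∃ n : ℕ,
      NormalOrders.degree R L /
        NormalOrders.degree R (NormalOrders.triangularModulo (R := R) d z hz.isNormal) = n ∧
      Nonempty (L ≃ₐ[R]
        Matrix (Fin n) (Fin n) (NormalOrders.triangularModulo (R := R) d z hz.isNormal)) ∧
      NormalOrders.leftGlobalDimension L = 2 ∧ NormalOrders.rightGlobalDimension L = 2 := by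
  have hD := hz.isUniformizing hdim
  have := hz.isMaximalOrder.isOrder.finite
  have := hz.isMaximalOrder.isOrder.torsionFree
  have := hD.isDomain
  have := hL.isOrder.finite
  have := hL.isOrder.torsionFree
  have := hL.isOrder.nontrivial
  have hΔ := hz.isOrder_triangularModulo hd
  have := hΔ.finite
  have hbr : NormalOrders.brauerClass hL.isOrder = NormalOrders.brauerClass hΔ :=
    congrArg Prod.fst hclass
  have hidx : ∀ p, NormalOrders.localIndex R L p = NormalOrders.localIndex R
      (NormalOrders.triangularModulo (R := R) d z hz.isNormal) p :=
    fun p => congrFun (congrArg Prod.snd hclass) p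
  have hLsat : NormalOrders.IsSaturated R L := by
    have := hL.reflexive
    exact NormalOrders.IsSaturated.of_isReflexive (NormalOrders.isSaturated_self R hdim) L
  obtain ⟨N, φ, hφ, hφ'⟩ := hz.exists_algHom_matrix hdim hd hL.isOrder hbr
  have : Nonempty (Fin N) := by
    by_contra hN
    rw [not_nonempty_iff] at hN
    exact one_ne_zero (hφ (Subsingleton.elim (φ 1) (φ 0)))
  have : Nonempty (Fin d) := ⟨⟨0, hd⟩⟩
  have : Module.Finite R (Matrix (Fin N) (Fin N) D) :=
    inferInstanceAs (Module.Finite R (Fin N → Fin N → D))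
  obtain ⟨r, hr, hφr⟩ := NormalOrders.exists_uniform_denominator φ.toLinearMap hφ'
  have hval := NormalOrders.exists_triangularModulo_iff (R := R) (d := d) hD.isNormal
  have hvalinj : Function.Injective
      (NormalOrders.triangularModulo (R := R) d z hz.isNormal).val := Subtype.val_injective
  -- `Δ_d` is a full matrix algebra at `p ≠ q`, and having the same index forces the same for `L`.
  have hsurj : ∀ p : NormalOrders.CodimOnePrime R, p ≠ q →
      Function.Surjective (NormalOrders.localisedMatrixHom p.1 φ) := fun p hp =>
    NormalOrders.localisedMatrixHom_surjective_of_localIndex_eq hvalinj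
      (hD.localisedMatrixHom_surjective hval p hp) hφ hr hφr (hL.principal p) (hidx p)
  obtain ⟨e, n, ψ, he, hn, hψ, hψ'⟩ := hD.exists_algHom_blockTriangular hz.radical_eq hdim hLsat hφ
    hr hφr hsurj (hL.principal q)
  have hlt : ∀ k : (Σ j : Fin e, Fin (n j)), k.1.1 < e := fun k => k.1.2
  have hex : ∀ j < e, ∃ k : (Σ j : Fin e, Fin (n j)), k.1.1 = j := fun j hj =>
    ⟨⟨⟨j, hj⟩, ⟨0, hn _⟩⟩, rfl⟩
  -- Both numbers of blocks are read off as the index at `q`; for `Δ_d` the blocks are single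
  -- indices.
  have hde : e = d := by
    rw [← hD.localIndex_eq hz.radical_eq hψ hψ' hlt hex, hidx q]
    exact hD.localIndex_eq hz.radical_eq hvalinj hval (fun i => i.2) fun j hj => ⟨⟨j, hj⟩, rfl⟩
  subst hde
  -- Only here does principality of the radical at `q` bear on the sizes of the blocks rather than
  -- on their existence.
  have hcard : ∀ j : Fin e, n j = n ⟨0, he⟩ := by
    have h1 : ∀ j : Fin e, Nat.card {k : (Σ j : Fin e, Fin (n j)) // k.1.1 = j.1} = n j := by
      intro j
      simp only [Fin.val_inj]
      rw [Nat.card_congr (Equiv.sigmaSubtype j), Nat.card_fin]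
    intro j
    rw [← h1, ← h1]
    exact hD.card_block_eq hz.radical_eq hψ hψ' hlt hex (hL.principal q) j j.2
  obtain ⟨m, rfl⟩ : ∃ m : ℕ, n = fun _ => m := ⟨n ⟨0, he⟩, funext hcard⟩
  obtain ⟨χ, hχ, hχ'⟩ := NormalOrders.exists_algHom_matrix_triangularModulo (R := R) hz.isNormal e m
  obtain ⟨f⟩ := NormalOrders.nonempty_algEquiv_of_range hψ hχ fun X => (hψ' X).trans (hχ' X).symm
  obtain ⟨g⟩ := NormalOrders.nonempty_algEquiv_of_range
    (f := (NormalOrders.blockTriangular R (fun k : (Σ _ : Fin e, Fin m) => k.1.1) z hD.isNormal).val)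
    Subtype.val_injective hψ fun X => by
      rw [hψ']
      exact ⟨fun ⟨a, ha⟩ => ha ▸ a.2, fun h => ⟨⟨X, h⟩, rfl⟩⟩
  refine ⟨m, ?_, ⟨f⟩, hD.leftGlobalDimension_eq_two hdim q.2 he hlt hex hLsat g,
    hD.rightGlobalDimension_eq_two hdim q.2 he hlt hex hLsat g⟩
  rw [NormalOrders.degree_congr f, NormalOrders.degree_matrix, mul_div_assoc,
    div_self hΔ.degree_ne_zero, mul_one]
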